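/- **Setting.** Let $V=\{x=(x_{ki})_{1\le i\le k\le n}\}\cong\mathbb C^{n(n+1)/2}$ be the space of Gelfand–Tsetlin tableaux of order $n$. Let $\Gamma\cong\mathbb Z^{n(n-1)/2}$ be the free abelian group on the shifts $\sigma_{st}$, $1\le t\le s\le n-1$, where $\sigma_{st}$ acts on $V$ by adding $1$ to the entry $x_{st}$; let $\Gamma$ act on functions by $\sigma(f)=f\circ\sigma^{-1}$. Let $\mathcal R$ be the skew group ring of finite sums $\sum_i f_i\sigma_i$ ($f_i$ meromorphic on $V$, $\sigma_i\in\Gamma$) with $f\sigma\circ f'\sigma'=f\,\sigma(f')\,\sigma\sigma'$; it acts on functions by $F\mapsto \sum_i f_i\,\sigma_i(F)$. Let $\Phi$ be defined on generators of $\mathfrak{gl}_n(\mathbb C)$ by $$\Phi(E_{k,k+1})=-\sum_{i=1}^k\frac{\prod_{j=1}^{k+1}(x_{ki}-x_{k+1,j})}{\prod_{j\ne i}(x_{ki}-x_{kj})}\sigma_{ki}^{-1},\qquad \Phi(E_{k+1,k})=\sum_{i=1}^k\frac{\prod_{j=1}^{k-1}(x_{ki}-x_{k-1,j})}{\prod_{j\ne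 i}(x_{ki}-x_{kj})}\sigma_{ki},$$ $$\Phi(E_{kk})=\sum_{i=1}^k(x_{ki}+i-1)-\sum_{i=1}^{k-1}(x_{k-1,i}+i-1).$$ Let $o=(x^0_{st})\in V$ be a $1$-singular point: for one row $k$ and one pair $i\neq j$ we have $x^0_{ki}=x^0_{kj}$, and $x^0_{st}-x^0_{sr}\notin\mathbb Z$ for every other pair of distinct entries of one row. Put $z_1=x_{ki}-x_{kj}$ and $\frac{\partial}{\partial z_1}=\frac12\big(\frac{\partial}{\partial x_{ki}}-\frac{\partial}{\partial x_{kj}}\big)$. Let $\tau$ be the involution of $V$ interchanging the entries $x_{ki}$ and $x_{kj}$, and put $\tau(\sigma)=\tau\sigma\tau^{-1}$ for $\sigma\in\Gamma$. Put $\mathcal L=\mathrm{ev}_o\circ\frac{\partial}{\partial z_1}\cdot z_1$; for $A=\sum_i h_i\sigma_i\in\mathcal R$ with all $z_1h_i$ holomorphic at $o$, $\mathcal L\circ A$ is the linear functional $F\mapsto \frac{\partial}{\partial z_1}\big(z_1A(F)\big)(o)$ on entire functions $F$. Let $$D^1_\sigma=\mathcal L\circ(\sigma+\tau(\sigma)),\qquad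 D^2_{\sigma'}=\mathcal L\circ\frac{\sigma'-\tau(\sigma')}{z_1},\qquad \sigma,\sigma'\in\Gamma,$$ and let $M$ be the complex span of all $D^1_\sigma$, $D^2_{\sigma'}$. **Theorem.** 1. $D^1_{\tau(\sigma)}=D^1_\sigma$ and $D^2_{\tau(\sigma')}=-D^2_{\sigma'}$ for all $\sigma,\sigma'$, and all linear relations among the $D^1_\sigma,D^2_{\sigma'}$ are linear consequences of these. 2. $\Phi$ extends uniquely to a homomorphism of unital $\mathbb C$-algebras from $\mathcal U(\mathfrak{gl}_n(\mathbb C))$ to $\mathcal R$ with the opposite multiplication $A*B=B\circ A$. 3. There is a $\mathfrak{gl}_n(\mathbb C)$-module structure on $M$ in which $u\in\mathcal U(\mathfrak{gl}_n(\mathbb C))$ acts on $D^1_\sigma$ and $D^2_{\sigma'}$ by $D\mapsto D\circ\Phi(u)$. Explicitly, let $D=\mathcal L\circ B$ with $B=\sigma+\tau(\sigma)$ or $B=(\sigma'-\tau(\sigma'))/z_1$, write $B\circ\Phi(u)=\sum_i h_i\sigma_i$ and put $g_i=z_1h_i$. Then all $g_i$ are holomorphic at $o$, and $$u\cdot D=\mathcal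 L\circ\big(B\circ\Phi(u)\big)=\frac12\sum_i\Big(g_i(o)\,D^2_{\sigma_i}+\frac{\partial g_i}{\partial z_1}(o)\,D^1_{\sigma_i}\Big).$$ 4. This module is the universal $1$-singular Gelfand–Tsetlin module of Futorny, Grantcharov and Ramirez, in the following sense. For $X\in\mathfrak{gl}_n(\mathbb C)$ and $\sigma\in\Gamma$ write $\sigma\circ\Phi(X)=\sum_i a_i\sigma_i$. Then all $z_1a_i$ are holomorphic at $o$ and $$X\cdot D^1_\sigma=\sum_i\Big((z_1a_i)(o)\,D^2_{\sigma_i}+\frac{\partial (z_1a_i)}{\partial z_1}(o)\,D^1_{\sigma_i}\Big);$$ if $\tau(\sigma)\ne\sigma$, then all $a_i$ are holomorphic at $o$ and $$X\cdot D^2_\sigma=\sum_i\Big(a_i(o)\,D^2_{\sigma_i}+\frac{\partial a_i}{\partial z_1}(o)\,D^1_{\sigma_i}\Big).$$ Together with the relations in 1, these are the defining relations and the action of that module on its tableaux $T(\sigma^{-1}(o))=D^1_\sigma$ and derivative tableaux $\mathcal DT(\sigma^{-1}(o))=D^2_\sigma$. -/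

import Mathlib

open Filter Topology

attribute [local instance 100] LieRing.ofAssociativeRing

namespace GT

noncomputable section

/-! ### Tableaux, the shift group and the involution -/

/-- Positions of a triangular tableau of order `n`.  The position `⟨k, i⟩` (both counted from `0`)
is the entry in row `k + 1` and column `i + 1`; row `k + 1` has `k + 1` entries. -/
abbrev Idx (n : ℕ) : Type := Σ k : Fin n, Fin (k.val + 1)

/-- The complex vector space of Gelfand–Tsetlin tableaux of order `n`. -/
abbrev V (n : ℕ) : Type := Idx n → ℂ

/-- Positions outside the top row `n`. -/
abbrev Low (n : ℕ) : Type := {p : Idx n // p.1.val + 1 < n}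

/-- The free abelian group (written multiplicatively) on the elementary shifts `σ_{st}`,
`1 ≤ t ≤ s ≤ n - 1`. -/
abbrev Γ (n : ℕ) : Type := Multiplicative (Low n → ℤ)

/-- The integer tableau by which `σ` translates; its top row is zero. -/
def vec {n : ℕ} (σ : Γ n) (p : Idx n) : ℤ :=
  if h : p.1.val + 1 < n then σ.toAdd ⟨p, h⟩ else 0

/-- The action of the shift group on tableaux: `σ` translates by `vec σ`. -/
def shift {n : ℕ} (σ : Γ n) (x : V n) : V n := fun p => x p + (vec σ p : ℂ)

/-- The elementary shift, which adds `1` at the position `p` (outside the top row). -/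
def δ {n : ℕ} (p : Idx n) : Γ n := Multiplicative.ofAdd fun q => if q.1 = p then 1 else 0

/-- The conjugate `τ σ τ⁻¹` of the shift `σ` by the involution `τ` of the space of tableaux that
interchanges the entries at `a` and `b` (two positions in the same row): it is the translation by
the integer tableau of `σ` with these entries interchanged. -/
def conj {n : ℕ} (a b : Idx n) (σ : Γ n) : Γ n :=
  Multiplicative.ofAdd fun q => vec σ (Equiv.swap a b q.1)

/-- A `1`-singular tableau `o`, normalised so that its two critical entries, at the positions
`a ≠ b` of one row, coincide: two entries of one row never differ by an integer otherwise. -/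
def IsOneSingular {n : ℕ} (a b : Idx n) (o : V n) : Prop :=
  a.1 = b.1 ∧ a ≠ b ∧ o a = o b ∧
    ∀ p q : Idx n, p.1 = q.1 → p ≠ q → ¬(p = a ∧ q = b) → ¬(p = b ∧ q = a) →
      ∀ m : ℤ, o p - o q ≠ (m : ℂ)

theorem vec_mul {n : ℕ} (σ ρ : Γ n) (p : Idx n) : vec (σ * ρ) p = vec σ p + vec ρ p := by
  unfold vec; split <;> simp

theorem vec_one {n : ℕ} (p : Idx n) : vec (1 : Γ n) p = 0 := by
  unfold vec; split <;> simp

theorem shift_one {n : ℕ} (x : V n) : shift (1 : Γ n) x = x := by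
  funext p; simp [shift, vec_one]

theorem shift_mul {n : ℕ} (σ ρ : Γ n) (x : V n) : shift (σ * ρ) x = shift σ (shift ρ x) := by
  funext p; simp only [shift, vec_mul]; push_cast; ring

theorem analyticAt_shift {n : ℕ} (σ : Γ n) (x : V n) : AnalyticAt ℂ (shift σ) x := by
  have h : shift σ = fun x : V n => x + fun p => (vec σ p : ℂ) := by
    funext x p; simp [shift]
  rw [h]
  exact analyticAt_id.add analyticAt_const

/-! ### Entire and meromorphic functions -/

/-- The algebra of functions that are holomorphic on the whole space of tableaux. -/
def entireFunctions (n : ℕ) : Subalgebra ℂ (V n → ℂ) where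
  carrier := {f | AnalyticOnNhd ℂ f Set.univ}
  mul_mem' hf hg := hf.mul hg
  add_mem' hf hg := hf.add hg
  algebraMap_mem' _ := analyticOnNhd_const

/-- The type of entire functions on the space of tableaux. -/
def Entire (n : ℕ) : Type := ↥(entireFunctions n)

instance (n : ℕ) : CommRing (Entire n) := inferInstanceAs (CommRing ↥(entireFunctions n))

instance (n : ℕ) : Algebra ℂ (Entire n) := inferInstanceAs (Algebra ℂ ↥(entireFunctions n))

instance (n : ℕ) : Nontrivial (Entire n) := inferInstanceAs (Nontrivial ↥(entireFunctions n))

instance (n : ℕ) : CoeFun (Entire n) fun _ => V n → ℂ := ⟨fun f => f.1⟩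

theorem Entire.analyticAt {n : ℕ} (f : Entire n) (x : V n) :
    AnalyticAt ℂ f x := f.2 x (Set.mem_univ x)

/-- Germs of holomorphic functions at a point have no zero divisors. -/
theorem germ_eq_zero_or {n : ℕ} {f g : V n → ℂ} {o : V n} (hf : AnalyticAt ℂ f o)
    (hg : AnalyticAt ℂ g o) (h : ∀ᶠ x in 𝓝 o, f x * g x = 0) :
    (∀ᶠ x in 𝓝 o, f x = 0) ∨ ∀ᶠ x in 𝓝 o, g x = 0 := by
  obtain ⟨r, hr, hB⟩ := Metric.eventually_nhds_iff_ball.1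
    ((hf.eventually_analyticAt.and hg.eventually_analyticAt).and h)
  by_cases hz : ∃ y ∈ Metric.ball o r, f y ≠ 0
  · right
    obtain ⟨y, hy, hfy⟩ := hz
    have hg0 : g =ᶠ[𝓝 y] 0 := by
      filter_upwards [(hB y hy).1.1.continuousAt.eventually_ne hfy,
        Metric.isOpen_ball.mem_nhds hy] with x hx hxB
      exact (mul_eq_zero.1 (hB x hxB).2).resolve_left hx
    have hga : AnalyticOnNhd ℂ g (Metric.ball o r) := fun x hx => (hB x hx).1.2
    have := hga.eqOn_zero_of_preconnected_of_eventuallyEq_zero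
      (convex_ball o r).isPreconnected hy hg0
    filter_upwards [Metric.ball_mem_nhds o hr] with x hx using this hx
  · left
    push Not at hz
    filter_upwards [Metric.ball_mem_nhds o hr] with x hx using hz x hx

theorem Entire.eq_zero_of_eventually {n : ℕ} (f : Entire n) {o : V n}
    (h : ∀ᶠ x in 𝓝 o, f x = 0) : f = 0 := by
  have := f.2.eqOn_zero_of_preconnected_of_eventuallyEq_zero isPreconnected_univ
    (Set.mem_univ o) h
  exact Subtype.ext (funext fun x => this (Set.mem_univ x))

instance (n : ℕ) : IsDomain (Entire n) :=
  haveI : NoZeroDivisors (Entire n) := ⟨fun {f g} h => by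
    have h' : ∀ᶠ x in 𝓝 (0 : V n), f x * g x = 0 :=
      Eventually.of_forall fun x => congrFun (congrArg Subtype.val h) x
    exact (germ_eq_zero_or (f.analyticAt 0) (g.analyticAt 0) h').imp
      f.eq_zero_of_eventually g.eq_zero_of_eventually⟩
  NoZeroDivisors.to_isDomain _

/-- The field of meromorphic functions on the space of tableaux: on a complex vector space every
meromorphic function is a quotient of two entire functions. -/
abbrev Mero (n : ℕ) : Type := FractionRing (Entire n)

/-- Shifts act on entire functions by `σ(f) = f ∘ σ⁻¹`. -/
instance (n : ℕ) : MulSemiringAction (Γ n) (Entire n) where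
  smul σ f := ⟨fun x => f (shift σ⁻¹ x), fun x _ =>
    (f.analyticAt _).comp (analyticAt_shift σ⁻¹ x)⟩
  one_smul f := Subtype.ext <| funext fun x => by
    change f (shift (1 : Γ n)⁻¹ x) = _
    rw [inv_one, shift_one]
  mul_smul σ ρ f := Subtype.ext <| funext fun x => by
    change f (shift (σ * ρ)⁻¹ x) = f (shift ρ⁻¹ (shift σ⁻¹ x))
    rw [mul_inv_rev, shift_mul]
  smul_zero _ := rfl
  smul_add _ _ _ := rfl
  smul_one _ := rfl
  smul_mul _ _ _ := rfl

instance (n : ℕ) : SMulCommClass (Γ n) ℂ (Entire n) := ⟨fun _ _ _ => rfl⟩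

/-- Shifts act on meromorphic functions by `σ(f) = f ∘ σ⁻¹`. -/
instance (n : ℕ) : MulSemiringAction (Γ n) (Mero n) :=
  IsFractionRing.mulSemiringAction (Γ n) (Entire n) (Mero n)

instance (n : ℕ) : SMulDistribClass (Γ n) (Entire n) (Mero n) :=
  IsFractionRing.smulDistribClass (Γ n) (Entire n) (Mero n)

instance (n : ℕ) : SMulCommClass (Γ n) ℂ (Mero n) :=
  IsFractionRing.smulCommClass (Γ n) ℂ (Entire n) ℂ (Mero n)

/-- The coordinate function at the position `p`. -/
def coord {n : ℕ} (p : Idx n) : Entire n :=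
  ⟨fun x => x p, fun x _ => (ContinuousLinearMap.proj (R := ℂ) (φ := fun _ : Idx n => ℂ)
    p).analyticAt x⟩

/-- The coordinate function at `p`, as a meromorphic function. -/
def X {n : ℕ} (p : Idx n) : Mero n := algebraMap (Entire n) (Mero n) (coord p)

/-- `g` is holomorphic at `o` and represents the meromorphic function `h` near `o`. -/
def IsGerm {n : ℕ} (o : V n) (h : Mero n) (g : V n → ℂ) : Prop :=
  AnalyticAt ℂ g o ∧ ∃ p q : Entire n, q ≠ 0 ∧
    h * algebraMap (Entire n) (Mero n) q = algebraMap (Entire n) (Mero n) p ∧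
    ∀ᶠ x in 𝓝 o, g x * q x = p x

/-- The meromorphic function `h` is holomorphic at `o`. -/
def IsHol {n : ℕ} (o : V n) (h : Mero n) : Prop := ∃ g, IsGerm o h g

open Classical in
/-- A holomorphic function that represents `h` near `o` (zero if `h` is not holomorphic at `o`). -/
def rep {n : ℕ} (o : V n) (h : Mero n) : V n → ℂ :=
  if H : IsHol o h then H.choose else 0

/-- The value `h(o)` of a meromorphic function that is holomorphic at `o`. -/
def val {n : ℕ} (o : V n) (h : Mero n) : ℂ := rep o h o

/-- The direction of `∂/∂z₁ = (∂/∂x_a - ∂/∂x_b) / 2`, where `z₁ = x_a - x_b`. -/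
def dir {n : ℕ} (a b : Idx n) : V n := (1 / 2 : ℂ) • (Pi.single a 1 - Pi.single b 1)

/-- The derivative `∂h/∂z₁ (o)` of a meromorphic function that is holomorphic at `o`. -/
def dz {n : ℕ} (a b : Idx n) (o : V n) (h : Mero n) : ℂ := fderiv ℂ (rep o h) o (dir a b)

/-- The function `z₁ = x_a - x_b`. -/
def z {n : ℕ} (a b : Idx n) : Mero n := X a - X b

theorem IsGerm.unique {n : ℕ} {o : V n} {h : Mero n} {g g' : V n → ℂ} (hg : IsGerm o h g)
    (hg' : IsGerm o h g') : g =ᶠ[𝓝 o] g' := by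
  obtain ⟨ga, p, q, hq, hpq, hgq⟩ := hg
  obtain ⟨ga', p', q', hq', hpq', hgq'⟩ := hg'
  have key : p * q' = p' * q := by
    apply IsFractionRing.injective (Entire n) (Mero n)
    rw [map_mul, map_mul, ← hpq, ← hpq']
    ring
  have h0 : ∀ᶠ x in 𝓝 o, (g x - g' x) * (q * q' : Entire n) x = 0 := by
    filter_upwards [hgq, hgq'] with x h1 h2
    have h3 : p x * q' x = p' x * q x :=
      congrFun (congrArg Subtype.val key) x
    change (g x - g' x) * (q x * q' x) = 0
    rw [← h1, ← h2] at h3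
    linear_combination h3
  rcases germ_eq_zero_or (ga.sub ga') ((q * q' : Entire n).analyticAt o) h0 with h1 | h1
  · filter_upwards [h1] with x hx using sub_eq_zero.1 hx
  · exact absurd (Entire.eq_zero_of_eventually _ h1) (mul_ne_zero hq hq')

theorem IsHol.isGerm_rep {n : ℕ} {o : V n} {h : Mero n} (H : IsHol o h) :
    IsGerm o h (rep o h) := by
  unfold rep; rw [dif_pos H]; exact H.choose_spec

theorem IsGerm.rep_eq {n : ℕ} {o : V n} {h : Mero n} {g : V n → ℂ} (hg : IsGerm o h g) :
    rep o h =ᶠ[𝓝 o] g :=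
  (IsHol.isGerm_rep ⟨g, hg⟩).unique hg

theorem IsGerm.add {n : ℕ} {o : V n} {h h' : Mero n} {g g' : V n → ℂ} (hg : IsGerm o h g)
    (hg' : IsGerm o h' g') : IsGerm o (h + h') (g + g') := by
  obtain ⟨ga, p, q, hq, hpq, hgq⟩ := hg
  obtain ⟨ga', p', q', hq', hpq', hgq'⟩ := hg'
  refine ⟨ga.add ga', p * q' + p' * q, q * q', mul_ne_zero hq hq', ?_, ?_⟩
  · rw [map_add, map_mul, map_mul, map_mul, ← hpq, ← hpq']; ring
  · filter_upwards [hgq, hgq'] with x h1 h2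
    change (g x + g' x) * (q x * q' x) =
      p x * q' x + p' x * q x
    rw [← h1, ← h2]; ring

theorem IsGerm.mul {n : ℕ} {o : V n} {h h' : Mero n} {g g' : V n → ℂ} (hg : IsGerm o h g)
    (hg' : IsGerm o h' g') : IsGerm o (h * h') (g * g') := by
  obtain ⟨ga, p, q, hq, hpq, hgq⟩ := hg
  obtain ⟨ga', p', q', hq', hpq', hgq'⟩ := hg'
  refine ⟨ga.mul ga', p * p', q * q', mul_ne_zero hq hq', ?_, ?_⟩
  · rw [map_mul, map_mul, ← hpq, ← hpq']; ring
  · filter_upwards [hgq, hgq'] with x h1 h2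
    change (g x * g' x) * (q x * q' x) =
      p x * p' x
    rw [← h1, ← h2]; ring

theorem isGerm_algebraMap {n : ℕ} (o : V n) (F : Entire n) :
    IsGerm o (algebraMap (Entire n) (Mero n) F) F :=
  ⟨F.analyticAt o, F, 1, one_ne_zero, by simp, Eventually.of_forall fun x => mul_one _⟩

theorem dz_add {n : ℕ} (a b : Idx n) {o : V n} {h h' : Mero n} (H : IsHol o h)
    (H' : IsHol o h') : dz a b o (h + h') = dz a b o h + dz a b o h' := by
  have e := (H.isGerm_rep.add H'.isGerm_rep).rep_eq
  unfold dz
  rw [e.fderiv_eq, fderiv_add H.isGerm_rep.1.differentiableAt H'.isGerm_rep.1.differentiableAt]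
  rfl

theorem dz_smul {n : ℕ} (a b : Idx n) {o : V n} (c : ℂ) {h : Mero n} (H : IsHol o h) :
    dz a b o (c • h) = c * dz a b o h := by
  have e0 : c • h = algebraMap (Entire n) (Mero n) (algebraMap ℂ (Entire n) c) * h := by
    rw [← IsScalarTower.algebraMap_apply, Algebra.smul_def]
  have e := ((isGerm_algebraMap o (algebraMap ℂ (Entire n) c)).mul H.isGerm_rep).rep_eq
  rw [← e0] at e
  have e1 : ((algebraMap ℂ (Entire n) c : Entire n).1 * rep o h) = c • rep o h := rfl
  rw [e1] at e
  unfold dz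
  rw [e.fderiv_eq, fderiv_const_smul H.isGerm_rep.1.differentiableAt]
  rfl

theorem IsHol.add {n : ℕ} {o : V n} {h h' : Mero n} (H : IsHol o h) (H' : IsHol o h') :
    IsHol o (h + h') := ⟨_, H.isGerm_rep.add H'.isGerm_rep⟩

theorem IsHol.mul {n : ℕ} {o : V n} {h h' : Mero n} (H : IsHol o h) (H' : IsHol o h') :
    IsHol o (h * h') := ⟨_, H.isGerm_rep.mul H'.isGerm_rep⟩

theorem isHol_algebraMap {n : ℕ} (o : V n) (F : Entire n) :
    IsHol o (algebraMap (Entire n) (Mero n) F) := ⟨_, isGerm_algebraMap o F⟩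

theorem isHol_zero {n : ℕ} (o : V n) : IsHol o (0 : Mero n) := by
  simpa using isHol_algebraMap o (0 : Entire n)

theorem IsHol.smul {n : ℕ} {o : V n} (c : ℂ) {h : Mero n} (H : IsHol o h) :
    IsHol o (c • h) := by
  rw [Algebra.smul_def, IsScalarTower.algebraMap_apply ℂ (Entire n) (Mero n)]
  exact (isHol_algebraMap o _).mul H

theorem isHol_z {n : ℕ} (a b : Idx n) (o : V n) : IsHol o (z a b) := by
  unfold z X
  rw [← map_sub]
  exact isHol_algebraMap o _

/-! ### The skew group ring and its action -/

/-- The skew group ring of finite sums `∑ f_σ σ` with meromorphic coefficients; its product is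
`(f σ) (g ρ) = f σ(g) (σ ρ)`. -/
abbrev R (n : ℕ) : Type := SkewMonoidAlgebra (Mero n) (Γ n)

/-- The action of `∑ f_σ σ` on meromorphic functions: `F ↦ ∑ f_σ σ(F)`. -/
def act {n : ℕ} (A : R n) (F : Mero n) : Mero n := A.coeff.sum fun σ h => h * σ • F

/-- The elements `∑ h_σ σ` such that all `z₁ h_σ` are holomorphic at `o`. -/
def Adm {n : ℕ} (a b : Idx n) (o : V n) : Submodule ℂ (R n) where
  carrier := {A | ∀ σ, IsHol o (z a b * A.coeff σ)}
  zero_mem' σ := by simpa using isHol_zero o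
  add_mem' hA hB σ := by
    simpa [mul_add] using (hA σ).add (hB σ)
  smul_mem' c A hA σ := by
    simpa using (hA σ).smul c

theorem act_add {n : ℕ} (A B : R n) (F : Mero n) : act (A + B) F = act A F + act B F := by
  classical
  unfold act
  rw [SkewMonoidAlgebra.coeff_add]
  exact Finsupp.sum_add_index' (by simp) (by intros; ring)

theorem act_smul {n : ℕ} (c : ℂ) (A : R n) (F : Mero n) : act (c • A) F = c • act A F := by
  unfold act
  rw [SkewMonoidAlgebra.coeff_smul, Finsupp.sum_smul_index' (by simp), Finsupp.smul_sum]
  simp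

theorem act_add_right {n : ℕ} (A : R n) (F G : Mero n) :
    act A (F + G) = act A F + act A G := by
  simp [act, mul_add, Finsupp.sum_add]

theorem act_smul_right {n : ℕ} (c : ℂ) (A : R n) (F : Mero n) :
    act A (c • F) = c • act A F := by
  simp [act, Finsupp.smul_sum, smul_comm]

theorem isHol_act {n : ℕ} {a b : Idx n} {o : V n} {A : R n} (hA : A ∈ Adm a b o)
    (F : Entire n) : IsHol o (z a b * act A (algebraMap (Entire n) (Mero n) F)) := by
  unfold act Finsupp.sum
  rw [Finset.mul_sum]
  refine Finset.sum_induction _ (IsHol o) (fun _ _ => IsHol.add) (isHol_zero o) fun σ _ => ?_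
  rw [← mul_assoc, ← algebraMap.coe_smul']
  exact (hA σ).mul (isHol_algebraMap o _)

/-- For `A ∈ Adm a b o`, the functional `𝓛 ∘ A`, where `𝓛 = ev_o ∘ (∂/∂z₁) ∘ z₁`:
it sends an entire function `F` to the value at `o` of `∂/∂z₁ (z₁ A(F))`. -/
def Ldist {n : ℕ} (a b : Idx n) (o : V n) :
    Adm a b o →ₗ[ℂ] Module.Dual ℂ (Entire n) where
  toFun A :=
    { toFun := fun F => dz a b o (z a b * act A.1 (algebraMap (Entire n) (Mero n) F))
      map_add' := fun F G => by
        rw [map_add, act_add_right, mul_add, dz_add a b (isHol_act A.2 F) (isHol_act A.2 G)]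
      map_smul' := fun c F => by
        rw [Algebra.smul_def, map_mul, ← IsScalarTower.algebraMap_apply, ← Algebra.smul_def,
          act_smul_right, mul_smul_comm, dz_smul a b c (isHol_act A.2 F)]
        rfl }
  map_add' A B := by
    ext F
    change dz a b o (z a b * act (A.1 + B.1) _) = _
    rw [act_add, mul_add, dz_add a b (isHol_act A.2 F) (isHol_act B.2 F)]
    rfl
  map_smul' c A := by
    ext F
    change dz a b o (z a b * act (c • A.1) _) = _
    rw [act_smul, mul_smul_comm, dz_smul a b c (isHol_act A.2 F)]
    rfl

/-- The operator `σ + τ(σ)`. -/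
def op₁ {n : ℕ} (a b : Idx n) (σ : Γ n) : R n :=
  SkewMonoidAlgebra.single σ 1 + SkewMonoidAlgebra.single (conj a b σ) 1

/-- The operator `(σ - τ(σ)) / z₁`. -/
def op₂ {n : ℕ} (a b : Idx n) (σ : Γ n) : R n :=
  SkewMonoidAlgebra.single σ (z a b)⁻¹ - SkewMonoidAlgebra.single (conj a b σ) (z a b)⁻¹

theorem single_mem_Adm {n : ℕ} {a b : Idx n} {o : V n} {h : Mero n} (σ : Γ n)
    (H : IsHol o (z a b * h)) : SkewMonoidAlgebra.single σ h ∈ Adm a b o := by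
  classical
  intro ρ
  rw [SkewMonoidAlgebra.coeff_single_apply]
  split
  · exact H
  · simpa using isHol_zero o

theorem op₁_mem {n : ℕ} (a b : Idx n) (o : V n) (σ : Γ n) : op₁ a b σ ∈ Adm a b o := by
  have H : IsHol o (z a b * 1) := by simpa using isHol_z a b o
  exact Submodule.add_mem _ (single_mem_Adm _ H) (single_mem_Adm _ H)

theorem op₂_mem {n : ℕ} (a b : Idx n) (o : V n) (σ : Γ n) : op₂ a b σ ∈ Adm a b o := by
  have H : IsHol o (z a b * (z a b)⁻¹) := by
    by_cases hz : z a b = 0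
    · rw [hz, zero_mul]; exact isHol_zero o
    · rw [mul_inv_cancel₀ hz]; simpa using isHol_algebraMap o (1 : Entire n)
  exact Submodule.sub_mem _ (single_mem_Adm _ H) (single_mem_Adm _ H)

/-- `D¹_σ = 𝓛 ∘ (σ + τ(σ))`. -/
def D₁ {n : ℕ} (a b : Idx n) (o : V n) (σ : Γ n) : Module.Dual ℂ (Entire n) :=
  Ldist a b o ⟨op₁ a b σ, op₁_mem a b o σ⟩

/-- `D²_σ = 𝓛 ∘ ((σ - τ(σ)) / z₁)`. -/
def D₂ {n : ℕ} (a b : Idx n) (o : V n) (σ : Γ n) : Module.Dual ℂ (Entire n) :=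
  Ldist a b o ⟨op₂ a b σ, op₂_mem a b o σ⟩

/-- The span of all `D¹_σ` and `D²_σ`. -/
def spanD {n : ℕ} (a b : Idx n) (o : V n) : Submodule ℂ (Module.Dual ℂ (Entire n)) :=
  Submodule.span ℂ (Set.range (D₁ a b o) ∪ Set.range (D₂ a b o))

/-- `D¹_σ` as an element of the span. -/
def v₁ {n : ℕ} (a b : Idx n) (o : V n) (σ : Γ n) : spanD a b o :=
  ⟨D₁ a b o σ, Submodule.subset_span (Or.inl ⟨σ, rfl⟩)⟩

/-- `D²_σ` as an element of the span. -/
def v₂ {n : ℕ} (a b : Idx n) (o : V n) (σ : Γ n) : spanD a b o :=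
  ⟨D₂ a b o σ, Submodule.subset_span (Or.inr ⟨σ, rfl⟩)⟩

/-- The linear map from the vector space with basis the symbols `inl σ` and `inr σ` onto the span,
`inl σ ↦ D¹_σ`, `inr σ ↦ D²_σ`. -/
def symbolMap {n : ℕ} (a b : Idx n) (o : V n) : ((Γ n ⊕ Γ n) →₀ ℂ) →ₗ[ℂ] spanD a b o :=
  Finsupp.linearCombination ℂ (Sum.elim (v₁ a b o) (v₂ a b o))

/-- The space spanned by the relations `D¹_{τ(σ)} = D¹_σ` and `D²_{τ(σ)} = - D²_σ`. -/
def relations {n : ℕ} (a b : Idx n) : Submodule ℂ ((Γ n ⊕ Γ n) →₀ ℂ) :=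
  Submodule.span ℂ
    (Set.range (fun σ : Γ n =>
        Finsupp.single (Sum.inl (conj a b σ)) (1 : ℂ) - Finsupp.single (Sum.inl σ) 1) ∪
      Set.range (fun σ : Γ n =>
        Finsupp.single (Sum.inr (conj a b σ)) (1 : ℂ) + Finsupp.single (Sum.inr σ) 1))

/-- For `A = ∑ h_s s`, the combination `∑ (g_s(o) D²_s + ∂g_s/∂z₁(o) D¹_s)` with `g_s = f h_s`. -/
def expansion {n : ℕ} (a b : Idx n) (o : V n) (f : Mero n) (A : R n) : spanD a b o :=
  ∑ s ∈ A.support,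
    (val o (f * A.coeff s) • v₂ a b o s + dz a b o (f * A.coeff s) • v₁ a b o s)

/-! ### The Gelfand–Tsetlin homomorphism -/

/-- The positions of row `k`, where rows are counted from `1`; row `0` is empty. -/
def row (n k : ℕ) : Finset (Idx n) := Finset.univ.filter fun p => p.1.val + 1 = k

/-- The image of `E_{k,k+1}` under the Gelfand–Tsetlin formulas, for `1 ≤ k ≤ n - 1`. -/
def gtE (n k : ℕ) : R n :=
  -∑ p ∈ row n k, SkewMonoidAlgebra.single (δ p)⁻¹
    ((∏ q ∈ row n (k + 1), (X p - X q)) / ∏ q ∈ (row n k).erase p, (X p - X q))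

/-- The image of `E_{k+1,k}` under the Gelfand–Tsetlin formulas, for `1 ≤ k ≤ n - 1`. -/
def gtF (n k : ℕ) : R n :=
  ∑ p ∈ row n k, SkewMonoidAlgebra.single (δ p)
    ((∏ q ∈ row n (k - 1), (X p - X q)) / ∏ q ∈ (row n k).erase p, (X p - X q))

/-- The image of `E_{k,k}` under the Gelfand–Tsetlin formulas, for `1 ≤ k ≤ n`. Here `p.2` is the
column of `p`, counted from `0`. -/
def gtH (n k : ℕ) : R n :=
  SkewMonoidAlgebra.single 1
    (∑ p ∈ row n k, (X p + (p.2.val : Mero n)) - ∑ p ∈ row n (k - 1), (X p + (p.2.val : Mero n)))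

/-- The Lie algebra of complex `n × n` matrices. -/
abbrev Gl (n : ℕ) : Type := Matrix (Fin n) (Fin n) ℂ

/-- The universal enveloping algebra of `gl_n(ℂ)`. -/
abbrev U (n : ℕ) : Type := UniversalEnvelopingAlgebra ℂ (Gl n)

/-- `Φ`, a homomorphism from the enveloping algebra to the skew group ring with the opposite
multiplication `A * B = B ∘ A`, is given on the standard generators by the Gelfand–Tsetlin
formulas. The matrix unit with (zero-based) row `i` and column `j` is `E_{i+1,j+1}`. -/
def IsGTHom {n : ℕ} (Φ : U n →ₐ[ℂ] (R n)ᵐᵒᵖ) : Prop :=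
  (∀ i j : Fin n, i.val + 1 = j.val →
    Φ (UniversalEnvelopingAlgebra.ι ℂ (Matrix.single i j 1)) = MulOpposite.op (gtE n (i.val + 1)) ∧
    Φ (UniversalEnvelopingAlgebra.ι ℂ (Matrix.single j i 1)) = MulOpposite.op (gtF n (i.val + 1))) ∧
  ∀ i : Fin n,
    Φ (UniversalEnvelopingAlgebra.ι ℂ (Matrix.single i i 1)) = MulOpposite.op (gtH n (i.val + 1))

end

end GT

/-! The homomorphism. Brackets of simple root vectors in any Lie algebra satisfying the
Chevalley–Serre relations give candidates for all matrix units, hence a linear map from `Gl n`. By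
Jacobi, the matrices `x` for which this map intertwines `ad x` form a Lie subalgebra, so it suffices
to test `x` on the Chevalley generators; this is done in `e_root`, `f_root` and `h_root`. It remains
to verify the relations for the Gelfand–Tsetlin operators. Commutation and Serre relations are
identities between rational functions in two or three coordinates (`lie_lie_gen_left`,
`lie_lie_gen_right`). The relation between raising and lowering operators is Lagrange interpolation
(`sum_coef_mul_coef`).

The relations in the span. On `σ` alone, `𝓛` produces the value and the `z₁`-derivative of `F` at a
point of the orbit of `o`: `D₁` is a sum of two values, `D₂` a difference of two derivatives. Values
and first derivatives at distinct points are linearly independent (`eq_zero_of_sum_eq_zero`), so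
(anti)symmetry under the involution is the only source of relations.

The action. Each `Φ(x)`, `x` in `Gl n`, commutes with the involution `τ` and has at most simple
poles along `z₁ = 0` and no other poles on the orbit. For poles: every off-diagonal matrix unit is
an iterated bracket in which the singular generator occurs at most once (`glOp_mem_poleOps`). Let
`A` be a `τ`-invariant operator with simple poles, as `σ + τ(σ)` and `(σ - τ(σ)) / z₁` are. In `A ∘
Φ(x)` a double pole might arise from a coefficient `A_σ` times `σ` of a coefficient of `Φ(x)`. If
`τ(σ) ≠ σ`, then `σ(z₁)` is nonzero at `o`, so the second factor is regular. If `τ(σ) = σ`, then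
`A_σ` is `τ`-invariant, and an invariant function cannot have a simple pole along `z₁ = 0`, because
`z₁ A_σ` is odd. The product therefore has simple poles again. The same dichotomy shows that right
multiplication preserves the kernel of `A ↦ 𝓛 ∘ A`, so `D ↦ D ∘ Φ(x)` is well defined. Operators
with both stability properties form an algebra, which passes from `gl_n` to its enveloping algebra.

For a holomorphic `h` the quotient `(h - τ(h)) / z₁` is used throughout; its holomorphy is carried
along as part of the subalgebra `reg`, which contains the coordinates and the inverses that occur.
-/

namespace GT

/-! ### The Chevalley–Serre presentation of `gl_n` -/

/-- Elements of a Lie algebra that satisfy the Chevalley–Serre relations of `gl_n`. -/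
structure ChevalleyData (n : ℕ) (L : Type*) [LieRing L] [LieAlgebra ℂ L] where
  e : ℕ → L
  f : ℕ → L
  h : ℕ → L
  h_h : ∀ i j, i < n → j < n → ⁅h i, h j⁆ = 0
  h_e : ∀ i j, i < n → j + 1 < n →
    ⁅h i, e j⁆ = ((if i = j then 1 else 0) - (if i = j + 1 then 1 else 0) : ℂ) • e j
  h_f : ∀ i j, i < n → j + 1 < n →
    ⁅h i, f j⁆ = ((if i = j + 1 then 1 else 0) - (if i = j then 1 else 0) : ℂ) • f j
  e_f : ∀ i j, i + 1 < n → j + 1 < n → i ≠ j → ⁅e i, f j⁆ = 0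
  e_f_self : ∀ i, i + 1 < n → ⁅e i, f i⁆ = h i - h (i + 1)
  e_e : ∀ i j, i + 2 ≤ j → j + 1 < n → ⁅e i, e j⁆ = 0
  f_f : ∀ i j, i + 2 ≤ j → j + 1 < n → ⁅f i, f j⁆ = 0
  e_e_e : ∀ i, i + 2 < n → ⁅e i, ⁅e i, e (i + 1)⁆⁆ = 0
  e_e_e' : ∀ i, i + 2 < n → ⁅e (i + 1), ⁅e (i + 1), e i⁆⁆ = 0
  f_f_f : ∀ i, i + 2 < n → ⁅f i, ⁅f i, f (i + 1)⁆⁆ = 0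
  f_f_f' : ∀ i, i + 2 < n → ⁅f (i + 1), ⁅f (i + 1), f i⁆⁆ = 0

namespace ChevalleyData

variable {n : ℕ} {L : Type*} [LieRing L] [LieAlgebra ℂ L] (D : ChevalleyData n L)

/-- The data twisted by the Chevalley involution. -/
def dual : ChevalleyData n L where
  e i := -D.f i
  f i := -D.e i
  h i := -D.h i
  h_h i j hi hj := by simp [D.h_h i j hi hj]
  h_e i j hi hj := by
    rw [neg_lie, lie_neg, neg_neg, D.h_f i j hi hj, smul_neg, ← neg_smul]; congr 1; ring
  h_f i j hi hj := by
    rw [neg_lie, lie_neg, neg_neg, D.h_e i j hi hj, smul_neg, ← neg_smul]; congr 1; ring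
  e_f i j hi hj hij := by
    rw [neg_lie, lie_neg, neg_neg, ← lie_skew, D.e_f j i hj hi hij.symm, neg_zero]
  e_f_self i hi := by
    rw [neg_lie, lie_neg, neg_neg, ← lie_skew, D.e_f_self i hi]; abel
  e_e i j h hj := by simp [D.f_f i j h hj]
  f_f i j h hj := by simp [D.e_e i j h hj]
  e_e_e i h := by simp [D.f_f_f i h]
  e_e_e' i h := by simp [D.f_f_f' i h]
  f_f_f i h := by simp [D.e_e_e i h]
  f_f_f' i h := by simp [D.e_e_e' i h]

/-- The element `E_{i, i + d + 1}`, as an iterated bracket of simple root vectors. -/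
def up : ℕ → ℕ → L
  | i, 0 => D.e i
  | i, d + 1 => ⁅D.e i, up (i + 1) d⁆

@[simp] theorem up_zero (i : ℕ) : D.up i 0 = D.e i := rfl

theorem up_succ (i d : ℕ) : D.up i (d + 1) = ⁅D.e i, D.up (i + 1) d⁆ := rfl

theorem e_up_far (j i d : ℕ) (hj : j + 1 < n) (hd : i + d + 1 < n)
    (h : i + d + 2 ≤ j ∨ j + 2 ≤ i) : ⁅D.e j, D.up i d⁆ = 0 := by
  induction d generalizing i with
  | zero =>
    rcases h with h | h
    · rw [up_zero, ← lie_skew, D.e_e i j (by omega) hj, neg_zero]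
    · exact D.e_e j i h hd
  | succ d ih =>
    rw [up_succ, leibniz_lie, ih (i + 1) (by omega) (by omega), lie_zero, add_zero]
    rcases h with h | h
    · rw [← lie_skew (D.e j), D.e_e i j (by omega) hj, neg_zero, zero_lie]
    · rw [D.e_e j i h (by omega), zero_lie]

theorem e_up_right (i d : ℕ) (hd : i + d + 2 < n) :
    ⁅D.e (i + d + 1), D.up i d⁆ = -D.up i (d + 1) := by
  induction d generalizing i with
  | zero => rw [up_succ, up_zero, up_zero, lie_skew]
  | succ d ih =>
    rw [up_succ, leibniz_lie, ← lie_skew (D.e _) (D.e i), D.e_e i _ (by omega) (by omega),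
      neg_zero, zero_lie, zero_add, show i + (d + 1) + 1 = i + 1 + d + 1 by ring,
      ih (i + 1) (by omega), lie_neg, ← up_succ]

theorem up_succ' (i d : ℕ) (hd : i + d + 2 < n) :
    D.up i (d + 1) = -⁅D.e (i + d + 1), D.up i d⁆ := by
  rw [D.e_up_right i d hd, neg_neg]

/-- Length two is a Serre relation. A longer root vector is rebuilt from its right end, where the
last simple root vector commutes with `D.e i`. -/
theorem e_up_left (i d : ℕ) (hd : i + d + 1 < n) : ⁅D.e i, D.up i d⁆ = 0 := by
  induction d with
  | zero => exact lie_self _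
  | succ d ih =>
    rcases d with _ | d
    · exact D.e_e_e i (by omega)
    · rw [D.up_succ' i (d + 1) (by omega), lie_neg, leibniz_lie, ih (by omega), lie_zero,
        D.e_e i _ (by omega) (by omega), zero_lie, add_zero, neg_zero]

theorem e_up_last (i d : ℕ) (hd : i + d + 1 < n) : ⁅D.e (i + d), D.up i d⁆ = 0 := by
  induction d generalizing i with
  | zero => exact lie_self _
  | succ d ih =>
    rcases d with _ | d
    · rw [up_succ, up_zero, ← lie_skew (D.e i), lie_neg, zero_add, D.e_e_e' i (by omega), neg_zero]
    · rw [up_succ, leibniz_lie, ← lie_skew (D.e _) (D.e i), D.e_e i _ (by omega) (by omega),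
        neg_zero, zero_lie, zero_add, show i + (d + 1 + 1) = i + 1 + (d + 1) by ring,
        ih (i + 1) (by omega), lie_zero]

/-- Bracketing the length-three vector from either side, both Serre relations at the middle node
give the same element with opposite signs, so twice the bracket is zero. -/
theorem e_up_two (i : ℕ) (hd : i + 3 < n) : ⁅D.e (i + 1), D.up i 2⁆ = 0 := by
  have hx : ⁅D.e i, D.e (i + 2)⁆ = 0 := D.e_e i (i + 2) le_rfl hd
  have h1 : ⁅D.e (i + 1), ⁅D.e (i + 1), D.e (i + 2)⁆⁆ = 0 := D.e_e_e (i + 1) hd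
  have h2 : ⁅D.e (i + 1), ⁅D.e i, D.e (i + 1)⁆⁆ = 0 := by
    rw [← lie_skew (D.e i), lie_neg, D.e_e_e' i (by omega), neg_zero]
  have e1 : D.up i 2 = ⁅D.e i, ⁅D.e (i + 1), D.e (i + 2)⁆⁆ := rfl
  have e2 : D.up i 2 = ⁅⁅D.e i, D.e (i + 1)⁆, D.e (i + 2)⁆ := by
    rw [e1, leibniz_lie, hx, lie_zero, add_zero]
  have c1 : ⁅D.e (i + 1), D.up i 2⁆ =
      -⁅⁅D.e i, D.e (i + 1)⁆, ⁅D.e (i + 1), D.e (i + 2)⁆⁆ := by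
    rw [e1, leibniz_lie, h1, lie_zero, add_zero, ← neg_lie, lie_skew]
  have c2 : ⁅D.e (i + 1), D.up i 2⁆ =
      ⁅⁅D.e i, D.e (i + 1)⁆, ⁅D.e (i + 1), D.e (i + 2)⁆⁆ := by
    rw [e2, leibniz_lie, h2, zero_lie, zero_add]
  have c3 : (2 : ℂ) • ⁅D.e (i + 1), D.up i 2⁆ = 0 := by
    rw [two_smul]; nth_rewrite 1 [c1]; rw [c2, neg_add_cancel]
  exact (smul_eq_zero.1 c3).resolve_left two_ne_zero

/-- Simple roots not adjacent to `j` can be stripped from either end until `j` is the middle of a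
root of length three. -/
theorem e_up_mid (j i d : ℕ) (hd : i + d + 1 < n) (h1 : i < j) (h2 : j < i + d) :
    ⁅D.e j, D.up i d⁆ = 0 := by
  induction d generalizing i with
  | zero => omega
  | succ d ih =>
    by_cases hj : i + 2 ≤ j
    · rw [up_succ, leibniz_lie, ← lie_skew (D.e _) (D.e i), D.e_e i _ hj (by omega),
        neg_zero, zero_lie, zero_add, ih (i + 1) (by omega) (by omega) (by omega), lie_zero]
    · obtain rfl : j = i + 1 := by omega
      rcases Nat.lt_or_ge d 2 with hd' | hd'
      · obtain rfl : d = 1 := by omega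
        exact D.e_up_two i (by omega)
      · rw [D.up_succ' i d (by omega), lie_neg, leibniz_lie, ih i (by omega) (by omega) (by omega),
          lie_zero, D.e_e (i + 1) _ (by omega) (by omega), zero_lie, add_zero, neg_zero]

theorem h_up (j i d : ℕ) (hj : j < n) (hd : i + d + 1 < n) :
    ⁅D.h j, D.up i d⁆ =
      ((if j = i then 1 else 0) - (if j = i + d + 1 then 1 else 0) : ℂ) • D.up i d := by
  induction d generalizing i with
  | zero => exact D.h_e j i hj hd
  | succ d ih =>
    rw [up_succ, leibniz_lie, D.h_e j i hj (by omega), ih (i + 1) (by omega), smul_lie, lie_smul,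
      ← add_smul, show i + 1 + d + 1 = i + (d + 1) + 1 by ring]
    congr 1; ring

theorem f_e (j i : ℕ) (hj : j + 1 < n) (hi : i + 1 < n) (hij : j ≠ i) :
    ⁅D.f j, D.e i⁆ = 0 := by
  rw [← lie_skew, D.e_f i j hi hj hij.symm, neg_zero]

theorem f_e_self (i : ℕ) (hi : i + 1 < n) : ⁅D.f i, D.e i⁆ = D.h (i + 1) - D.h i := by
  rw [← lie_skew, D.e_f_self i hi, neg_sub]

/-- The three claims go by a joint induction: removing the first simple root turns an inner index `i
+ 1` into a left end. Both end cases come from `⁅f, e⁆` being a difference of Cartan elements, on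
which the remaining root vector has weight one. -/
theorem f_up_aux (d : ℕ) : ∀ i, i + d + 1 < n →
    (∀ j, j + 1 < n → j ≠ i → j ≠ i + d → ⁅D.f j, D.up i d⁆ = 0) ∧
    (1 ≤ d → ⁅D.f i, D.up i d⁆ = D.up (i + 1) (d - 1)) ∧
    (1 ≤ d → ⁅D.f (i + d), D.up i d⁆ = -D.up i (d - 1)) := by
  induction d with
  | zero =>
    intro i hi
    exact ⟨fun j hj h _ => D.f_e j i hj hi h, by omega, by omega⟩
  | succ d ih =>
    intro i hi
    refine ⟨fun j hj h1 h2 => ?_, fun _ => ?_, fun _ => ?_⟩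
    · rw [up_succ, leibniz_lie, D.f_e j i hj (by omega) h1, zero_lie, zero_add]
      by_cases hj' : j = i + 1
      · subst hj'
        rw [(ih (i + 1) (by omega)).2.1 (by omega), D.e_up_far _ _ _ (by omega) (by omega)
          (Or.inr (by omega))]
      · rw [(ih (i + 1) (by omega)).1 j hj hj' (by omega), lie_zero]
    · rw [up_succ, leibniz_lie, D.f_e_self i (by omega),
        (ih (i + 1) (by omega)).1 i (by omega) (by omega) (by omega), lie_zero, add_zero, sub_lie,
        D.h_up _ _ _ (by omega) (by omega), D.h_up _ _ _ (by omega) (by omega),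
        if_pos rfl, if_neg (by omega), if_neg (by omega), if_neg (by omega)]
      simp
    · rw [D.up_succ' i d (by omega), lie_neg, leibniz_lie, show i + (d + 1) = i + d + 1 by ring,
        D.f_e_self _ (by omega), (ih i (by omega)).1 _ (by omega) (by omega) (by omega), lie_zero,
        add_zero, sub_lie,
        D.h_up _ _ _ (by omega) (by omega), D.h_up _ _ _ (by omega) (by omega),
        if_neg (by omega), if_neg (by omega), if_neg (by omega), if_pos rfl]
      simp

/-- The element `E_{i,j}`. -/
def root (i j : ℕ) : L :=
  if i < j then D.up i (j - i - 1) else if i = j then D.h i else -D.dual.up j (i - j - 1)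

theorem root_self (i : ℕ) : D.root i i = D.h i := by simp [root]

theorem root_of_lt {i j : ℕ} (h : i < j) : D.root i j = D.up i (j - i - 1) := if_pos h

theorem root_add (i d : ℕ) : D.root i (i + d + 1) = D.up i d := by
  rw [D.root_of_lt (by omega)]; congr 1; omega

theorem root_of_gt {i j : ℕ} (h : j < i) : D.root i j = -D.dual.up j (i - j - 1) := by
  rw [root, if_neg (by omega), if_neg (by omega)]

theorem dual_dual : D.dual.dual = D := by
  cases D; simp [dual]

/-- The Chevalley involution acts as minus transpose, so brackets with negative root vectors follow
from those with positive ones. -/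
theorem root_dual (i j : ℕ) : D.dual.root i j = -D.root j i := by
  rcases lt_trichotomy i j with h | h | h
  · rw [D.dual.root_of_lt h, D.root_of_gt h, neg_neg]
  · subst h; rw [root_self, root_self]; rfl
  · rw [D.dual.root_of_gt h, D.root_of_lt h, dual_dual]

theorem h_root (j k l : ℕ) (hj : j < n) (hk : k < n) (hl : l < n) :
    ⁅D.h j, D.root k l⁆ =
      ((if j = k then 1 else 0) - (if j = l then 1 else 0) : ℂ) • D.root k l := by
  rcases lt_trichotomy k l with h | h | h
  · obtain ⟨d, rfl⟩ : ∃ d, l = k + d + 1 := ⟨l - k - 1, by omega⟩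
    rw [root_add, D.h_up _ _ _ hj hl]
  · subst h; rw [root_self, sub_self, zero_smul, D.h_h _ _ hj hk]
  · obtain ⟨d, rfl⟩ : ∃ d, k = l + d + 1 := ⟨k - l - 1, by omega⟩
    have := D.dual.h_up j l d hj hk
    rw [D.root_of_gt h, show l + d + 1 - l - 1 = d by omega, lie_neg, ← neg_lie]
    rw [show -D.h j = D.dual.h j from rfl, this, smul_neg, ← neg_smul]
    congr 1; ring

theorem e_root (j k l : ℕ) (hj : j + 1 < n) (hk : k < n) (hl : l < n) :
    ⁅D.e j, D.root k l⁆ =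
      (if j + 1 = k then D.root j l else 0) - (if l = j then D.root k (j + 1) else 0) := by
  rcases lt_trichotomy k l with h | h | h
  · obtain ⟨d, rfl⟩ : ∃ d, l = k + d + 1 := ⟨l - k - 1, by omega⟩
    rw [root_add]
    by_cases h1 : j + 1 = k
    · subst h1
      rw [if_pos rfl, if_neg (by omega), sub_zero,
        show j + 1 + d + 1 = j + (d + 1) + 1 by ring, root_add, up_succ]
    rw [if_neg h1]
    by_cases h2 : k + d + 1 = j
    · subst h2
      rw [if_pos rfl, D.e_up_right _ _ (by omega), zero_sub,
        show k + d + 1 + 1 = k + (d + 1) + 1 by ring, root_add]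
    rw [if_neg h2, sub_zero]
    by_cases h3 : j = k
    · subst h3; exact D.e_up_left _ _ hl
    by_cases h4 : j = k + d
    · subst h4; exact D.e_up_last _ _ hl
    by_cases h5 : k < j ∧ j < k + d
    · exact D.e_up_mid _ _ _ hl h5.1 h5.2
    · exact D.e_up_far _ _ _ hj hl (by omega)
  · subst h
    rw [root_self, ← lie_skew, D.h_e _ _ hk hj]
    by_cases h1 : k = j
    · subst h1
      rw [if_pos rfl, if_neg (by omega), if_neg (by omega), if_pos rfl, D.root_add k 0]
      simp
    · by_cases h2 : k = j + 1
      · subst h2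
        rw [if_neg (by omega), if_pos rfl, if_pos rfl, if_neg (by omega), D.root_add j 0]
        simp
      · rw [if_neg h1, if_neg h2, if_neg (by omega), if_neg h1]; simp
  · obtain ⟨d, rfl⟩ : ∃ d, k = l + d + 1 := ⟨k - l - 1, by omega⟩
    have key := D.dual.f_up_aux d l hk
    rw [D.root_of_gt h, show l + d + 1 - l - 1 = d by omega, lie_neg, ← neg_lie,
      show -D.e j = D.dual.f j from rfl]
    -- For a negative simple root both indicators on the right can be nonzero at once, and they give
    -- the difference of two Cartan elements.
    rcases Nat.eq_zero_or_pos d with rfl | hd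
    · by_cases hjl : j = l
      · subst hjl
        rw [if_pos rfl, if_pos rfl, root_self, root_self, up_zero, D.dual.f_e_self j hj]
        change -D.h (j + 1) - -D.h j = _
        abel
      · rw [if_neg (by omega), if_neg (Ne.symm hjl), key.1 j hj hjl (by omega), sub_zero]
    · by_cases h1 : j = l
      · subst h1
        rw [if_neg (by omega), if_pos rfl, key.2.1 hd, zero_sub, D.root_of_gt (by omega),
          neg_neg]
        congr 1; omega
      · by_cases h2 : j = l + d
        · subst h2
          rw [if_pos rfl, if_neg (by omega), key.2.2 hd, sub_zero, D.root_of_gt (by omega)]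
          congr 2; omega
        · rw [if_neg (by omega), if_neg (Ne.symm h1), sub_zero, key.1 j hj h1 h2]

theorem f_root (j k l : ℕ) (hj : j + 1 < n) (hk : k < n) (hl : l < n) :
    ⁅D.f j, D.root k l⁆ =
      (if j = k then D.root (j + 1) l else 0) - (if l = j + 1 then D.root k j else 0) := by
  have key := D.dual.e_root j l k hj hl hk
  rw [root_dual, root_dual, root_dual] at key
  change ⁅-D.f j, -D.root k l⁆ = _ at key
  rw [neg_lie, lie_neg, neg_neg] at key
  rw [key]
  by_cases h1 : j = k <;> by_cases h2 : l = j + 1 <;>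
    simp [h1, h2, eq_comm] <;> grind

/-- The linear map from `gl_n` that sends the matrix units to the elements `E_{i,j}`. -/
noncomputable def linHom : Gl n →ₗ[ℂ] L where
  toFun x := ∑ i, ∑ j, x i j • D.root i j
  map_add' x y := by simp [add_smul, Finset.sum_add_distrib]
  map_smul' c x := by simp [mul_smul, Finset.smul_sum]

theorem linHom_apply (x : Gl n) : D.linHom x = ∑ i, ∑ j, x i j • D.root i j := rfl

theorem linHom_single (i j : Fin n) : D.linHom (Matrix.single i j 1) = D.root i j := by
  rw [linHom_apply, Finset.sum_eq_single i, Finset.sum_eq_single j]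
  · rw [Matrix.single_apply_same, one_smul]
  · intro l _ hl
    rw [Matrix.single_apply, if_neg fun h => hl h.2.symm, zero_smul]
  · simp
  · intro k _ hk
    refine Finset.sum_eq_zero fun l _ => ?_
    rw [Matrix.single_apply, if_neg fun h => hk h.1.symm, zero_smul]
  · simp

end ChevalleyData

/-! ### Generation of `gl_n` by matrix units near the diagonal -/

theorem lie_single {n : ℕ} (i j k l : Fin n) :
    ⁅(Matrix.single i j 1 : Gl n), (Matrix.single k l 1 : Gl n)⁆ =
      (if j = k then Matrix.single i l 1 else 0) - (if l = i then Matrix.single k j 1 else 0) := by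
  rw [LieRing.of_associative_ring_bracket]
  congr 1
  · split_ifs with h
    · subst h; simp
    · simp [h]
  · split_ifs with h
    · subst h; simp
    · simp [h]

/-- Closure under brackets of superdiagonal units gives all units above the diagonal. -/
theorem single_mem_of_lt {n : ℕ} (S : LieSubalgebra ℂ (Gl n)) {k l : Fin n} (hkl : k < l)
    (h : ∀ i j : Fin n, k ≤ i → j ≤ l → i.val + 1 = j.val → Matrix.single i j 1 ∈ S) :
    Matrix.single k l 1 ∈ S := by
  obtain ⟨d, hd⟩ : ∃ d, l.val = k.val + d + 1 := ⟨l - k - 1, by omega⟩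
  induction d generalizing k with
  | zero => exact h k l le_rfl le_rfl (by omega)
  | succ d ih =>
    let k' : Fin n := ⟨k + 1, by omega⟩
    have h1 := ih (k := k') (Fin.lt_def.2 (by simp [k']; omega))
      (fun i j hi hj => h i j (Fin.le_def.2 (by have := Fin.le_def.1 hi; simp [k'] at this; omega))
        hj) (by simp [k']; omega)
    have h2 := h k k' le_rfl (Fin.le_def.2 (by simp [k']; omega)) rfl
    have h3 := S.lie_mem h2 h1
    rw [lie_single, if_pos rfl, if_neg hkl.ne', sub_zero] at h3
    exact h3

/-- Only generators with indices between `k` and `l` are assumed to lie in `S`; the pole estimate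
needs this to keep the singular generator out. -/
theorem single_mem_of_gt {n : ℕ} (S : LieSubalgebra ℂ (Gl n)) {k l : Fin n} (hkl : k < l)
    (h : ∀ i j : Fin n, k ≤ i → j ≤ l → i.val + 1 = j.val → Matrix.single j i 1 ∈ S) :
    Matrix.single l k 1 ∈ S := by
  obtain ⟨d, hd⟩ : ∃ d, l.val = k.val + d + 1 := ⟨l - k - 1, by omega⟩
  induction d generalizing k with
  | zero => exact h k l le_rfl le_rfl (by omega)
  | succ d ih =>
    let k' : Fin n := ⟨k + 1, by omega⟩
    have h1 := ih (k := k') (Fin.lt_def.2 (by simp [k']; omega))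
      (fun i j hi hj => h i j (Fin.le_def.2 (by have := Fin.le_def.1 hi; simp [k'] at this; omega))
        hj) (by simp [k']; omega)
    have h2 := h k k' le_rfl (Fin.le_def.2 (by simp [k']; omega)) rfl
    have h3 := S.lie_mem h1 h2
    rw [lie_single, if_pos rfl, if_neg hkl.ne, sub_zero] at h3
    exact h3

theorem mem_of_single_mem {n : ℕ} (S : Submodule ℂ (Gl n))
    (h : ∀ i j : Fin n, Matrix.single i j 1 ∈ S) (x : Gl n) : x ∈ S := by
  rw [Matrix.matrix_eq_sum_single x]
  refine S.sum_mem fun i _ => S.sum_mem fun j _ => ?_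
  have := S.smul_mem (x i j) (h i j)
  rwa [Matrix.smul_single, smul_eq_mul, mul_one] at this

/-- The matrix units on the three central diagonals generate `gl_n` as a Lie algebra. -/
theorem mem_of_generators_mem {n : ℕ} (S : LieSubalgebra ℂ (Gl n))
    (he : ∀ i j : Fin n, i.val + 1 = j.val → Matrix.single i j 1 ∈ S ∧ Matrix.single j i 1 ∈ S)
    (hh : ∀ i : Fin n, Matrix.single i i 1 ∈ S) (x : Gl n) : x ∈ S := by
  refine mem_of_single_mem S.toSubmodule (fun i j => ?_) x
  rcases lt_trichotomy i j with h | h | h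
  · exact single_mem_of_lt S h fun i j _ _ hij => (he i j hij).1
  · subst h; exact hh i
  · exact single_mem_of_gt S h fun i j _ _ hij => (he i j hij).2

/-! ### The Lie homomorphism defined by Chevalley–Serre data -/

namespace ChevalleyData

variable {n : ℕ} {L : Type*} [LieRing L] [LieAlgebra ℂ L] (D : ChevalleyData n L)

/-- Matrices at which the linear map respects all brackets. -/
noncomputable def equivariant : LieSubalgebra ℂ (Gl n) where
  carrier := {x | ∀ y, D.linHom ⁅x, y⁆ = ⁅D.linHom x, D.linHom y⁆}
  zero_mem' y := by simp
  add_mem' {x x'} hx hx' y := by rw [add_lie, map_add, hx, hx', map_add, add_lie]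
  smul_mem' c x hx y := by rw [smul_lie, map_smul, hx, map_smul, smul_lie]
  -- Jacobi: `ad` of a bracket is the commutator of the two `ad`s. This closure reduces
  -- multiplicativity to the generators.
  lie_mem' {x x'} hx hx' y := by
    rw [lie_lie, map_sub, hx, hx', hx', hx, hx, lie_lie]

theorem mem_equivariant {x : Gl n}
    (h : ∀ k l : Fin n, D.linHom ⁅x, (Matrix.single k l 1 : Gl n)⁆ = ⁅D.linHom x, D.root k l⁆) :
    x ∈ D.equivariant := by
  intro y
  let S : Submodule ℂ (Gl n) :=
    { carrier := {y | D.linHom ⁅x, y⁆ = ⁅D.linHom x, D.linHom y⁆}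
      zero_mem' := by simp
      add_mem' := fun {y y'} hy hy' => by
        change D.linHom ⁅x, y + y'⁆ = _
        rw [lie_add, map_add, hy, hy', map_add, lie_add]
      smul_mem' := fun c y hy => by
        change D.linHom ⁅x, c • y⁆ = _
        rw [lie_smul, map_smul, hy, map_smul, lie_smul] }
  refine mem_of_single_mem S (fun k l => ?_) y
  change D.linHom _ = _
  rw [h, linHom_single]

/-- The homomorphism from `gl_n` given by elements that satisfy the Chevalley–Serre relations. -/
noncomputable def lieHom : Gl n →ₗ⁅ℂ⁆ L :=
  { D.linHom with
    map_lie' := fun {x y} => by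
      refine mem_of_generators_mem D.equivariant (fun i j hij => ⟨?_, ?_⟩) (fun i => ?_) x y
      · refine D.mem_equivariant fun k l => ?_
        have e1 : D.root i j = D.e i := by rw [← hij]; exact D.root_add i 0
        rw [lie_single, linHom_single, e1, D.e_root _ _ _ (by omega) k.2 l.2, map_sub]
        congr 1
        · simp only [Fin.ext_iff, ← hij]
          split_ifs <;> simp [linHom_single]
        · simp only [Fin.ext_iff]
          split_ifs <;> simp [linHom_single, hij]
      · refine D.mem_equivariant fun k l => ?_
        have e1 : D.root j i = D.f i := by
          rw [← hij, D.root_of_gt (by omega), show i.val + 1 - i - 1 = 0 by omega]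
          exact neg_neg _
        rw [lie_single, linHom_single, e1, D.f_root _ _ _ (by omega) k.2 l.2, map_sub]
        congr 1
        · simp only [Fin.ext_iff]
          split_ifs <;> simp [linHom_single, hij]
        · simp only [Fin.ext_iff, ← hij]
          split_ifs <;> simp [linHom_single]
      · refine D.mem_equivariant fun k l => ?_
        rw [lie_single, linHom_single, root_self, D.h_root _ _ _ i.2 k.2 l.2, map_sub]
        simp only [Fin.ext_iff, sub_smul, ite_smul, one_smul, zero_smul]
        congr 1
        · split_ifs with h
          · rw [linHom_single, h]
          · simp
        · simp only [eq_comm (a := i.val)]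
          split_ifs with h
          · rw [linHom_single, h]
          · simp }

theorem lieHom_single (i j : Fin n) : D.lieHom (Matrix.single i j 1) = D.root i j :=
  D.linHom_single i j

theorem lieHom_e {i j : Fin n} (hij : i.val + 1 = j.val) :
    D.lieHom (Matrix.single i j 1) = D.e i := by
  rw [lieHom_single, ← hij]; exact D.root_add i 0

theorem lieHom_f {i j : Fin n} (hij : i.val + 1 = j.val) :
    D.lieHom (Matrix.single j i 1) = D.f i := by
  rw [lieHom_single, ← hij, D.root_of_gt (by omega), show i.val + 1 - i - 1 = 0 by omega]
  exact neg_neg _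

theorem lieHom_h (i : Fin n) : D.lieHom (Matrix.single i i 1) = D.h i := by
  rw [lieHom_single, root_self]

end ChevalleyData

/-! ### The action of the shifts on coordinates -/

theorem vec_inv {n : ℕ} (σ : Γ n) (p : Idx n) : vec σ⁻¹ p = -vec σ p := by
  unfold vec; split <;> simp

theorem vec_zpow {n : ℕ} (σ : Γ n) (m : ℤ) (p : Idx n) : vec (σ ^ m) p = m * vec σ p := by
  unfold vec; split <;> simp

/-- For a position in the top row `δ p` is the identity, so the bound on `p` is essential. -/
theorem vec_δ {n : ℕ} {p : Idx n} (hp : p.1.val + 1 < n) (q : Idx n) :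
    vec (δ p) q = if q = p then 1 else 0 := by
  unfold vec δ
  split_ifs with h1 h2 h2
  · simp [h2]
  · simp [h2]
  · subst h2; exact absurd hp h1
  · rfl

theorem vec_δ_zpow {n : ℕ} {p : Idx n} (hp : p.1.val + 1 < n) (ε : ℤ) (q : Idx n) :
    vec (δ p ^ ε) q = if q = p then ε else 0 := by
  rw [vec_zpow, vec_δ hp]; split_ifs <;> simp

theorem smul_algebraMap {n : ℕ} (σ : Γ n) (F : Entire n) :
    σ • algebraMap (Entire n) (Mero n) F = algebraMap (Entire n) (Mero n) (σ • F) :=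
  (algebraMap.smul' σ F (Mero n)).symm

/-- The minus sign comes from the convention `σ(f) = f ∘ σ⁻¹`. -/
theorem smul_X {n : ℕ} (σ : Γ n) (p : Idx n) : σ • X p = X p - (vec σ p : Mero n) := by
  have h : σ • (coord p : Entire n) = coord p - (vec σ p : Entire n) := by
    refine Subtype.ext (funext fun x => ?_)
    have e : ∀ m : ℤ, ((m : Entire n) : Entire n).1 x = (m : ℂ) := fun m => by
      have h1 : (m : Entire n) = algebraMap ℂ (Entire n) (m : ℂ) := by simp
      rw [h1]; rfl
    change x p + (vec σ⁻¹ p : ℂ) = x p - ((vec σ p : Entire n) : Entire n).1 x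
    rw [e, vec_inv]; push_cast; ring
  rw [X, smul_algebraMap, h, map_sub, map_intCast]

theorem smul_intCast {n : ℕ} (σ : Γ n) (m : ℤ) : σ • (m : Mero n) = m :=
  map_intCast (MulSemiringAction.toRingHom (Γ n) (Mero n) σ) m

theorem X_sub_X_add_ne {n : ℕ} {p q : Idx n} (h : p ≠ q) (m : ℤ) :
    X p - X q + (m : Mero n) ≠ 0 := by
  intro h0
  have e : X p - X q + (m : Mero n) = algebraMap (Entire n) (Mero n)
      (coord p - coord q + algebraMap ℂ (Entire n) (m : ℂ)) := by
    simp [X]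
  rw [e, map_eq_zero_iff _ (IsFractionRing.injective (Entire n) (Mero n))] at h0
  -- At the tableau with `1 - m` at `p` and `0` elsewhere the function takes the value `1`.
  have := congrFun (congrArg Subtype.val h0) (Pi.single p (1 - (m : ℂ)))
  change (Pi.single p (1 - (m : ℂ)) : V n) p - (Pi.single p (1 - (m : ℂ)) : V n) q + (m : ℂ) = 0
    at this
  rw [Pi.single_eq_same, Pi.single_eq_of_ne h.symm] at this
  simp at this

theorem X_sub_X_ne {n : ℕ} {p q : Idx n} (h : p ≠ q) : X p - X q ≠ (0 : Mero n) := by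
  simpa using X_sub_X_add_ne h 0

theorem X_injective {n : ℕ} : Function.Injective (X : Idx n → Mero n) := fun p q h => by
  by_contra hpq
  exact X_sub_X_ne hpq (sub_eq_zero.2 h)

/-! ### The coefficients of the Gelfand–Tsetlin formulas -/

/-- The quotient `∏_{q ∈ N} (x_p - x_q) / ∏_{q ∈ M, q ≠ p} (x_p - x_q)`. -/
noncomputable def coef {n : ℕ} (M N : Finset (Idx n)) (p : Idx n) : Mero n :=
  (∏ q ∈ N, (X p - X q)) / ∏ q ∈ M.erase p, (X p - X q)

/-- The sum of the terms `coef M N p` times the `ε`-th power of the shift at `p`, over `p ∈ M`. -/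
noncomputable def gen {n : ℕ} (ε : ℤ) (M N : Finset (Idx n)) : R n :=
  ∑ p ∈ M, SkewMonoidAlgebra.single (δ p ^ ε) (coef M N p)

theorem gtE_eq (n k : ℕ) : gtE n k = -gen (-1) (row n k) (row n (k + 1)) := by
  simp [gtE, gen, coef]

theorem gtF_eq (n k : ℕ) : gtF n k = gen 1 (row n k) (row n (k - 1)) := by
  simp [gtF, gen, coef]

theorem smul_X_of_ne {n : ℕ} {p q : Idx n} (hq : q.1.val + 1 < n) (hpq : p ≠ q) (ε : ℤ) :
    δ q ^ ε • X p = X p := by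
  rw [smul_X, vec_δ_zpow hq, if_neg hpq, Int.cast_zero, sub_zero]

theorem smul_X_self {n : ℕ} {q : Idx n} (hq : q.1.val + 1 < n) (ε : ℤ) :
    δ q ^ ε • X q = X q - (ε : Mero n) := by
  rw [smul_X, vec_δ_zpow hq, if_pos rfl]

theorem smul_prod_of_notMem {n : ℕ} {S : Finset (Idx n)} {p q : Idx n} (hq : q.1.val + 1 < n)
    (hpq : p ≠ q) (hS : q ∉ S) (ε : ℤ) :
    δ q ^ ε • ∏ r ∈ S, (X p - X r) = ∏ r ∈ S, (X p - X r) := by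
  rw [Finset.smul_prod']
  refine Finset.prod_congr rfl fun r hr => ?_
  rw [smul_sub, smul_X_of_ne hq hpq, smul_X_of_ne hq fun h => hS (h ▸ hr)]

/-- Only the factor at `q` is moved. Writing the change as a ratio lets all relations below be
checked after cancelling the unshifted coefficients. -/
theorem smul_prod_of_mem {n : ℕ} {S : Finset (Idx n)} {p q : Idx n} (hq : q.1.val + 1 < n)
    (hpq : p ≠ q) (hS : q ∈ S) (ε : ℤ) :
    δ q ^ ε • ∏ r ∈ S, (X p - X r) =
      (∏ r ∈ S, (X p - X r)) * ((X p - X q + (ε : Mero n)) / (X p - X q)) := by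
  rw [← Finset.mul_prod_erase S _ hS, smul_mul', smul_prod_of_notMem hq hpq (by simp),
    smul_sub, smul_X_of_ne hq hpq, smul_X_self hq]
  have := X_sub_X_ne hpq
  field_simp
  ring

section coef

variable {n : ℕ} {M N : Finset (Idx n)} {p q : Idx n}

theorem smul_coef_of_notMem (hq : q.1.val + 1 < n) (hpq : p ≠ q) (hM : q ∉ M) (hN : q ∉ N)
    (ε : ℤ) : δ q ^ ε • coef M N p = coef M N p := by
  rw [coef, smul_div₀', smul_prod_of_notMem hq hpq hN,
    smul_prod_of_notMem hq hpq fun h => hM (Finset.mem_of_mem_erase h)]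

theorem smul_coef_of_mem_num (hq : q.1.val + 1 < n) (hpq : p ≠ q) (hM : q ∉ M) (hN : q ∈ N)
    (ε : ℤ) :
    δ q ^ ε • coef M N p = coef M N p * ((X p - X q + (ε : Mero n)) / (X p - X q)) := by
  rw [coef, smul_div₀', smul_prod_of_mem hq hpq hN,
    smul_prod_of_notMem hq hpq fun h => hM (Finset.mem_of_mem_erase h)]
  ring

theorem smul_coef_of_mem_den (hq : q.1.val + 1 < n) (hpq : p ≠ q) (hM : q ∈ M) (hN : q ∉ N)
    (ε : ℤ) :
    δ q ^ ε • coef M N p = coef M N p * ((X p - X q) / (X p - X q + (ε : Mero n))) := by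
  rw [coef, smul_div₀', smul_prod_of_notMem hq hpq hN,
    smul_prod_of_mem hq hpq (Finset.mem_erase.2 ⟨hpq.symm, hM⟩), div_mul_eq_div_div,
    div_div_eq_mul_div, mul_div_assoc]

theorem smul_coef_self (hp : p.1.val + 1 < n) (hN : p ∉ N) (ε : ℤ) :
    δ p ^ ε • coef M N p = (∏ q ∈ N, (X p - (ε : Mero n) - X q)) /
      ∏ q ∈ M.erase p, (X p - (ε : Mero n) - X q) := by
  rw [coef, smul_div₀', Finset.smul_prod', Finset.smul_prod']
  congr 1
  · refine Finset.prod_congr rfl fun q hq => ?_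
    rw [smul_sub, smul_X_self hp, smul_X_of_ne hp fun h => hN (h ▸ hq)]
  · refine Finset.prod_congr rfl fun q hq => ?_
    rw [smul_sub, smul_X_self hp, smul_X_of_ne hp (Finset.ne_of_mem_erase hq)]

end coef

/-! ### Commutation and Serre relations -/

theorem sum_mul_sum_comm {A ι κ : Type*} [Ring A] {s : Finset ι} {t : Finset κ} {e : ι → A}
    {f : κ → A} (h : ∀ p ∈ s, ∀ q ∈ t, e p * f q = f q * e p) :
    (∑ p ∈ s, e p) * ∑ q ∈ t, f q = (∑ q ∈ t, f q) * ∑ p ∈ s, e p := by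
  rw [Finset.sum_mul_sum, Finset.sum_mul_sum, Finset.sum_comm]
  exact Finset.sum_congr rfl fun q hq => Finset.sum_congr rfl fun p hp => h p hp q hq

/-- The double bracket is a sum of `G p p'` over ordered pairs. Its double is the sum of the
symmetrised terms, so only these need to vanish; the individual `G p p'` need not. -/
theorem serre_of_symm {A ι κ : Type*} [Ring A] [Module ℂ A] {s : Finset ι} {t : Finset κ}
    {e : ι → A} {f : κ → A}
    (h : ∀ p ∈ s, ∀ p' ∈ s, ∀ q ∈ t,
      (e p * e p' * f q - (2 : ℤ) • (e p * f q * e p') + f q * e p * e p') +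
      (e p' * e p * f q - (2 : ℤ) • (e p' * f q * e p) + f q * e p' * e p) = 0) :
    ⁅⁅∑ q ∈ t, f q, ∑ p ∈ s, e p⁆, ∑ p ∈ s, e p⁆ = 0 := by
  set G : ι → ι → A := fun p p' =>
    ∑ q ∈ t, (e p * e p' * f q - (2 : ℤ) • (e p * f q * e p') + f q * e p * e p')
  have hG : ∀ p ∈ s, ∀ p' ∈ s, G p p' + G p' p = 0 := fun p hp p' hp' => by
    rw [← Finset.sum_add_distrib]
    exact Finset.sum_eq_zero fun q hq => h p hp p' hp' q hq
  have key : ⁅⁅∑ q ∈ t, f q, ∑ p ∈ s, e p⁆, ∑ p ∈ s, e p⁆ = ∑ p ∈ s, ∑ p' ∈ s, G p p' := by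
    have h1 : (∑ p ∈ s, e p) * (∑ p ∈ s, e p) * ∑ q ∈ t, f q =
        ∑ p ∈ s, ∑ p' ∈ s, ∑ q ∈ t, e p * e p' * f q := by
      rw [Finset.sum_mul_sum]
      simp_rw [Finset.sum_mul]
      simp_rw [Finset.mul_sum]
    have h2 : (∑ p ∈ s, e p) * (∑ q ∈ t, f q) * ∑ p ∈ s, e p =
        ∑ p ∈ s, ∑ p' ∈ s, ∑ q ∈ t, e p * f q * e p' := by
      rw [Finset.sum_mul_sum]
      simp_rw [Finset.sum_mul]
      simp_rw [Finset.mul_sum]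
      exact Finset.sum_congr rfl fun p _ => Finset.sum_comm
    have h3 : (∑ q ∈ t, f q) * (∑ p ∈ s, e p) * ∑ p ∈ s, e p =
        ∑ p ∈ s, ∑ p' ∈ s, ∑ q ∈ t, f q * e p * e p' := by
      rw [Finset.sum_mul_sum]
      simp_rw [Finset.sum_mul]
      simp_rw [Finset.mul_sum]
      rw [Finset.sum_comm]
      exact Finset.sum_congr rfl fun p _ => Finset.sum_comm
    simp only [G, Finset.sum_add_distrib, Finset.sum_sub_distrib, ← Finset.smul_sum]
    rw [← h1, ← h2, ← h3]
    simp only [LieRing.of_associative_ring_bracket]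
    noncomm_ring
  rw [key]
  set S := ∑ p ∈ s, ∑ p' ∈ s, G p p'
  have h2 : S + S = 0 := by
    change ∑ p ∈ s, ∑ p' ∈ s, G p p' + ∑ p ∈ s, ∑ p' ∈ s, G p p' = 0
    nth_rewrite 2 [Finset.sum_comm]
    rw [← Finset.sum_add_distrib]
    refine Finset.sum_eq_zero fun p hp => ?_
    rw [← Finset.sum_add_distrib]
    exact Finset.sum_eq_zero fun p' hp' => hG p hp p' hp'
  rw [← two_smul ℂ] at h2
  exact (smul_eq_zero.1 h2).resolve_left two_ne_zero

open SkewMonoidAlgebra in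
theorem single_mul_single_mul_single {n : ℕ} (σ ρ κ : Γ n) (f g h : Mero n) :
    single σ f * single ρ g * single κ h =
      single (σ * ρ * κ) (f * σ • g * σ • ρ • h) := by
  rw [single_mul_single, single_mul_single, mul_smul]

open SkewMonoidAlgebra in
theorem single_comb {n : ℕ} (σ : Γ n) (f g h f' g' h' : Mero n) :
    single σ f - (2 : ℤ) • single σ g + single σ h +
      (single σ f' - (2 : ℤ) • single σ g' + single σ h') =
      single σ (f - 2 * g + h + (f' - 2 * g' + h')) := by
  simp only [sub_eq_add_neg, single_add, single_neg, two_zsmul, two_mul]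

theorem smul_X_sub_div {n : ℕ} {p q : Idx n} (hp : p.1.val + 1 < n) (hpq : p ≠ q) (ε : ℤ) :
    δ p ^ ε • ((X p - X q + (ε : Mero n)) / (X p - X q)) =
      (X p - X q) / (X p - X q - (ε : Mero n)) := by
  rw [smul_div₀', smul_add, smul_sub, smul_intCast, smul_X_self hp, smul_X_of_ne hp hpq.symm]
  congr 1 <;> ring

section gen

variable {n : ℕ} {M N N' : Finset (Idx n)}

/-- Shifts at `M` leave the coefficients of `gen ε N N'` alone, while a shift at `q` multiplies the
coefficient at `p` by `(y + ε) / y`, `y = X p - X q`. For `p = p'` the relation becomes `1 - 2y/(y -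
ε) + (y + ε)/(y - ε) = 0`; for `p ≠ p'` the denominators in `X p - X p'` cancel after
symmetrisation. -/
theorem lie_lie_gen_left (ε : ℤ) (hM : ∀ p ∈ M, p.1.val + 1 < n) (hN : ∀ p ∈ N, p.1.val + 1 < n)
    (hMN : Disjoint M N) (hMN' : Disjoint M N') :
    ⁅⁅gen ε N N', gen ε M N⁆, gen ε M N⁆ = 0 := by
  refine serre_of_symm fun p hp p' hp' q hq => ?_
  have ne : ∀ {r s}, r ∈ M → s ∈ N → r ≠ s := fun hr hs h =>
    Finset.disjoint_left.1 hMN hr (h ▸ hs)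
  have hpN' := Finset.disjoint_left.1 hMN' hp
  have hp'N' := Finset.disjoint_left.1 hMN' hp'
  have hqM := Finset.disjoint_right.1 hMN hq
  have hpN := Finset.disjoint_left.1 hMN hp
  have hp'N := Finset.disjoint_left.1 hMN hp'
  have y0 := X_sub_X_ne (ne hp hq)
  have y0' := X_sub_X_ne (ne hp' hq)
  simp only [single_mul_single_mul_single]
  rw [mul_right_comm (δ p ^ ε) (δ q ^ ε), mul_comm (δ q ^ ε) (δ p ^ ε),
    mul_right_comm (δ p ^ ε) (δ q ^ ε), mul_right_comm (δ p' ^ ε) (δ q ^ ε),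
    mul_comm (δ q ^ ε) (δ p' ^ ε), mul_right_comm (δ p' ^ ε) (δ q ^ ε),
    mul_comm (δ p' ^ ε) (δ p ^ ε), single_comb]
  refine SkewMonoidAlgebra.single_eq_zero.2 ?_
  have hc := smul_coef_of_notMem (hM p hp) (ne hp hq).symm hpN hpN' ε
  have hc' := smul_coef_of_notMem (hM p' hp') (ne hp' hq).symm hp'N hp'N' ε
  have ha := smul_coef_of_mem_num (hN q hq) (ne hp hq) hqM hq ε
  have ha' := smul_coef_of_mem_num (hN q hq) (ne hp' hq) hqM hq ε
  -- All six terms become one product of coefficients times explicit ratios.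
  rw [smul_comm (δ q ^ ε) (δ p ^ ε), smul_comm (δ q ^ ε) (δ p' ^ ε), hc', hc, hc', ha, ha',
    smul_mul', smul_mul']
  by_cases hpp : p = p'
  · subst hpp
    rw [smul_X_sub_div (hM p hp) (ne hp hq)]
    by_cases hε : ε = 0
    · subst hε
      simp only [zpow_zero, one_smul, Int.cast_zero, sub_zero, add_zero, div_self y0]
      ring
    have y1 := X_sub_X_add_ne (ne hp hq) (-ε)
    push_cast at y1
    rw [← sub_eq_add_neg] at y1
    field_simp
    ring
  · have d1 := X_sub_X_add_ne hpp (-ε)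
    have d2 := X_sub_X_add_ne hpp ε
    have e1 := smul_coef_of_mem_den (hM p' hp') hpp hp' hp'N ε
    have e2 := smul_coef_of_mem_den (hM p hp) (Ne.symm hpp) hp hpN ε
    rw [e1, e2]
    simp only [smul_div₀', smul_add, smul_sub, smul_intCast, smul_X_of_ne (hM p hp) (Ne.symm hpp),
      smul_X_of_ne (hM p hp) (ne hp hq).symm, smul_X_of_ne (hM p' hp') (ne hp' hq).symm,
      smul_X_of_ne (hM p' hp') hpp]
    have d3 : X p' - X p + (ε : Mero n) = -(X p - X p' - ε) := by ring
    push_cast at d1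
    rw [← sub_eq_add_neg] at d1
    rw [d3]
    field_simp
    ring

/-- The mirror case: now the repeated operators have coefficients free of `X p`, and their shifts at
`q` and `q'` rescale the coefficient of the single operator at `p`. -/
theorem lie_lie_gen_right (ε : ℤ) (hM : ∀ p ∈ M, p.1.val + 1 < n) (hN : ∀ p ∈ N, p.1.val + 1 < n)
    (hMN : Disjoint M N) (hMN' : Disjoint M N') (hNN' : Disjoint N N') :
    ⁅⁅gen ε M N, gen ε N N'⁆, gen ε N N'⁆ = 0 := by
  refine serre_of_symm fun q hq q' hq' p hp => ?_
  have ne : ∀ {r s}, r ∈ M → s ∈ N → r ≠ s := fun hr hs h =>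
    Finset.disjoint_left.1 hMN hr (h ▸ hs)
  have hpN' := Finset.disjoint_left.1 hMN' hp
  have hqM := Finset.disjoint_right.1 hMN hq
  have hq'M := Finset.disjoint_right.1 hMN hq'
  have hqN' := Finset.disjoint_left.1 hNN' hq
  have hq'N' := Finset.disjoint_left.1 hNN' hq'
  have hpN := Finset.disjoint_left.1 hMN hp
  have y0 := X_sub_X_ne (ne hp hq)
  have y0' := X_sub_X_ne (ne hp hq')
  simp only [single_mul_single_mul_single]
  rw [mul_right_comm (δ q ^ ε) (δ p ^ ε), mul_comm (δ p ^ ε) (δ q ^ ε),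
    mul_right_comm (δ q ^ ε) (δ p ^ ε), mul_right_comm (δ q' ^ ε) (δ p ^ ε),
    mul_comm (δ p ^ ε) (δ q' ^ ε), mul_right_comm (δ q' ^ ε) (δ p ^ ε),
    mul_comm (δ q' ^ ε) (δ q ^ ε), single_comb]
  refine SkewMonoidAlgebra.single_eq_zero.2 ?_
  have hc := smul_coef_of_notMem (hM p hp) (ne hp hq).symm hpN hpN' ε
  have hc' := smul_coef_of_notMem (hM p hp) (ne hp hq').symm hpN hpN' ε
  have ha := smul_coef_of_mem_num (hN q hq) (ne hp hq) hqM hq ε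
  have ha' := smul_coef_of_mem_num (hN q' hq') (ne hp hq') hq'M hq' ε
  rw [smul_comm (δ p ^ ε) (δ q ^ ε), smul_comm (δ p ^ ε) (δ q' ^ ε), hc', hc, ha', ha,
    smul_mul', smul_mul', ha', ha]
  by_cases hqq : q = q'
  · subst hqq
    have e : δ q ^ ε • ((X p - X q + (ε : Mero n)) / (X p - X q)) =
        (X p - X q + 2 * (ε : Mero n)) / (X p - X q + (ε : Mero n)) := by
      rw [smul_div₀', smul_add, smul_sub, smul_intCast, smul_X_self (hN q hq),
        smul_X_of_ne (hN q hq) (ne hp hq)]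
      congr 1 <;> ring
    rw [e]
    have y1 := X_sub_X_add_ne (ne hp hq) ε
    field_simp
    ring
  · have d1 := X_sub_X_add_ne hqq (-ε)
    have d2 := X_sub_X_add_ne hqq ε
    have e1 := smul_coef_of_mem_den (hN q' hq') hqq hq' hq'N' ε
    have e2 := smul_coef_of_mem_den (hN q hq) (Ne.symm hqq) hq hqN' ε
    rw [e1, e2]
    simp only [smul_div₀', smul_add, smul_sub, smul_intCast, smul_X_of_ne (hN q hq) (Ne.symm hqq),
      smul_X_of_ne (hN q hq) (ne hp hq), smul_X_of_ne (hN q' hq') (ne hp hq'),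
      smul_X_of_ne (hN q' hq') hqq]
    have d3 : X q' - X q + (ε : Mero n) = -(X q - X q' - ε) := by ring
    push_cast at d1
    rw [← sub_eq_add_neg] at d1
    rw [d3]
    field_simp
    ring

/-- Terms for disjoint sets whose coefficients do not involve the other set commute. -/
theorem lie_gen_of_disjoint {K K' : Finset (Idx n)} (ε ε' : ℤ)
    (hM : ∀ p ∈ M, p.1.val + 1 < n) (hN : ∀ p ∈ N, p.1.val + 1 < n)
    (hMN : Disjoint M N) (h1 : Disjoint M K') (h2 : Disjoint N K) :
    ⁅gen ε M K, gen ε' N K'⁆ = 0 := by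
  rw [LieRing.of_associative_ring_bracket, sub_eq_zero]
  refine sum_mul_sum_comm fun p hp q hq => ?_
  have hpq : p ≠ q := fun h => Finset.disjoint_left.1 hMN hp (h ▸ hq)
  rw [SkewMonoidAlgebra.single_mul_single, SkewMonoidAlgebra.single_mul_single,
    smul_coef_of_notMem (hM p hp) hpq.symm (Finset.disjoint_left.1 hMN hp)
      (Finset.disjoint_left.1 h1 hp),
    smul_coef_of_notMem (hN q hq) hpq (Finset.disjoint_right.1 hMN hq)
      (Finset.disjoint_left.1 h2 hq), mul_comm, mul_comm (coef _ _ _)]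

/-- Each coefficient has `±(X p - X q)` as a numerator factor. Since the shifts are opposite, both
orders of multiplication rescale by the same ratio `(X p - X q + ε) / (X p - X q)`. -/
theorem lie_gen_neg (ε : ℤ) (hM : ∀ p ∈ M, p.1.val + 1 < n) (hN : ∀ p ∈ N, p.1.val + 1 < n)
    (hMN : Disjoint M N) : ⁅gen (-ε) M N, gen ε N M⁆ = 0 := by
  rw [LieRing.of_associative_ring_bracket, sub_eq_zero]
  refine sum_mul_sum_comm fun p hp q hq => ?_
  have hpq : p ≠ q := fun h => Finset.disjoint_left.1 hMN hp (h ▸ hq)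
  rw [SkewMonoidAlgebra.single_mul_single, SkewMonoidAlgebra.single_mul_single,
    smul_coef_of_mem_num (hM p hp) hpq.symm (Finset.disjoint_left.1 hMN hp) hp,
    smul_coef_of_mem_num (hN q hq) hpq (Finset.disjoint_right.1 hMN hq) hq,
    mul_comm (δ p ^ _)]
  congr 1
  have y0 := X_sub_X_ne hpq
  have y1 := X_sub_X_ne hpq.symm
  have e1 : X q - X p + ((-ε : ℤ) : Mero n) = -(X p - X q + ε) := by push_cast; ring
  have e2 : X q - X p = -(X p - X q) := by ring
  rw [e1, e2, neg_div_neg_eq]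
  ring

end gen

instance (n : ℕ) : CharZero (Mero n) :=
  charZero_of_injective_algebraMap (algebraMap ℂ (Mero n)).injective

theorem single_sub {n : ℕ} (σ : Γ n) (f g : Mero n) :
    SkewMonoidAlgebra.single σ (f - g) =
      SkewMonoidAlgebra.single σ f - SkewMonoidAlgebra.single σ g :=
  map_sub (SkewMonoidAlgebra.singleAddHom σ) f g

theorem single_sum {n : ℕ} {ι : Type*} (σ : Γ n) (s : Finset ι) (f : ι → Mero n) :
    SkewMonoidAlgebra.single σ (∑ i ∈ s, f i) = ∑ i ∈ s, SkewMonoidAlgebra.single σ (f i) :=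
  map_sum (SkewMonoidAlgebra.singleAddHom σ) f s

/-! ### The commutator of raising and lowering operators -/

-- Interpolate `∏ (X - w j) - ∏ (X - v i)` at the nodes `v i`. The leading terms cancel, so the
-- degree is below the number of nodes, and the Lagrange formula for the next coefficient has the
-- sum on the left; by Vieta that coefficient is the right-hand side.
open Polynomial in
theorem sum_prod_sub_div_prod_sub {F ι κ : Type*} [Field F] [DecidableEq ι] (s : Finset ι)
    (t : Finset κ) (v : ι → F) (w : κ → F) (hv : Set.InjOn v s) (hc : t.card = s.card) :
    ∑ i ∈ s, (∏ j ∈ t, (v i - w j)) / ∏ j ∈ s.erase i, (v i - v j) =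
      ∑ i ∈ s, v i - ∑ j ∈ t, w j := by
  rcases s.eq_empty_or_nonempty with rfl | hs
  · obtain rfl : t = ∅ := by simpa using hc
    simp
  set P : F[X] := ∏ j ∈ t, (Polynomial.X - C (w j)) - ∏ i ∈ s, (Polynomial.X - C (v i)) with hP
  have hpos : 0 < s.card := hs.card_pos
  have hdeg : P.degree < s.card := by
    have h1 : (∏ j ∈ t, (Polynomial.X - C (w j))).degree = (s.card : WithBot ℕ) := by
      rw [degree_prod, ← hc]; simp
    have h2 : (∏ i ∈ s, (Polynomial.X - C (v i))).degree = (s.card : WithBot ℕ) := by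
      rw [degree_prod]; simp
    rw [← h1]
    refine degree_sub_lt_left (h1.trans h2.symm) (fun h => ?_) ?_
    · rw [h, degree_zero] at h1; exact absurd h1 (by simp)
    · rw [(monic_prod_of_monic _ _ fun j _ => monic_X_sub_C _).leadingCoeff,
        (monic_prod_of_monic _ _ fun j _ => monic_X_sub_C _).leadingCoeff]
  have key := Lagrange.coeff_eq_sum hv hdeg
  have h3 : P.coeff (s.card - 1) = ∑ i ∈ s, v i - ∑ j ∈ t, w j := by
    rw [hP, coeff_sub, prod_X_sub_C_coeff_card_pred s v hpos]
    nth_rewrite 1 [← hc]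
    rw [prod_X_sub_C_coeff_card_pred t w (hc ▸ hpos)]
    ring
  rw [← h3, key]
  refine Finset.sum_congr rfl fun i hi => ?_
  congr 1
  rw [hP, eval_sub, eval_prod, eval_prod, Finset.prod_eq_zero (i := i) (s := s) hi (by simp)]
  simp

theorem erase_inl_disjSum {α β : Type*} [DecidableEq α] [DecidableEq β] (s : Finset α)
    (t : Finset β) (a : α) : (s.disjSum t).erase (Sum.inl a) = (s.erase a).disjSum t := by
  ext (x | x) <;> simp

theorem erase_inr_disjSum {α β : Type*} [DecidableEq α] [DecidableEq β] (s : Finset α)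
    (t : Finset β) (b : β) : (s.disjSum t).erase (Sum.inr b) = s.disjSum (t.erase b) := by
  ext (x | x) <;> simp

/-- Interpolation with doubled nodes `X p` and `X p - 1` for `p ∈ M`, and roots `X q` for `q ∈ N`,
`X q - 1` for `q ∈ K`. The node `X p` gives the first product and the node `X p - 1` the second; the
factor pairing the two nodes of the same `p` is `1` or `-1`, which accounts for the sign. -/
theorem sum_coef_mul_coef {n : ℕ} {M N K : Finset (Idx n)} (hM : ∀ p ∈ M, p.1.val + 1 < n)
    (hN : Disjoint M N) (hK : Disjoint M K) (hc : N.card + K.card = M.card + M.card) :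
    ∑ p ∈ M, (coef M N p * δ p ^ (-1 : ℤ) • coef M K p - coef M K p * δ p ^ (1 : ℤ) • coef M N p) =
      2 * ∑ p ∈ M, X p - ∑ p ∈ N, X p - ∑ p ∈ K, X p + (K.card - M.card : Mero n) := by
  have key := sum_prod_sub_div_prod_sub (M.disjSum M) (N.disjSum K)
    (Sum.elim X fun p => X p - 1 : Idx n ⊕ Idx n → Mero n) (Sum.elim X fun p => X p - 1) ?_
    (by simpa using hc)
  · rw [Finset.sum_disjSum, Finset.sum_disjSum, Finset.sum_disjSum] at key
    simp only [Finset.prod_disjSum, erase_inl_disjSum, erase_inr_disjSum, Sum.elim_inl,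
      Sum.elim_inr, Finset.sum_sub_distrib, Finset.sum_const, nsmul_eq_mul, mul_one] at key
    have e : ∑ p ∈ M, (coef M N p * δ p ^ (-1 : ℤ) • coef M K p -
        coef M K p * δ p ^ (1 : ℤ) • coef M N p) = ∑ p ∈ M, X p - ∑ p ∈ N, X p +
          (∑ p ∈ M, X p - M.card) - (∑ p ∈ K, X p - K.card) := by
      have e2 : ∑ p ∈ M, X p - ∑ p ∈ N, X p + (∑ p ∈ M, X p - M.card) - (∑ p ∈ K, X p - K.card) =
        ∑ p ∈ M, X p + (∑ p ∈ M, X p - (M.card : Mero n)) -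
          (∑ p ∈ N, X p + (∑ p ∈ K, X p - (K.card : Mero n))) := by ring
      rw [e2, ← key, ← Finset.sum_add_distrib]
      refine Finset.sum_congr rfl fun p hp => ?_
      rw [smul_coef_self (hM p hp) (Finset.disjoint_left.1 hK hp),
        smul_coef_self (hM p hp) (Finset.disjoint_left.1 hN hp), sub_eq_add_neg]
      congr 1
      · rw [coef, ← Finset.mul_prod_erase M (fun q => X p - (X q - 1)) hp, div_mul_div_comm]
        congr 1
        · congr 1
          exact Finset.prod_congr rfl fun q _ => by push_cast; ring
        · rw [show X p - (X p - 1) = (1 : Mero n) by ring, one_mul]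
          congr 1
          exact Finset.prod_congr rfl fun q _ => by push_cast; ring
      · rw [coef, ← Finset.mul_prod_erase M (fun q => X p - 1 - X q) hp, div_mul_div_comm, ← div_neg]
        congr 1
        · rw [mul_comm]
          congr 1
          · exact Finset.prod_congr rfl fun q _ => by push_cast; ring
          · exact Finset.prod_congr rfl fun q _ => by ring
        · rw [show X p - 1 - X p = (-1 : Mero n) by ring, neg_one_mul, neg_mul, neg_inj, mul_comm]
          congr 1
          · exact Finset.prod_congr rfl fun q _ => by push_cast; ring
          · exact Finset.prod_congr rfl fun q _ => by ring
    rw [e]; ring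
  -- The nodes are distinct because coordinates at different positions do not differ by an integer
  -- constant.
  · rintro (p | p) hp (q | q) hq h
    · exact congrArg _ (X_injective h)
    · exfalso
      change X p = X q - 1 at h
      by_cases hpq : p = q
      · subst hpq; exact one_ne_zero (sub_eq_self.1 h.symm)
      · exact X_sub_X_add_ne hpq 1 (by push_cast; rw [h]; ring)
    · exfalso
      change X p - 1 = X q at h
      by_cases hpq : p = q
      · subst hpq; exact one_ne_zero (sub_eq_self.1 h)
      · exact X_sub_X_add_ne hpq (-1) (by push_cast; rw [← h]; ring)
    · change X p - 1 = X q - 1 at h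
      rw [sub_left_inj] at h
      exact congrArg _ (X_injective h)

/-- For `p ≠ q` the two orders of multiplication produce the same ratio and cancel. On the diagonal
the shifts are mutually inverse, which leaves a function. -/
theorem lie_gen_gen {n : ℕ} {M N K : Finset (Idx n)} (hM : ∀ p ∈ M, p.1.val + 1 < n)
    (hN : Disjoint M N) (hK : Disjoint M K) (hc : N.card + K.card = M.card + M.card) :
    ⁅gen (-1) M N, gen 1 M K⁆ = SkewMonoidAlgebra.single 1
      (2 * ∑ p ∈ M, X p - ∑ p ∈ N, X p - ∑ p ∈ K, X p + (K.card - M.card : Mero n)) := by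
  rw [← sum_coef_mul_coef hM hN hK hc, LieRing.of_associative_ring_bracket, gen, gen,
    Finset.sum_mul_sum, Finset.sum_mul_sum]
  nth_rewrite 2 [Finset.sum_comm]
  rw [← Finset.sum_sub_distrib]
  rw [single_sum]
  refine Finset.sum_congr rfl fun p hp => ?_
  rw [← Finset.sum_sub_distrib, Finset.sum_eq_single p]
  · rw [SkewMonoidAlgebra.single_mul_single, SkewMonoidAlgebra.single_mul_single, ← zpow_add,
      ← zpow_add, single_sub]
    simp
  · intro q hq hqp
    rw [SkewMonoidAlgebra.single_mul_single, SkewMonoidAlgebra.single_mul_single, sub_eq_zero,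
      mul_comm (δ p ^ _)]
    congr 1
    rw [smul_coef_of_mem_den (hM p hp) hqp hp (Finset.disjoint_left.1 hK hp),
      smul_coef_of_mem_den (hM q hq) hqp.symm hq (Finset.disjoint_left.1 hN hq)]
    have e1 : X q - X p + ((-1 : ℤ) : Mero n) = -(X p - X q + (1 : ℤ)) := by push_cast; ring
    have e2 : X q - X p = -(X p - X q) := by ring
    rw [e1, e2, neg_div_neg_eq]
    ring
  · exact fun h => absurd hp h

/-! ### Weights -/

theorem lie_single_one_gen {n : ℕ} {M N : Finset (Idx n)} (ε : ℤ) (h : Mero n) (c : ℤ)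
    (hc : ∀ p ∈ M, δ p ^ ε • h = h - (c : Mero n)) :
    ⁅(SkewMonoidAlgebra.single 1 h : R n), gen ε M N⁆ = (c : ℂ) • gen ε M N := by
  rw [LieRing.of_associative_ring_bracket, gen, Finset.mul_sum, Finset.sum_mul,
    ← Finset.sum_sub_distrib, Finset.smul_sum]
  refine Finset.sum_congr rfl fun p hp => ?_
  rw [SkewMonoidAlgebra.single_mul_single, SkewMonoidAlgebra.single_mul_single, one_mul, mul_one,
    one_smul, hc p hp, SkewMonoidAlgebra.smul_single, sub_eq_add_neg, ← SkewMonoidAlgebra.single_neg,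
    ← SkewMonoidAlgebra.single_add]
  congr 1
  rw [Algebra.smul_def, map_intCast]
  ring

theorem mem_row {n k : ℕ} {p : Idx n} : p ∈ row n k ↔ p.1.val + 1 = k := by simp [row]

theorem disjoint_row {n k l : ℕ} (h : k ≠ l) : Disjoint (row n k) (row n l) :=
  Finset.disjoint_left.2 fun _ hp hp' => h ((mem_row.1 hp).symm.trans (mem_row.1 hp'))

theorem low_of_mem_row {n k : ℕ} (hk : k < n) : ∀ p ∈ row n k, p.1.val + 1 < n := fun p hp => by
  rw [mem_row.1 hp]; exact hk

theorem sum_row {n k : ℕ} {A : Type*} [AddCommMonoid A] (hk : k < n) (f : Idx n → A) :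
    ∑ p ∈ row n (k + 1), f p = ∑ i : Fin (k + 1), f ⟨⟨k, hk⟩, i⟩ := by
  symm
  refine Finset.sum_bij (fun i _ => ⟨⟨k, hk⟩, i⟩) (fun i _ => mem_row.2 rfl)
    (fun i _ j _ h => by simpa using h) (fun p hp => ?_) (fun _ _ => rfl)
  obtain ⟨⟨l, hl⟩, i⟩ := p
  obtain rfl : l = k := by simpa using mem_row.1 hp
  exact ⟨i, Finset.mem_univ _, rfl⟩

theorem row_zero (n : ℕ) : row n 0 = ∅ := by
  ext p; simp [row]

theorem card_row {n k : ℕ} (hk : k ≤ n) : (row n k).card = k := by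
  rcases k with _ | k
  · rw [row_zero]; rfl
  · rw [Finset.card_eq_sum_ones, sum_row (by omega)]; simp

theorem sum_row_column {n k : ℕ} (hk : k ≤ n) :
    ∑ p ∈ row n k, (p.2.val : Mero n) = (k : Mero n) * (k - 1) / 2 := by
  rcases k with _ | k
  · rw [row_zero]; simp
  · rw [sum_row (by omega)]
    have h : ∑ i : Fin (k + 1), ((i : ℕ) : Mero n) = ∑ i ∈ Finset.range (k + 1), (i : Mero n) :=
      Fin.sum_univ_eq_sum_range (fun i => (i : Mero n)) (k + 1)
    rw [h, ← Nat.cast_sum, Finset.sum_range_id]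
    have h2 := Finset.sum_range_id_mul_two (k + 1)
    rw [Finset.sum_range_id] at h2
    generalize (k + 1) * (k + 1 - 1) / 2 = m at h2
    have h3 := congrArg (Nat.cast : ℕ → Mero n) h2
    rw [add_tsub_cancel_right] at h3
    push_cast at h3
    rw [eq_div_iff two_ne_zero, h3]; push_cast; ring

theorem smul_sum_row {n k l : ℕ} {p : Idx n} (hk : k < n) (hp : p ∈ row n k) (ε : ℤ) :
    δ p ^ ε • ∑ q ∈ row n l, (X q + (q.2.val : Mero n)) =
      ∑ q ∈ row n l, (X q + (q.2.val : Mero n)) - ((if l = k then ε else 0 : ℤ) : Mero n) := by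
  have hlow := low_of_mem_row hk p hp
  rw [Finset.smul_sum]
  have h : ∀ q : Idx n, δ p ^ ε • (X q + (q.2.val : Mero n)) =
      (X q + (q.2.val : Mero n)) - (if q = p then (ε : Mero n) else 0) := fun q => by
    rw [smul_add, smul_X, vec_δ_zpow hlow, ← Int.cast_natCast, smul_intCast]
    split_ifs
    · ring
    · simp
  simp only [h, Finset.sum_sub_distrib, Finset.sum_ite_eq']
  simp only [mem_row, mem_row.1 hp, eq_comm (a := k)]
  split_ifs <;> simp

theorem lie_gtH_gen {n i j : ℕ} {N : Finset (Idx n)} (ε : ℤ) (hj : j + 1 < n) :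
    ⁅gtH n (i + 1), gen ε (row n (j + 1)) N⁆ =
      ((ε * ((if i = j then 1 else 0) - if i = j + 1 then 1 else 0) : ℤ) : ℂ) •
        gen ε (row n (j + 1)) N := by
  rw [gtH]
  refine lie_single_one_gen ε _ _ fun p hp => ?_
  rw [smul_sub, smul_sum_row hj hp, smul_sum_row hj hp]
  simp only [add_tsub_cancel_right, add_left_inj]
  push_cast
  split_ifs <;> ring

theorem lie_gtH_gtH (n i j : ℕ) : ⁅gtH n i, gtH n j⁆ = 0 := by
  rw [LieRing.of_associative_ring_bracket, gtH, gtH, SkewMonoidAlgebra.single_mul_single,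
    SkewMonoidAlgebra.single_mul_single, one_smul, one_smul, sub_eq_zero]
  congr 1
  exact mul_comm _ _

/-- The column numbers in `gtH` are what makes the constants agree: their row sums `k(k - 1)/2` have
second difference `1`, matching minus the difference of the sizes of rows `i` and `i + 1`. -/
theorem lie_gtE_gtF {n i : ℕ} (hi : i + 1 < n) :
    ⁅gtE n (i + 1), gtF n (i + 1)⁆ = gtH n (i + 2) - gtH n (i + 1) := by
  have c0 := card_row (n := n) (k := i + 1) (by omega)
  have c1 := card_row (n := n) (k := i + 1 + 1) (by omega)
  have c2 := card_row (n := n) (k := i + 1 - 1) (by omega)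
  rw [gtE_eq, gtF_eq, neg_lie, lie_gen_gen (low_of_mem_row hi) (disjoint_row (by omega))
    (disjoint_row (by omega)) (by rw [c0, c1, c2]; omega), gtH, gtH, ← single_sub,
    ← SkewMonoidAlgebra.single_neg]
  congr 1
  rw [c0, c2]
  simp only [Finset.sum_add_distrib]
  rw [show i + 2 - 1 = i + 1 by omega, show i + 1 - 1 = i by omega, sum_row_column (by omega),
    sum_row_column (by omega), sum_row_column (by omega)]
  push_cast
  ring

/-! ### The Gelfand–Tsetlin homomorphism -/

/-- This reversal explains why `lie_gtE_gtF` carries the sign opposite to that of `gl_n`. -/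
theorem lie_op {A : Type*} [Ring A] (x y : A) :
    ⁅MulOpposite.op x, MulOpposite.op y⁆ = MulOpposite.op ⁅y, x⁆ := by
  simp [LieRing.of_associative_ring_bracket]

/-- The Gelfand–Tsetlin operators satisfy the Chevalley–Serre relations. -/
noncomputable def gtData (n : ℕ) : ChevalleyData n (R n)ᵐᵒᵖ where
  e i := MulOpposite.op (gtE n (i + 1))
  f i := MulOpposite.op (gtF n (i + 1))
  h i := MulOpposite.op (gtH n (i + 1))
  h_h i j _ _ := by rw [lie_op, lie_gtH_gtH, MulOpposite.op_zero]
  h_e i j _ hj := by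
    rw [lie_op, ← lie_skew, gtE_eq, lie_neg, neg_neg, lie_gtH_gen _ hj, ← MulOpposite.op_smul,
      smul_neg, ← neg_smul]
    congr 2
    split_ifs <;> simp
  h_f i j _ hj := by
    rw [lie_op, ← lie_skew, gtF_eq, lie_gtH_gen _ hj, ← MulOpposite.op_smul, ← neg_smul]
    congr 2
    split_ifs <;> simp
  e_f i j hi hj hij := by
    rw [lie_op, ← lie_skew, gtE_eq, gtF_eq, neg_lie, neg_neg]
    by_cases h : j = i + 1
    · subst h
      have := lie_gen_neg (n := n) 1 (low_of_mem_row hi) (low_of_mem_row hj)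
        (disjoint_row (by omega))
      rw [show i + 1 + 1 - 1 = i + 1 by omega, this, MulOpposite.op_zero]
    · rw [lie_gen_of_disjoint _ _ (low_of_mem_row hi) (low_of_mem_row hj)
        (disjoint_row (by omega)) (disjoint_row (by omega)) (disjoint_row (by omega)),
        MulOpposite.op_zero]
  e_f_self i hi := by
    rw [lie_op, ← lie_skew, lie_gtE_gtF hi, neg_sub, MulOpposite.op_sub]
  e_e i j h hj := by
    rw [lie_op, gtE_eq, gtE_eq, lie_neg, neg_lie, neg_neg,
      lie_gen_of_disjoint _ _ (low_of_mem_row hj) (low_of_mem_row (by omega))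
        (disjoint_row (by omega)) (disjoint_row (by omega)) (disjoint_row (by omega)),
        MulOpposite.op_zero]
  f_f i j h hj := by
    rw [lie_op, gtF_eq, gtF_eq,
      lie_gen_of_disjoint _ _ (low_of_mem_row hj) (low_of_mem_row (by omega))
        (disjoint_row (by omega)) (disjoint_row (by omega)) (disjoint_row (by omega)),
        MulOpposite.op_zero]
  e_e_e i hi := by
    rw [lie_op, lie_op, gtE_eq, gtE_eq, lie_neg, lie_neg, neg_lie, neg_lie, neg_lie, neg_neg,
      lie_lie_gen_left _ (low_of_mem_row (by omega)) (low_of_mem_row (by omega))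
        (disjoint_row (by omega)) (disjoint_row (by omega)), neg_zero, MulOpposite.op_zero]
  e_e_e' i hi := by
    rw [lie_op, lie_op, gtE_eq, gtE_eq, lie_neg, lie_neg, neg_lie, neg_lie, neg_lie, neg_neg,
      lie_lie_gen_right _ (low_of_mem_row (by omega)) (low_of_mem_row (by omega))
        (disjoint_row (by omega)) (disjoint_row (by omega)) (disjoint_row (by omega)),
      neg_zero, MulOpposite.op_zero]
  f_f_f i hi := by
    rw [lie_op, lie_op, gtF_eq, gtF_eq, show i + 1 + 1 - 1 = i + 1 by omega,
      lie_lie_gen_right _ (low_of_mem_row (by omega)) (low_of_mem_row (by omega))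
        (disjoint_row (by omega)) (disjoint_row (by omega)) (disjoint_row (by omega)),
      MulOpposite.op_zero]
  f_f_f' i hi := by
    rw [lie_op, lie_op, gtF_eq, gtF_eq, show i + 1 + 1 - 1 = i + 1 by omega,
      lie_lie_gen_left _ (low_of_mem_row (by omega)) (low_of_mem_row (by omega))
        (disjoint_row (by omega)) (disjoint_row (by omega)), MulOpposite.op_zero]

/-- The Gelfand–Tsetlin homomorphism. -/
noncomputable def gtHom (n : ℕ) : U n →ₐ[ℂ] (R n)ᵐᵒᵖ :=
  UniversalEnvelopingAlgebra.lift ℂ (gtData n).lieHom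

theorem isGTHom_gtHom (n : ℕ) : IsGTHom (gtHom n) := by
  refine ⟨fun i j hij => ⟨?_, ?_⟩, fun i => ?_⟩
  · rw [gtHom, UniversalEnvelopingAlgebra.lift_ι_apply, ChevalleyData.lieHom_e _ hij]; rfl
  · rw [gtHom, UniversalEnvelopingAlgebra.lift_ι_apply, ChevalleyData.lieHom_f _ hij]; rfl
  · rw [gtHom, UniversalEnvelopingAlgebra.lift_ι_apply, ChevalleyData.lieHom_h]; rfl

theorem IsGTHom.eq {n : ℕ} {Φ Ψ : U n →ₐ[ℂ] (R n)ᵐᵒᵖ} (hΦ : IsGTHom Φ) (hΨ : IsGTHom Ψ) :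
    Ψ = Φ := by
  refine UniversalEnvelopingAlgebra.hom_ext ℂ (LieHom.ext fun x => ?_)
  let f := (Φ : U n →ₗ⁅ℂ⁆ (R n)ᵐᵒᵖ).comp (UniversalEnvelopingAlgebra.ι ℂ)
  let g := (Ψ : U n →ₗ⁅ℂ⁆ (R n)ᵐᵒᵖ).comp (UniversalEnvelopingAlgebra.ι ℂ)
  let S : LieSubalgebra ℂ (Gl n) :=
    { carrier := {x | g x = f x}
      zero_mem' := by simp
      add_mem' := fun {x y} hx hy => by
        change g (x + y) = f (x + y); rw [map_add, map_add, hx, hy]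
      smul_mem' := fun c x hx => by
        change g (c • x) = f (c • x); rw [map_smul, map_smul, hx]
      lie_mem' := fun {x y} hx hy => by
        change g ⁅x, y⁆ = f ⁅x, y⁆; rw [LieHom.map_lie, LieHom.map_lie, hx, hy] }
  exact mem_of_generators_mem S
    (fun i j hij => ⟨(hΨ.1 i j hij).1.trans (hΦ.1 i j hij).1.symm,
      (hΨ.1 i j hij).2.trans (hΦ.1 i j hij).2.symm⟩)
    (fun i => (hΨ.2 i).trans (hΦ.2 i).symm) x

/-! ### The involution on functions and operators -/

theorem analyticAt_swap {n : ℕ} (a b : Idx n) (x : V n) :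
    AnalyticAt ℂ (fun x : V n => fun p => x (Equiv.swap a b p)) x :=
  (ContinuousLinearMap.pi fun p : Idx n => ContinuousLinearMap.proj (R := ℂ)
    (φ := fun _ : Idx n => ℂ) (Equiv.swap a b p)).analyticAt x

/-- The involution `F ↦ F ∘ τ` of the algebra of entire functions. -/
noncomputable def tauEntire {n : ℕ} (a b : Idx n) : Entire n ≃ₐ[ℂ] Entire n where
  toFun F := ⟨fun x => F fun p => x (Equiv.swap a b p), fun x _ =>
    (F.analyticAt _).comp (f := fun x : V n => fun p => x (Equiv.swap a b p))
      (analyticAt_swap a b x)⟩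
  invFun F := ⟨fun x => F fun p => x (Equiv.swap a b p), fun x _ =>
    (F.analyticAt _).comp (f := fun x : V n => fun p => x (Equiv.swap a b p))
      (analyticAt_swap a b x)⟩
  left_inv F := Subtype.ext <| funext fun x => by
    change F (fun p => x (Equiv.swap a b (Equiv.swap a b p))) = F x
    simp
  right_inv F := Subtype.ext <| funext fun x => by
    change F (fun p => x (Equiv.swap a b (Equiv.swap a b p))) = F x
    simp
  map_mul' _ _ := rfl
  map_add' _ _ := rfl
  commutes' _ := rfl

/-- The involution `h ↦ h ∘ τ` of the field of meromorphic functions. -/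
noncomputable def tau {n : ℕ} (a b : Idx n) : Mero n →ₐ[ℂ] Mero n :=
  { (IsFractionRing.ringEquivOfRingEquiv (K := Mero n) (L := Mero n)
      (tauEntire a b).toRingEquiv).toRingHom with
    commutes' := fun c => by
      change IsFractionRing.ringEquivOfRingEquiv (tauEntire a b).toRingEquiv _ = _
      rw [IsScalarTower.algebraMap_apply ℂ (Entire n) (Mero n),
        IsFractionRing.ringEquivOfRingEquiv_algebraMap]
      exact congrArg _ ((tauEntire a b).commutes c) }

section tau

variable {n : ℕ} {a b : Idx n}

theorem tau_algebraMap (F : Entire n) :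
    tau a b (algebraMap (Entire n) (Mero n) F) = algebraMap (Entire n) (Mero n) (tauEntire a b F) :=
  IsFractionRing.ringEquivOfRingEquiv_algebraMap _ _

theorem tau_X (p : Idx n) : tau a b (X p) = X (Equiv.swap a b p) := tau_algebraMap _

theorem tau_tau (h : Mero n) : tau a b (tau a b h) = h := by
  obtain ⟨p, q, _, rfl⟩ := IsFractionRing.div_surjective (Entire n) h
  have e : ∀ F : Entire n, tauEntire a b (tauEntire a b F) = F := (tauEntire a b).left_inv
  simp only [map_div₀, tau_algebraMap, e]

theorem tau_z : tau a b (z a b) = -z a b := by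
  rw [z, map_sub, tau_X, tau_X, Equiv.swap_apply_left, Equiv.swap_apply_right, neg_sub]

theorem Γ_ext {σ ρ : Γ n} (h : ∀ p, vec σ p = vec ρ p) : σ = ρ := by
  refine Multiplicative.toAdd.injective (funext fun q => ?_)
  have := h q.1
  unfold vec at this
  rwa [dif_pos q.2, dif_pos q.2] at this

theorem fst_swap (hab : a.1 = b.1) (p : Idx n) : (Equiv.swap a b p).1 = p.1 := by
  rw [Equiv.swap_apply_def]
  split_ifs with h1 h2
  · rw [h1, hab]
  · rw [h2, hab]
  · rfl

theorem vec_conj (hab : a.1 = b.1) (σ : Γ n) (p : Idx n) :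
    vec (conj a b σ) p = vec σ (Equiv.swap a b p) := by
  by_cases hp : p.1.val + 1 < n
  · conv_lhs => unfold vec
    rw [dif_pos hp]; rfl
  · have hp' : ¬ ((Equiv.swap a b p).1.val + 1 < n) := by rwa [fst_swap hab]
    unfold vec; rw [dif_neg hp, dif_neg hp']

theorem conj_mul (hab : a.1 = b.1) (σ ρ : Γ n) :
    conj a b (σ * ρ) = conj a b σ * conj a b ρ :=
  Γ_ext fun p => by simp only [vec_conj hab, vec_mul]

theorem conj_one (hab : a.1 = b.1) : conj a b (1 : Γ n) = 1 :=
  Γ_ext fun p => by simp only [vec_conj hab, vec_one]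

theorem conj_conj (hab : a.1 = b.1) (σ : Γ n) : conj a b (conj a b σ) = σ :=
  Γ_ext fun p => by simp only [vec_conj hab, Equiv.swap_apply_self]

theorem conj_zpow (hab : a.1 = b.1) (σ : Γ n) (m : ℤ) :
    conj a b (σ ^ m) = conj a b σ ^ m :=
  Γ_ext fun p => by simp only [vec_conj hab, vec_zpow]

theorem conj_δ (hab : a.1 = b.1) {p : Idx n} (hp : p.1.val + 1 < n) :
    conj a b (δ p) = δ (Equiv.swap a b p) :=
  Γ_ext fun q => by
    rw [vec_conj hab, vec_δ hp, vec_δ (by rwa [fst_swap hab])]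
    simp only [Equiv.swap_apply_eq_iff]

/-- The dichotomy behind all pole estimates: the shifts fixed by the involution are those that fix
`z₁`, and all others move `z₁ = 0` away from `o`. -/
theorem conj_eq_self_iff (hab : a.1 = b.1) (σ : Γ n) :
    conj a b σ = σ ↔ vec σ a = vec σ b := by
  constructor
  · intro h
    conv_lhs => rw [← h]
    rw [vec_conj hab, Equiv.swap_apply_left]
  · refine fun h => Γ_ext fun p => ?_
    rw [vec_conj hab, Equiv.swap_apply_def]
    split_ifs with h1 h2
    · rw [h1, h]
    · rw [h2, h]
    · rfl

theorem tau_smul (hab : a.1 = b.1) (σ : Γ n) (h : Mero n) :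
    tau a b (σ • h) = conj a b σ • tau a b h := by
  have e : ∀ F : Entire n, tauEntire a b (σ • F) = conj a b σ • tauEntire a b F := fun F => by
    refine Subtype.ext (funext fun x => ?_)
    change F (shift σ⁻¹ fun p => x (Equiv.swap a b p)) =
      F fun p => shift (conj a b σ)⁻¹ x (Equiv.swap a b p)
    refine congrArg F.1 (funext fun p => ?_)
    simp only [shift, vec_inv, vec_conj hab, Equiv.swap_apply_self]
  obtain ⟨p, q, _, rfl⟩ := IsFractionRing.div_surjective (Entire n) h
  simp only [map_div₀, smul_div₀', smul_algebraMap, tau_algebraMap, e]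

end tau

/-- Conjugation by the involution, as a homomorphism of the shift group. -/
def conjHom {n : ℕ} {a b : Idx n} (hab : a.1 = b.1) : Γ n →* Γ n where
  toFun := conj a b
  map_one' := conj_one hab
  map_mul' := conj_mul hab

/-- Conjugation by the involution on the skew group ring. -/
noncomputable def tauR {n : ℕ} {a b : Idx n} (hab : a.1 = b.1) : R n →ₐ[ℂ] R n :=
  SkewMonoidAlgebra.liftNCAlgHom
    ({ SkewMonoidAlgebra.singleOneRingHom.comp (tau a b).toRingHom with
        commutes' := fun c => by
          change SkewMonoidAlgebra.single 1 (tau a b (algebraMap ℂ _ c)) = _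
          rw [AlgHom.commutes]; rfl } : Mero n →ₐ[ℂ] R n)
    ((SkewMonoidAlgebra.of (Mero n) (Γ n)).comp (conjHom hab))
    (fun {h σ} => by
      change SkewMonoidAlgebra.single 1 (tau a b (σ • h)) * SkewMonoidAlgebra.single (conj a b σ) 1 =
        SkewMonoidAlgebra.single (conj a b σ) 1 * SkewMonoidAlgebra.single 1 (tau a b h)
      simp [SkewMonoidAlgebra.single_mul_single, tau_smul hab])

section tauR

variable {n : ℕ} {a b : Idx n} (hab : a.1 = b.1)

theorem tauR_single (σ : Γ n) (h : Mero n) :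
    tauR hab (SkewMonoidAlgebra.single σ h) =
      SkewMonoidAlgebra.single (conj a b σ) (tau a b h) := by
  change SkewMonoidAlgebra.liftNC _ _ (SkewMonoidAlgebra.single σ h) = _
  rw [SkewMonoidAlgebra.liftNC_single]
  change SkewMonoidAlgebra.single 1 (tau a b h) * SkewMonoidAlgebra.single (conj a b σ) 1 = _
  simp [SkewMonoidAlgebra.single_mul_single]

theorem coeff_tauR (A : R n) (σ : Γ n) :
    (tauR hab A).coeff σ = tau a b (A.coeff (conj a b σ)) := by
  classical
  induction A using SkewMonoidAlgebra.induction_on with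
  | zero => simp
  | single ρ h =>
    rw [tauR_single, SkewMonoidAlgebra.coeff_single_apply, SkewMonoidAlgebra.coeff_single_apply]
    have : conj a b ρ = σ ↔ ρ = conj a b σ :=
      ⟨fun h => by rw [← h, conj_conj hab], fun h => by rw [h, conj_conj hab]⟩
    simp only [this]
    split_ifs <;> simp
  | add A B hA hB => simp [hA, hB]

end tauR

/-! ### Values and derivatives of germs -/

section germ

variable {n : ℕ} {a b : Idx n} {o : V n}

theorem IsGerm.val_eq {h : Mero n} {g : V n → ℂ} (hg : IsGerm o h g) : val o h = g o :=
  hg.rep_eq.eq_of_nhds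

theorem IsGerm.dz_eq {h : Mero n} {g : V n → ℂ} (hg : IsGerm o h g) :
    dz a b o h = fderiv ℂ g o (dir a b) := by
  rw [dz, hg.rep_eq.fderiv_eq]

theorem val_algebraMap (F : Entire n) : val o (algebraMap (Entire n) (Mero n) F) = F o :=
  (isGerm_algebraMap o F).val_eq

theorem dz_algebraMap (F : Entire n) :
    dz a b o (algebraMap (Entire n) (Mero n) F) = fderiv ℂ F o (dir a b) :=
  (isGerm_algebraMap o F).dz_eq

theorem val_add {h h' : Mero n} (H : IsHol o h) (H' : IsHol o h') :
    val o (h + h') = val o h + val o h' := (H.isGerm_rep.add H'.isGerm_rep).val_eq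

theorem val_mul {h h' : Mero n} (H : IsHol o h) (H' : IsHol o h') :
    val o (h * h') = val o h * val o h' := (H.isGerm_rep.mul H'.isGerm_rep).val_eq

theorem dz_mul {h h' : Mero n} (H : IsHol o h) (H' : IsHol o h') :
    dz a b o (h * h') = dz a b o h * val o h' + val o h * dz a b o h' := by
  rw [(H.isGerm_rep.mul H'.isGerm_rep).dz_eq,
    fderiv_mul H.isGerm_rep.1.differentiableAt H'.isGerm_rep.1.differentiableAt]
  simp only [add_apply, smul_apply, smul_eq_mul, dz, val]
  ring

theorem isHol_const (c : ℂ) : IsHol o (algebraMap ℂ (Mero n) c) := by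
  rw [IsScalarTower.algebraMap_apply ℂ (Entire n) (Mero n)]; exact isHol_algebraMap o _

theorem val_const (c : ℂ) : val o (algebraMap ℂ (Mero n) c) = c := by
  rw [IsScalarTower.algebraMap_apply ℂ (Entire n) (Mero n), val_algebraMap]; rfl

theorem val_zero : val o (0 : Mero n) = 0 := by
  simpa using val_const (o := o) 0

theorem dz_zero : dz a b o (0 : Mero n) = 0 := by
  simpa using dz_smul a b (0 : ℂ) (isHol_zero o)

theorem val_one : val o (1 : Mero n) = 1 := by
  simpa using val_const (o := o) 1

theorem isHol_one : IsHol o (1 : Mero n) := by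
  simpa using isHol_const (o := o) (n := n) 1

theorem val_smul (c : ℂ) {h : Mero n} (H : IsHol o h) : val o (c • h) = c * val o h := by
  rw [Algebra.smul_def, val_mul (isHol_const c) H, val_const]

theorem IsHol.neg {h : Mero n} (H : IsHol o h) : IsHol o (-h) := by
  simpa using H.smul (-1)

theorem IsHol.sub {h h' : Mero n} (H : IsHol o h) (H' : IsHol o h') : IsHol o (h - h') := by
  rw [sub_eq_add_neg]; exact H.add H'.neg

theorem val_neg {h : Mero n} (H : IsHol o h) : val o (-h) = -val o h := by
  simpa using val_smul (-1) H

theorem dz_neg {h : Mero n} (H : IsHol o h) : dz a b o (-h) = -dz a b o h := by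
  simpa using dz_smul a b (-1) H

theorem isHol_X (p : Idx n) : IsHol o (X p) := isHol_algebraMap o _

theorem val_X (p : Idx n) : val o (X p) = o p := val_algebraMap _

theorem val_sub {h h' : Mero n} (H : IsHol o h) (H' : IsHol o h') :
    val o (h - h') = val o h - val o h' := by
  rw [sub_eq_add_neg, val_add H H'.neg, val_neg H', sub_eq_add_neg]

theorem IsHol.inv {h : Mero n} (H : IsHol o h) (h0 : val o h ≠ 0) : IsHol o h⁻¹ := by
  obtain ⟨ga, p, q, hq, hpq, hgq⟩ := H.isGerm_rep
  have hne : h ≠ 0 := fun e => h0 (by rw [e, val_zero])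
  have inj := IsFractionRing.injective (Entire n) (Mero n)
  have hp : p ≠ 0 := fun e => by
    rw [e, map_zero] at hpq
    exact mul_ne_zero hne ((map_ne_zero_iff _ inj).2 hq) hpq
  refine ⟨(rep o h)⁻¹, ga.inv h0, q, p, hp, ?_, ?_⟩
  · rw [← hpq, inv_mul_cancel_left₀ hne]
  · filter_upwards [hgq, ga.continuousAt.eventually_ne h0] with x h1 h2
    rw [← h1, Pi.inv_apply, inv_mul_cancel_left₀ h2]

theorem swap_eq_self (hoab : o a = o b) : (fun p => o (Equiv.swap a b p)) = o := by
  funext p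
  rw [Equiv.swap_apply_def]
  split_ifs with h1 h2
  · rw [h1, hoab]
  · rw [h2, hoab]
  · rfl

theorem IsGerm.tau (hoab : o a = o b) {h : Mero n} {g : V n → ℂ} (hg : IsGerm o h g) :
    IsGerm o (tau a b h) (fun x => g fun p => x (Equiv.swap a b p)) := by
  have e := swap_eq_self hoab
  obtain ⟨ga, p, q, hq, hpq, hgq⟩ := hg
  refine ⟨?_, tauEntire a b p, tauEntire a b q, ?_, ?_, ?_⟩
  · refine AnalyticAt.comp (g := g) (f := fun x : V n => fun p => x (Equiv.swap a b p)) ?_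
      (analyticAt_swap a b o)
    rwa [e]
  · exact (map_ne_zero_iff _ (tauEntire a b).injective).2 hq
  · rw [← tau_algebraMap, ← tau_algebraMap, ← hpq, map_mul]
  · have hc : Tendsto (fun x : V n => fun p => x (Equiv.swap a b p)) (𝓝 o) (𝓝 o) := by
      have := (analyticAt_swap a b o).continuousAt
      rwa [ContinuousAt, e] at this
    exact hc.eventually hgq

theorem IsHol.tau (hoab : o a = o b) {h : Mero n} (H : IsHol o h) : IsHol o (tau a b h) :=
  ⟨_, H.isGerm_rep.tau hoab⟩

theorem val_tau (hoab : o a = o b) {h : Mero n} (H : IsHol o h) :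
    val o (tau a b h) = val o h := by
  rw [(H.isGerm_rep.tau hoab).val_eq, swap_eq_self hoab]; rfl

theorem dir_swap (p : Idx n) : dir a b (Equiv.swap a b p) = -dir a b p := by
  simp only [dir, Pi.smul_apply, Pi.sub_apply, Pi.single_apply, smul_eq_mul,
    Equiv.swap_apply_eq_iff, Equiv.swap_apply_left, Equiv.swap_apply_right]
  ring

/-- The involution fixes `o` and reverses the direction of `∂/∂z₁`. -/
theorem dz_tau (hoab : o a = o b) {h : Mero n} (H : IsHol o h) :
    dz a b o (tau a b h) = -dz a b o h := by
  let T : V n →L[ℂ] V n := ContinuousLinearMap.pi fun p : Idx n => ContinuousLinearMap.proj (R := ℂ)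
    (φ := fun _ : Idx n => ℂ) (Equiv.swap a b p)
  have hT : T o = o := swap_eq_self hoab
  rw [(H.isGerm_rep.tau hoab).dz_eq, dz]
  change fderiv ℂ (rep o h ∘ T) o (dir a b) = _
  have hd : DifferentiableAt ℂ (rep o h) (T o) := by
    rw [hT]; exact H.isGerm_rep.1.differentiableAt
  rw [fderiv_comp o hd T.differentiableAt, hT, ContinuousLinearMap.fderiv,
    ContinuousLinearMap.comp_apply, ← map_neg]
  congr 1
  funext p
  exact dir_swap p

theorem val_z (hoab : o a = o b) : val o (z a b) = 0 := by
  rw [z, val_sub (isHol_X a) (isHol_X b), val_X, val_X, hoab, sub_self]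

theorem dz_z (hne : a ≠ b) : dz a b o (z a b) = 1 := by
  have e : z a b = algebraMap (Entire n) (Mero n) (coord a - coord b) := by
    rw [map_sub]; rfl
  let T : V n →L[ℂ] ℂ := ContinuousLinearMap.proj (R := ℂ) (φ := fun _ : Idx n => ℂ) a -
    ContinuousLinearMap.proj (R := ℂ) (φ := fun _ : Idx n => ℂ) b
  have e1 : (coord a - coord b : Entire n).1 = T := rfl
  rw [e, dz_algebraMap, e1, ContinuousLinearMap.fderiv]
  change dir a b a - dir a b b = 1
  simp [dir, hne, hne.symm]
  norm_num

theorem z_ne_zero (hne : a ≠ b) : z a b ≠ (0 : Mero n) := X_sub_X_ne hne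

end germ

/-! ### Functions with a holomorphic divided difference -/

section reg

variable {n : ℕ} {a b : Idx n} {o : V n}

/-- The functions `h` holomorphic at `o` such that `(h - τ(h)) / z₁` is holomorphic at `o`. -/
noncomputable def reg (ho : IsOneSingular a b o) : Subalgebra ℂ (Mero n) where
  carrier := {h | IsHol o h ∧ IsHol o ((z a b)⁻¹ * (h - tau a b h))}
  mul_mem' {h g} hh hg := by
    refine ⟨hh.1.mul hg.1, ?_⟩
    -- The divided difference obeys a Leibniz rule twisted by `τ`.
    have e : (z a b)⁻¹ * (h * g - tau a b (h * g)) =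
        (z a b)⁻¹ * (h - tau a b h) * g + tau a b h * ((z a b)⁻¹ * (g - tau a b g)) := by
      rw [map_mul]; ring
    rw [e]
    exact (hh.2.mul hg.1).add ((hh.1.tau ho.2.2.1).mul hg.2)
  add_mem' {h g} hh hg := by
    refine ⟨hh.1.add hg.1, ?_⟩
    have e : (z a b)⁻¹ * (h + g - tau a b (h + g)) =
        (z a b)⁻¹ * (h - tau a b h) + (z a b)⁻¹ * (g - tau a b g) := by
      rw [map_add]; ring
    rw [e]
    exact hh.2.add hg.2
  algebraMap_mem' c := by
    refine ⟨isHol_const c, ?_⟩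
    rw [AlgHom.commutes, sub_self, mul_zero]
    exact isHol_zero o

variable (ho : IsOneSingular a b o)
include ho

theorem tau_mem_reg {h : Mero n} (hh : h ∈ reg ho) : tau a b h ∈ reg ho := by
  refine ⟨hh.1.tau ho.2.2.1, ?_⟩
  rw [tau_tau, show (z a b)⁻¹ * (tau a b h - h) = -((z a b)⁻¹ * (h - tau a b h)) by ring]
  exact hh.2.neg

theorem mem_reg_of_tau_eq {h : Mero n} (hh : IsHol o h) (hτ : tau a b h = h) : h ∈ reg ho := by
  refine ⟨hh, ?_⟩
  rw [hτ, sub_self, mul_zero]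
  exact isHol_zero o

theorem inv_mem_reg {h : Mero n} (hh : h ∈ reg ho) (h0 : val o h ≠ 0) : h⁻¹ ∈ reg ho := by
  have h0' : val o (tau a b h) ≠ 0 := by rwa [val_tau ho.2.2.1 hh.1]
  have hne : h ≠ 0 := fun e => h0 (by rw [e, val_zero])
  have hne' : tau a b h ≠ 0 := fun e => h0' (by rw [e, val_zero])
  refine ⟨hh.1.inv h0, ?_⟩
  have e : (z a b)⁻¹ * (h⁻¹ - tau a b h⁻¹) =
      -((z a b)⁻¹ * (h - tau a b h) * (h⁻¹ * (tau a b h)⁻¹)) := by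
    rw [map_inv₀]
    field_simp
    ring
  rw [e]
  exact (hh.2.mul ((hh.1.inv h0).mul ((hh.1.tau ho.2.2.1).inv h0'))).neg

theorem X_mem_reg (p : Idx n) : X p ∈ reg ho := by
  refine ⟨isHol_X p, ?_⟩
  rw [tau_X, Equiv.swap_apply_def]
  have hz := z_ne_zero ho.2.1
  split_ifs with h1 h2
  · rw [h1, ← z, inv_mul_cancel₀ hz]; exact isHol_one
  · rw [h2, show X b - X a = -z a b by rw [z]; ring, mul_neg, inv_mul_cancel₀ hz]
    exact isHol_one.neg
  · rw [sub_self, mul_zero]; exact isHol_zero o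

theorem intCast_mem_reg (m : ℤ) : (m : Mero n) ∈ reg ho := intCast_mem _ m

theorem z_mem_reg : z a b ∈ reg ho := sub_mem (X_mem_reg ho a) (X_mem_reg ho b)

omit ho in
theorem smul_z (σ : Γ n) : σ • z a b = z a b - ((vec σ a - vec σ b : ℤ) : Mero n) := by
  rw [z, smul_sub, smul_X, smul_X]; push_cast; ring

theorem val_smul_z (σ : Γ n) : val o (σ • z a b) = -((vec σ a - vec σ b : ℤ) : ℂ) := by
  have e : ((vec σ a - vec σ b : ℤ) : Mero n) =
      algebraMap ℂ (Mero n) ((vec σ a - vec σ b : ℤ) : ℂ) := (map_intCast _ _).symm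
  rw [smul_z, e, val_sub (isHol_z a b o) (isHol_const _), val_const, val_z ho.2.2.1, zero_sub]

omit ho in
theorem smul_z_of_eq {σ : Γ n} (h : vec σ a = vec σ b) : σ • z a b = z a b := by
  rw [smul_z, h]; simp

/-- The functions all of whose shifts have a holomorphic divided difference. -/
noncomputable def orbReg : Subalgebra ℂ (Mero n) where
  carrier := {h | ∀ σ : Γ n, σ • h ∈ reg ho}
  mul_mem' hh hg σ := by rw [smul_mul']; exact mul_mem (hh σ) (hg σ)
  add_mem' hh hg σ := by rw [smul_add]; exact add_mem (hh σ) (hg σ)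
  algebraMap_mem' c σ := by rw [_root_.smul_algebraMap]; exact algebraMap_mem _ c

theorem smul_mem_orbReg {h : Mero n} (hh : h ∈ orbReg ho) (σ : Γ n) : σ • h ∈ orbReg ho :=
  fun ρ => by rw [smul_smul]; exact hh _

theorem X_mem_orbReg (p : Idx n) : X p ∈ orbReg ho := fun σ => by
  rw [smul_X]; exact sub_mem (X_mem_reg ho p) (intCast_mem_reg ho _)

theorem z_mem_orbReg : z a b ∈ orbReg ho := sub_mem (X_mem_orbReg ho a) (X_mem_orbReg ho b)

/-- Along the orbit `X p - X q` changes only by integers, and its value at `o` is not an integer. -/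
theorem inv_mem_orbReg {p q : Idx n} (hrow : p.1 = q.1) (hpq : p ≠ q) (h1 : ¬(p = a ∧ q = b))
    (h2 : ¬(p = b ∧ q = a)) : (X p - X q)⁻¹ ∈ orbReg ho := fun σ => by
  rw [smul_inv₀', smul_sub, smul_X, smul_X]
  refine inv_mem_reg ho (sub_mem (sub_mem (X_mem_reg ho p) (intCast_mem_reg ho _))
    (sub_mem (X_mem_reg ho q) (intCast_mem_reg ho _))) ?_
  have e : X p - (vec σ p : Mero n) - (X q - (vec σ q : Mero n)) =
      X p - X q - algebraMap ℂ (Mero n) ((vec σ p - vec σ q : ℤ) : ℂ) := by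
    rw [map_intCast]; push_cast; ring
  rw [e, val_sub ((isHol_X p).sub (isHol_X q)) (isHol_const _), val_sub (isHol_X p) (isHol_X q),
    val_X, val_X, val_const]
  exact sub_ne_zero.2 (ho.2.2.2 p q hrow hpq h1 h2 _)

/-- The operators with coefficients in `orbReg` whose shifts preserve `z₁`. -/
noncomputable def regOps : Subalgebra ℂ (R n) where
  carrier := {A | ∀ s, A.coeff s ∈ orbReg ho ∧ (A.coeff s ≠ 0 → vec s a = vec s b)}
  mul_mem' {A B} hA hB s := by
    rw [SkewMonoidAlgebra.coeff_mul_left, SkewMonoidAlgebra.sum_def']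
    refine ⟨sum_mem fun σ _ => mul_mem (hA σ).1 (smul_mem_orbReg ho (hB _).1 σ), fun h => ?_⟩
    obtain ⟨σ, _, hσ⟩ := Finset.exists_ne_zero_of_sum_ne_zero h
    have h1 := (hA σ).2 (left_ne_zero_of_mul hσ)
    have h2 := (hB (σ⁻¹ * s)).2 fun e => right_ne_zero_of_mul hσ (by rw [e, smul_zero])
    simp only [vec_mul, vec_inv] at h2
    omega
  add_mem' {A B} hA hB s := by
    rw [SkewMonoidAlgebra.coeff_add, Finsupp.add_apply]
    refine ⟨add_mem (hA s).1 (hB s).1, fun h => ?_⟩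
    by_cases h1 : A.coeff s = 0
    · rw [h1, zero_add] at h; exact (hB s).2 h
    · exact (hA s).2 h1
  algebraMap_mem' c s := by
    classical
    change (SkewMonoidAlgebra.single 1 (algebraMap ℂ (Mero n) c)).coeff s ∈ _ ∧
      ((SkewMonoidAlgebra.single 1 (algebraMap ℂ (Mero n) c)).coeff s ≠ 0 → _)
    rw [SkewMonoidAlgebra.coeff_single_apply]
    split_ifs with h
    · subst h; exact ⟨algebraMap_mem _ c, fun _ => by rw [vec_one, vec_one]⟩
    · exact ⟨zero_mem _, fun h => absurd rfl h⟩

/-- The operators whose coefficients have at most a simple pole along `z₁ = 0` on the orbit. -/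
noncomputable def poleOps : Submodule ℂ (R n) where
  carrier := {A | ∀ s, z a b * A.coeff s ∈ orbReg ho}
  zero_mem' s := by simp
  add_mem' {A B} hA hB s := by
    rw [SkewMonoidAlgebra.coeff_add, Finsupp.add_apply, mul_add]
    exact add_mem (hA s) (hB s)
  smul_mem' c A hA s := by
    rw [SkewMonoidAlgebra.coeff_smul, Finsupp.smul_apply, mul_smul_comm]
    exact Subalgebra.smul_mem _ (hA s) c

theorem single_mem_regOps {σ : Γ n} {h : Mero n} (hh : h ∈ orbReg ho)
    (hσ : vec σ a = vec σ b) : SkewMonoidAlgebra.single σ h ∈ regOps ho := fun s => by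
  classical
  rw [SkewMonoidAlgebra.coeff_single_apply]
  split_ifs with e
  · subst e; exact ⟨hh, fun _ => hσ⟩
  · exact ⟨zero_mem _, fun h => absurd rfl h⟩

theorem single_mem_poleOps (σ : Γ n) {h : Mero n} (hh : z a b * h ∈ orbReg ho) :
    SkewMonoidAlgebra.single σ h ∈ poleOps ho := fun s => by
  classical
  rw [SkewMonoidAlgebra.coeff_single_apply]
  split_ifs with e
  · exact hh
  · rw [mul_zero]; exact zero_mem _

theorem regOps_le_poleOps {A : R n} (hA : A ∈ regOps ho) : A ∈ poleOps ho := fun s =>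
  mul_mem (z_mem_orbReg ho) (hA s).1

/-- The shifts occurring in `A` fix `z₁`, so the factor `z₁` can be moved past them onto the
coefficients of `B`. -/
theorem regOps_mul_poleOps {A B : R n} (hA : A ∈ regOps ho) (hB : B ∈ poleOps ho) :
    A * B ∈ poleOps ho := fun s => by
  rw [SkewMonoidAlgebra.coeff_mul_left, SkewMonoidAlgebra.sum_def', Finset.mul_sum]
  refine sum_mem fun σ hσ => ?_
  have h := (hA σ).2 (SkewMonoidAlgebra.mem_support_iff.1 hσ)
  have e : z a b * (A.coeff σ * σ • B.coeff (σ⁻¹ * s)) =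
      A.coeff σ * σ • (z a b * B.coeff (σ⁻¹ * s)) := by
    rw [smul_mul', smul_z_of_eq h]; ring
  rw [e]
  exact mul_mem (hA σ).1 (smul_mem_orbReg ho (hB _) σ)

theorem poleOps_mul_regOps {A B : R n} (hA : A ∈ poleOps ho) (hB : B ∈ regOps ho) :
    A * B ∈ poleOps ho := fun s => by
  rw [SkewMonoidAlgebra.coeff_mul_left, SkewMonoidAlgebra.sum_def', Finset.mul_sum]
  refine sum_mem fun σ _ => ?_
  rw [← mul_assoc]
  exact mul_mem (hA σ) (smul_mem_orbReg ho (hB _).1 σ)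

/-! ### Poles of the Gelfand–Tsetlin operators -/

theorem coef_mem_orbReg {M N : Finset (Idx n)} {p : Idx n} (hM : ∀ q ∈ M, q.1 = p.1)
    (h : ∀ q ∈ M, ¬(p = a ∧ q = b) ∧ ¬(p = b ∧ q = a)) : coef M N p ∈ orbReg ho := by
  rw [coef, div_eq_mul_inv, ← Finset.prod_inv_distrib]
  refine mul_mem (prod_mem fun q _ => sub_mem (X_mem_orbReg ho p) (X_mem_orbReg ho q))
    (prod_mem fun q hq => ?_)
  have hq' := Finset.mem_of_mem_erase hq
  exact inv_mem_orbReg ho (hM q hq').symm (Finset.ne_of_mem_erase hq).symm (h q hq').1 (h q hq').2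

/-- At most one factor of the denominator is `±z₁`; all others are invertible on the orbit. -/
theorem z_mul_coef_mem_orbReg {M N : Finset (Idx n)} {p : Idx n} (hM : ∀ q ∈ M, q.1 = p.1) :
    z a b * coef M N p ∈ orbReg ho := by
  by_cases h : ∀ q ∈ M, ¬(p = a ∧ q = b) ∧ ¬(p = b ∧ q = a)
  · exact mul_mem (z_mem_orbReg ho) (coef_mem_orbReg ho hM h)
  push Not at h
  obtain ⟨q, hq, hpq⟩ := h
  have hpq' : (p = a ∧ q = b) ∨ (p = b ∧ q = a) := by tauto
  have hne : q ≠ p := by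
    rcases hpq' with ⟨rfl, rfl⟩ | ⟨rfl, rfl⟩
    · exact ho.2.1.symm
    · exact ho.2.1
  have hz : z a b * (X p - X q)⁻¹ ∈ orbReg ho := by
    have hz0 := z_ne_zero (n := n) ho.2.1
    rcases hpq' with ⟨rfl, rfl⟩ | ⟨rfl, rfl⟩
    · rw [← z, mul_inv_cancel₀ hz0]; exact one_mem _
    · rw [show X p - X q = -z q p by rw [z]; ring, inv_neg, mul_neg, mul_inv_cancel₀ hz0]
      exact neg_mem (one_mem _)
  rw [coef, ← Finset.mul_prod_erase _ _ (Finset.mem_erase.2 ⟨hne, hq⟩), div_eq_mul_inv, mul_inv,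
    ← Finset.prod_inv_distrib, mul_left_comm, ← mul_assoc (z a b)]
  refine mul_mem (prod_mem fun q _ => sub_mem (X_mem_orbReg ho p) (X_mem_orbReg ho q))
    (mul_mem hz (prod_mem fun r hr => ?_))
  have hr1 := Finset.mem_of_mem_erase hr
  have hr2 := Finset.ne_of_mem_erase hr
  refine inv_mem_orbReg ho (hM r (Finset.mem_of_mem_erase hr1)).symm
    (Finset.ne_of_mem_erase hr1).symm ?_ ?_
  · rintro ⟨rfl, rfl⟩
    rcases hpq' with ⟨_, rfl⟩ | ⟨h, rfl⟩
    · exact hr2 rfl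
    · exact ho.2.1 h
  · rintro ⟨rfl, rfl⟩
    rcases hpq' with ⟨h, rfl⟩ | ⟨_, rfl⟩
    · exact ho.2.1 h.symm
    · exact hr2 rfl

theorem gen_mem_poleOps (ε : ℤ) (k : ℕ) (N : Finset (Idx n)) :
    gen ε (row n k) N ∈ poleOps ho :=
  sum_mem fun p hp => single_mem_poleOps ho _ <| z_mul_coef_mem_orbReg ho fun q hq =>
    Fin.ext (by have := mem_row.1 hp; have := mem_row.1 hq; omega)

/-- Outside the row of `a` and `b` neither the denominators nor the shifts involve the critical
entries. -/
theorem gen_mem_regOps (ε : ℤ) {k : ℕ} (N : Finset (Idx n)) (hk : k < n) (hka : k ≠ a.1.val + 1) :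
    gen ε (row n k) N ∈ regOps ho := by
  have hab : a.1 = b.1 := ho.1
  refine sum_mem fun p hp => single_mem_regOps ho (coef_mem_orbReg ho (fun q hq =>
    Fin.ext (by have := mem_row.1 hp; have := mem_row.1 hq; omega)) fun q hq => ?_) ?_
  · constructor
    · rintro ⟨rfl, _⟩; exact hka (mem_row.1 hp).symm
    · rintro ⟨_, rfl⟩; exact hka (mem_row.1 hq).symm
  · have hlow := low_of_mem_row hk p hp
    rw [vec_δ_zpow hlow, vec_δ_zpow hlow, if_neg, if_neg]
    · rintro rfl; exact hka (by rw [hab]; exact (mem_row.1 hp).symm)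
    · rintro rfl; exact hka (mem_row.1 hp).symm

theorem gtH_mem_regOps (k : ℕ) : gtH n k ∈ regOps ho := by
  refine single_mem_regOps ho (sub_mem (sum_mem fun p _ => ?_) (sum_mem fun p _ => ?_))
    (by rw [vec_one, vec_one]) <;>
  exact add_mem (X_mem_orbReg ho p) (natCast_mem _ _)

end reg

/-! ### The operators of `gl_n` and the order of their poles -/

/-- The operator by which an element of the enveloping algebra acts from the right. -/
noncomputable def gtOp {n : ℕ} (u : U n) : R n := (gtHom n u).unop

theorem gtOp_mul {n : ℕ} (u v : U n) : gtOp (u * v) = gtOp v * gtOp u := by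
  rw [gtOp, map_mul]; rfl

theorem gtOp_add {n : ℕ} (u v : U n) : gtOp (u + v) = gtOp u + gtOp v := by
  rw [gtOp, map_add]; rfl

theorem gtOp_smul {n : ℕ} (c : ℂ) (u : U n) : gtOp (c • u) = c • gtOp u := by
  rw [gtOp, map_smul]; rfl

theorem gtOp_one {n : ℕ} : gtOp (1 : U n) = 1 := by
  rw [gtOp, map_one]; rfl

/-- The operator of an element of `gl_n`. -/
noncomputable def glOp {n : ℕ} (x : Gl n) : R n := gtOp (UniversalEnvelopingAlgebra.ι ℂ x)

theorem glOp_add {n : ℕ} (x y : Gl n) : glOp (x + y) = glOp x + glOp y := by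
  rw [glOp, map_add, gtOp_add]; rfl

theorem glOp_smul {n : ℕ} (c : ℂ) (x : Gl n) : glOp (c • x) = c • glOp x := by
  rw [glOp, map_smul, gtOp_smul]; rfl

theorem glOp_zero {n : ℕ} : glOp (0 : Gl n) = 0 := by
  rw [glOp, map_zero, gtOp, map_zero]; rfl

theorem glOp_lie {n : ℕ} (x y : Gl n) : glOp ⁅x, y⁆ = glOp y * glOp x - glOp x * glOp y := by
  rw [glOp, LieHom.map_lie, LieRing.of_associative_ring_bracket, sub_eq_add_neg, gtOp_add,
    gtOp_mul, ← neg_one_smul ℂ, gtOp_smul, gtOp_mul, neg_one_smul, ← sub_eq_add_neg]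
  rfl

theorem glOp_e {n : ℕ} {i j : Fin n} (hij : i.val + 1 = j.val) :
    glOp (Matrix.single i j 1) = gtE n (i.val + 1) := by
  rw [glOp, gtOp, ((isGTHom_gtHom n).1 i j hij).1]; rfl

theorem glOp_f {n : ℕ} {i j : Fin n} (hij : i.val + 1 = j.val) :
    glOp (Matrix.single j i 1) = gtF n (i.val + 1) := by
  rw [glOp, gtOp, ((isGTHom_gtHom n).1 i j hij).2]; rfl

theorem glOp_h {n : ℕ} (i : Fin n) : glOp (Matrix.single i i 1) = gtH n (i.val + 1) := by
  rw [glOp, gtOp, (isGTHom_gtHom n).2 i]; rfl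

/-- The matrices whose operators lie in a given subalgebra. -/
noncomputable def glPreimage {n : ℕ} (S : Subalgebra ℂ (R n)) : LieSubalgebra ℂ (Gl n) where
  carrier := {x | glOp x ∈ S}
  zero_mem' := by change glOp 0 ∈ S; rw [glOp_zero]; exact zero_mem _
  add_mem' {x y} hx hy := by change glOp (x + y) ∈ S; rw [glOp_add]; exact add_mem hx hy
  smul_mem' c x hx := by change glOp (c • x) ∈ S; rw [glOp_smul]; exact S.smul_mem hx c
  lie_mem' {x y} hx hy := by
    change glOp ⁅x, y⁆ ∈ S
    rw [glOp_lie]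
    exact sub_mem (mul_mem hy hx) (mul_mem hx hy)

section poles

variable {n : ℕ} {a b : Idx n} {o : V n} (ho : IsOneSingular a b o)
include ho

/-- Every element of `gl_n` acts with at most simple poles along `z₁ = 0`. -/
theorem glOp_mem_poleOps (x : Gl n) : glOp x ∈ poleOps ho := by
  set G := glPreimage (regOps ho)
  let T : Submodule ℂ (Gl n) :=
    { carrier := {x | glOp x ∈ poleOps ho}
      zero_mem' := by change glOp 0 ∈ poleOps ho; rw [glOp_zero]; exact zero_mem _
      add_mem' := fun {x y} hx hy => by
        change glOp (x + y) ∈ poleOps ho; rw [glOp_add]; exact add_mem hx hy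
      smul_mem' := fun c x hx => by
        change glOp (c • x) ∈ poleOps ho; rw [glOp_smul]; exact Submodule.smul_mem _ c hx }
  have hGT : ∀ {x}, x ∈ G → x ∈ T := fun hx => regOps_le_poleOps ho hx
  -- Operators with simple poles are stable under multiplication by regular ones on either side.
  have hlie : ∀ {x y}, x ∈ G → y ∈ T → ⁅x, y⁆ ∈ T := fun {x y} hx hy => by
    change glOp ⁅x, y⁆ ∈ poleOps ho
    rw [glOp_lie]
    exact sub_mem (poleOps_mul_regOps ho hy hx) (regOps_mul_poleOps ho hx hy)
  have he : ∀ i j : Fin n, i.val + 1 = j.val → i ≠ a.1 →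
      Matrix.single i j 1 ∈ G ∧ Matrix.single j i 1 ∈ G := fun i j hij hi => by
    have hi' : i.val + 1 ≠ a.1.val + 1 := fun h => hi (Fin.ext (by omega))
    constructor
    · change glOp _ ∈ regOps ho
      rw [glOp_e hij, gtE_eq]
      exact neg_mem (gen_mem_regOps ho _ _ (by omega) hi')
    · change glOp _ ∈ regOps ho
      rw [glOp_f hij, gtF_eq]
      exact gen_mem_regOps ho _ _ (by omega) hi'
  have hT : ∀ i j : Fin n, i.val + 1 = j.val →
      Matrix.single i j 1 ∈ T ∧ Matrix.single j i 1 ∈ T := fun i j hij => by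
    constructor
    · change glOp _ ∈ poleOps ho
      rw [glOp_e hij, gtE_eq]
      exact neg_mem (gen_mem_poleOps ho _ _ _)
    · change glOp _ ∈ poleOps ho
      rw [glOp_f hij, gtF_eq]
      exact gen_mem_poleOps ho _ _ _
  -- Inside the diagonal blocks of indices `≤ a.1` and `> a.1` no singular generator is needed.
  have hblock : ∀ k l : Fin n, k < l → (l ≤ a.1 ∨ a.1 < k) →
      Matrix.single k l 1 ∈ G ∧ Matrix.single l k 1 ∈ G := fun k l hkl h => by
    have hne : ∀ i j : Fin n, k ≤ i → j ≤ l → i.val + 1 = j.val → i ≠ a.1 := by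
      rintro i j hi hj hij rfl
      simp only [Fin.le_def, Fin.lt_def] at *
      omega
    exact ⟨single_mem_of_lt G hkl fun i j hi hj hij => (he i j hij (hne i j hi hj hij)).1,
      single_mem_of_gt G hkl fun i j hi hj hij => (he i j hij (hne i j hi hj hij)).2⟩
  -- The units joining the blocks start from the singular generators, in positions `(a.1, a.1 + 1)`
  -- and `(a.1 + 1, a.1)`. Bracketing with the lower block extends one end, and `hupper` then
  -- extends the other with the upper block.
  have hcorner : ∀ l : Fin n, a.1 < l →
      Matrix.single a.1 l 1 ∈ T ∧ Matrix.single l a.1 1 ∈ T := fun l hl => by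
    rw [Fin.lt_def] at hl
    let m : Fin n := ⟨a.1 + 1, by omega⟩
    have hm := hT a.1 m rfl
    by_cases hlm : l = m
    · rw [hlm]; exact hm
    have hml : m < l := by
      rw [Fin.lt_def]; have : l.val ≠ m.val := fun h => hlm (Fin.ext h); simp only [m] at *; omega
    have hb := hblock m l hml (Or.inr (Fin.lt_def.2 (by simp [m])))
    have hal : a.1 ≠ l := fun h => by rw [h] at hl; omega
    constructor
    · have := hlie hb.1 hm.1
      rw [lie_single, if_neg hal.symm, if_pos rfl, zero_sub] at this
      exact (Submodule.neg_mem_iff _).1 this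
    · have := hlie hb.2 hm.2
      rwa [lie_single, if_pos rfl, if_neg hal, sub_zero] at this
  have hupper : ∀ k l : Fin n, k < l → Matrix.single k l 1 ∈ T ∧ Matrix.single l k 1 ∈ T :=
    fun k l hkl => by
    by_cases h : l ≤ a.1 ∨ a.1 < k
    · exact ⟨hGT (hblock k l hkl h).1, hGT (hblock k l hkl h).2⟩
    push Not at h
    have hc := hcorner l h.1
    rcases h.2.eq_or_lt with rfl | hk
    · exact hc
    have hb := hblock k a.1 hk (Or.inl le_rfl)
    constructor
    · have := hlie hb.1 hc.1
      rwa [lie_single, if_pos rfl, if_neg hkl.ne', sub_zero] at this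
    · have := hlie hb.2 hc.2
      rw [lie_single, if_neg hkl.ne, if_pos rfl, zero_sub] at this
      exact (Submodule.neg_mem_iff _).1 this
  refine mem_of_single_mem T (fun i j => ?_) x
  rcases lt_trichotomy i j with h | h | h
  · exact (hupper i j h).1
  · subst h
    refine hGT ?_
    change glOp _ ∈ regOps ho
    rw [glOp_h]
    exact gtH_mem_regOps ho _
  · exact (hupper j i h).2

end poles

/-! ### Invariance under the involution -/

section invariance

variable {n : ℕ} {a b : Idx n} (hab : a.1 = b.1)
include hab

theorem swap_mem_row {k : ℕ} {p : Idx n} : Equiv.swap a b p ∈ row n k ↔ p ∈ row n k := by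
  rw [mem_row, mem_row, fst_swap hab]

theorem tau_coef (k l : ℕ) (p : Idx n) :
    tau a b (coef (row n k) (row n l) p) = coef (row n k) (row n l) (Equiv.swap a b p) := by
  rw [coef, coef, map_div₀, map_prod, map_prod]
  congr 1
  · refine Finset.prod_equiv (Equiv.swap a b) (fun q => (swap_mem_row hab).symm) fun q _ => ?_
    rw [map_sub, tau_X, tau_X]
  · refine Finset.prod_equiv (Equiv.swap a b) (fun q => ?_) fun q _ => ?_
    · rw [Finset.mem_erase, Finset.mem_erase, swap_mem_row hab, (Equiv.injective _).ne_iff]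
    · rw [map_sub, tau_X, tau_X]

/-- The swap maps each row to itself, so the involution only permutes the summands. -/
theorem tauR_gen (ε : ℤ) {k : ℕ} (l : ℕ) (hk : k < n) :
    tauR hab (gen ε (row n k) (row n l)) = gen ε (row n k) (row n l) := by
  rw [gen, map_sum]
  refine Finset.sum_equiv (Equiv.swap a b) (fun q => (swap_mem_row hab).symm) fun p hp => ?_
  rw [tauR_single, tau_coef hab, conj_zpow hab, conj_δ hab (low_of_mem_row hk p hp)]

theorem tauR_gtH (k : ℕ) : tauR hab (gtH n k) = gtH n k := by
  have h : ∀ k, tau a b (∑ p ∈ row n k, (X p + (p.2.val : Mero n))) =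
      ∑ p ∈ row n k, (X p + (p.2.val : Mero n)) := fun k => by
    rw [map_sum]
    simp only [map_add, map_natCast, tau_X, Finset.sum_add_distrib]
    congr 1
    exact Finset.sum_equiv (Equiv.swap a b) (fun q => (swap_mem_row hab).symm) fun p _ => rfl
  rw [gtH, tauR_single, conj_one hab, map_sub, h, h]

theorem tauR_glOp (x : Gl n) : tauR hab (glOp x) = glOp x := by
  refine mem_of_generators_mem (glPreimage (AlgHom.equalizer (tauR hab) (AlgHom.id ℂ (R n))))
    (fun i j hij => ⟨?_, ?_⟩) (fun i => ?_) x
  · change tauR hab (glOp _) = glOp _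
    rw [glOp_e hij, gtE_eq, map_neg, tauR_gen hab _ _ (by omega)]
  · change tauR hab (glOp _) = glOp _
    rw [glOp_f hij, gtF_eq, tauR_gen hab _ _ (by omega)]
  · change tauR hab (glOp _) = glOp _
    rw [glOp_h, tauR_gtH]

end invariance

/-! ### Evaluations and their derivatives -/

section distributions

variable {n : ℕ} {a b : Idx n} {o : V n}

theorem dz_sum {ι : Type*} {s : Finset ι} {f : ι → Mero n} (h : ∀ i ∈ s, IsHol o (f i)) :
    IsHol o (∑ i ∈ s, f i) ∧ dz a b o (∑ i ∈ s, f i) = ∑ i ∈ s, dz a b o (f i) := by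
  classical
  induction s using Finset.induction_on with
  | empty => exact ⟨by simpa using isHol_zero o, by simp [dz_zero]⟩
  | insert i s hi ih =>
    have h1 := h i (Finset.mem_insert_self i s)
    have h2 := ih fun j hj => h j (Finset.mem_insert_of_mem hj)
    rw [Finset.sum_insert hi, Finset.sum_insert hi, dz_add a b h1 h2.1, h2.2]
    exact ⟨h1.add h2.1, rfl⟩

theorem isHol_smul_algebraMap (σ : Γ n) (F : Entire n) :
    IsHol o (σ • algebraMap (Entire n) (Mero n) F) := by
  rw [smul_algebraMap]; exact isHol_algebraMap o _

/-- The functional `F ↦ σ(F)(o)`. -/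
noncomputable def evAt (o : V n) (σ : Γ n) : Module.Dual ℂ (Entire n) where
  toFun F := val o (σ • algebraMap (Entire n) (Mero n) F)
  map_add' F G := by
    rw [map_add, smul_add, val_add (isHol_smul_algebraMap σ F) (isHol_smul_algebraMap σ G)]
  map_smul' c F := by
    rw [Algebra.smul_def, map_mul, ← IsScalarTower.algebraMap_apply, ← Algebra.smul_def, smul_comm,
      val_smul c (isHol_smul_algebraMap σ F)]
    rfl

/-- The functional `F ↦ ∂σ(F)/∂z₁ (o)`. -/
noncomputable def dzAt (a b : Idx n) (o : V n) (σ : Γ n) : Module.Dual ℂ (Entire n) where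
  toFun F := dz a b o (σ • algebraMap (Entire n) (Mero n) F)
  map_add' F G := by
    rw [map_add, smul_add, dz_add a b (isHol_smul_algebraMap σ F) (isHol_smul_algebraMap σ G)]
  map_smul' c F := by
    rw [Algebra.smul_def, map_mul, ← IsScalarTower.algebraMap_apply, ← Algebra.smul_def, smul_comm,
      dz_smul a b c (isHol_smul_algebraMap σ F)]
    rfl

theorem evAt_apply (σ : Γ n) (F : Entire n) :
    evAt o σ F = val o (σ • algebraMap (Entire n) (Mero n) F) := rfl

theorem dzAt_apply (σ : Γ n) (F : Entire n) :
    dzAt a b o σ F = dz a b o (σ • algebraMap (Entire n) (Mero n) F) := rfl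

theorem evAt_mul (σ : Γ n) (F G : Entire n) : evAt o σ (F * G) = evAt o σ F * evAt o σ G := by
  rw [evAt_apply, map_mul, smul_mul', val_mul (isHol_smul_algebraMap σ F)
    (isHol_smul_algebraMap σ G)]
  rfl

theorem dzAt_mul (σ : Γ n) (F G : Entire n) :
    dzAt a b o σ (F * G) = dzAt a b o σ F * evAt o σ G + evAt o σ F * dzAt a b o σ G := by
  rw [dzAt_apply, map_mul, smul_mul', dz_mul (isHol_smul_algebraMap σ F)
    (isHol_smul_algebraMap σ G)]
  rfl

theorem evAt_const (σ : Γ n) (c : ℂ) : evAt o σ (algebraMap ℂ (Entire n) c) = c := by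
  rw [evAt_apply, ← IsScalarTower.algebraMap_apply, _root_.smul_algebraMap, val_const]

theorem evAt_one (σ : Γ n) : evAt o σ 1 = 1 := by
  simpa using evAt_const (o := o) σ 1

theorem dzAt_const (σ : Γ n) (c : ℂ) : dzAt a b o σ (algebraMap ℂ (Entire n) c) = 0 := by
  have h1 : dzAt a b o σ 1 = 0 := by
    have := dzAt_mul (a := a) (b := b) (o := o) σ 1 1
    rw [mul_one, evAt_one, mul_one, one_mul] at this
    exact left_eq_add.1 this
  rw [Algebra.algebraMap_eq_smul_one, map_smul, h1, smul_zero]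

theorem evAt_coord (σ : Γ n) (p : Idx n) : evAt o σ (coord p) = o p - (vec σ p : ℂ) := by
  rw [evAt_apply, ← X, smul_X, ← map_intCast (algebraMap ℂ (Mero n)),
    val_sub (isHol_X p) (isHol_const _), val_X, val_const]

theorem dzAt_z (hne : a ≠ b) (σ : Γ n) : dzAt a b o σ (coord a - coord b) = 1 := by
  have e : σ • algebraMap (Entire n) (Mero n) (coord a - coord b) =
      z a b + algebraMap ℂ (Mero n) (-((vec σ a - vec σ b : ℤ) : ℂ)) := by
    rw [map_sub, ← X, ← X, ← z, smul_z, map_neg, map_intCast]; ring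
  have h0 : dz a b o (algebraMap ℂ (Mero n) (-((vec σ a - vec σ b : ℤ) : ℂ))) = 0 := by
    have := dzAt_const (a := a) (b := b) (o := o) (1 : Γ n) (-((vec σ a - vec σ b : ℤ) : ℂ))
    rwa [dzAt_apply, one_smul, ← IsScalarTower.algebraMap_apply] at this
  rw [dzAt_apply, e, dz_add a b (isHol_z a b o) (isHol_const _), dz_z hne, h0, add_zero]

/-- Evaluations and derivatives at the points of the orbit are linearly independent. -/
theorem eq_zero_of_sum_eq_zero (hne : a ≠ b) {S : Finset (Γ n)} {c d : Γ n → ℂ}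
    (h : ∑ σ ∈ S, (c σ • evAt o σ + d σ • dzAt a b o σ) = 0) {ρ : Γ n} (hρ : ρ ∈ S) :
    c ρ = 0 ∧ d ρ = 0 := by
  classical
  have hex : ∀ σ : Γ n, ∃ p, σ ≠ ρ → vec σ p ≠ vec ρ p := fun σ => by
    by_cases hσ : σ = ρ
    · exact ⟨a, fun h => absurd hσ h⟩
    · by_contra hcon
      push Not at hcon
      exact hσ (Γ_ext fun p => (hcon p).2)
  choose p hp using hex
  -- For each `σ ≠ ρ`, `p σ` is a position where the two shifts differ, so `P` vanishes at the point
  -- of `σ` but not at that of `ρ`.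
  set P : Entire n := ∏ σ ∈ S.erase ρ,
    (coord (p σ) - algebraMap ℂ (Entire n) (o (p σ) - (vec σ (p σ) : ℂ)))
  have evP : ∀ κ, evAt o κ P = ∏ σ ∈ S.erase ρ,
      (((vec σ (p σ) : ℤ) : ℂ) - (vec κ (p σ) : ℂ)) := fun κ => by
    let f : Entire n →* ℂ := ⟨⟨evAt o κ, evAt_one κ⟩, evAt_mul κ⟩
    change f P = _
    rw [map_prod]
    refine Finset.prod_congr rfl fun σ _ => ?_
    change evAt o κ _ = _
    rw [map_sub, evAt_coord, evAt_const]; ring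
  have evP0 : ∀ κ ∈ S, κ ≠ ρ → evAt o κ P = 0 := fun κ hκ hne => by
    rw [evP]; exact Finset.prod_eq_zero (Finset.mem_erase.2 ⟨hne, hκ⟩) (sub_self _)
  have evP1 : evAt o ρ P ≠ 0 := by
    rw [evP]
    refine Finset.prod_ne_zero_iff.2 fun σ hσ => sub_ne_zero.2 ?_
    exact_mod_cast hp σ (Finset.ne_of_mem_erase hσ)
  -- Testing on `P * P * Q` kills values and first derivatives at all points other than that of `ρ`.
  have key : ∀ Q : Entire n, c ρ * (evAt o ρ P * evAt o ρ P * evAt o ρ Q) +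
      d ρ * ((dzAt a b o ρ P * evAt o ρ P + evAt o ρ P * dzAt a b o ρ P) * evAt o ρ Q +
        evAt o ρ P * evAt o ρ P * dzAt a b o ρ Q) = 0 := fun Q => by
    have h1 := LinearMap.congr_fun h (P * P * Q)
    rw [LinearMap.sum_apply, Finset.sum_eq_single ρ] at h1
    · simpa only [LinearMap.add_apply, LinearMap.smul_apply, smul_eq_mul, evAt_mul, dzAt_mul,
        LinearMap.zero_apply] using h1
    · intro κ hκ hne
      simp only [LinearMap.add_apply, LinearMap.smul_apply, smul_eq_mul, evAt_mul, dzAt_mul,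
        evP0 κ hκ hne]
      ring
    · exact fun h => absurd hρ h
  have hd : d ρ = 0 := by
    -- This `Q` vanishes at the point of `ρ` with derivative `1`, which isolates `d ρ`.
    have h1 := key (coord a - coord b -
      algebraMap ℂ (Entire n) (evAt o ρ (coord a - coord b)))
    rw [map_sub (evAt o ρ), evAt_const, sub_self, map_sub (dzAt a b o ρ), dzAt_const, dzAt_z hne]
      at h1
    simpa [evP1] using h1
  refine ⟨?_, hd⟩
  have h1 := key 1
  rw [hd, evAt_one] at h1
  simpa [evP1] using h1

/-! ### The functionals `𝓛 ∘ A` -/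

/-- By Leibniz, `𝓛 ∘ A` depends only on the values and `z₁`-derivatives at `o` of the functions `z₁
A_s`. -/
theorem Ldist_eq_sum {A : R n} (hA : A ∈ Adm a b o) :
    Ldist a b o ⟨A, hA⟩ = ∑ s ∈ A.support,
      (dz a b o (z a b * A.coeff s) • evAt o s + val o (z a b * A.coeff s) • dzAt a b o s) := by
  ext F
  change dz a b o (z a b * act A (algebraMap (Entire n) (Mero n) F)) = _
  have e : z a b * act A (algebraMap (Entire n) (Mero n) F) =
      ∑ s ∈ A.support, z a b * A.coeff s * s • algebraMap (Entire n) (Mero n) F := by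
    rw [act, Finsupp.sum, Finset.mul_sum]
    exact Finset.sum_congr rfl fun s _ => (mul_assoc _ _ _).symm
  rw [e, (dz_sum fun s _ => (hA s).mul (isHol_smul_algebraMap s F)).2, LinearMap.sum_apply]
  refine Finset.sum_congr rfl fun s _ => ?_
  rw [dz_mul (hA s) (isHol_smul_algebraMap s F)]
  rfl

theorem Ldist_single {σ : Γ n} {h : Mero n} (H : IsHol o (z a b * h)) :
    Ldist a b o ⟨SkewMonoidAlgebra.single σ h, single_mem_Adm σ H⟩ =
      dz a b o (z a b * h) • evAt o σ + val o (z a b * h) • dzAt a b o σ := by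
  classical
  rw [Ldist_eq_sum, Finset.sum_subset SkewMonoidAlgebra.support_single_subset,
    Finset.sum_singleton, SkewMonoidAlgebra.coeff_single_apply, if_pos rfl]
  intro s _ hs
  rw [SkewMonoidAlgebra.notMem_support_iff.1 hs, mul_zero, dz_zero, val_zero, zero_smul, zero_smul,
    add_zero]

/-- At `o` the function `z₁` has value `0` and derivative `1`, so only values of `F` survive; for
`D₂` the corresponding function is the constant `1`, which leaves only derivatives. -/
theorem D₁_eq (ho : IsOneSingular a b o) (σ : Γ n) :
    D₁ a b o σ = evAt o σ + evAt o (conj a b σ) := by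
  have H : IsHol o (z a b * 1) := by simpa using isHol_z a b o
  have e : (⟨op₁ a b σ, op₁_mem a b o σ⟩ : Adm a b o) =
      ⟨_, single_mem_Adm σ H⟩ + ⟨_, single_mem_Adm (conj a b σ) H⟩ := rfl
  rw [D₁, e, map_add, Ldist_single H, Ldist_single H, mul_one, dz_z ho.2.1, val_z ho.2.2.1]
  simp

theorem dz_one : dz a b o (1 : Mero n) = 0 := by
  have := dzAt_const (a := a) (b := b) (o := o) (1 : Γ n) 1
  rwa [dzAt_apply, one_smul, map_one, map_one] at this

theorem D₂_eq (ho : IsOneSingular a b o) (σ : Γ n) :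
    D₂ a b o σ = dzAt a b o σ - dzAt a b o (conj a b σ) := by
  have hz : z a b * (z a b)⁻¹ = (1 : Mero n) := mul_inv_cancel₀ (z_ne_zero ho.2.1)
  have H : IsHol o (z a b * (z a b)⁻¹ : Mero n) := by rw [hz]; exact isHol_one
  have e : (⟨op₂ a b σ, op₂_mem a b o σ⟩ : Adm a b o) =
      ⟨_, single_mem_Adm σ H⟩ + (-1 : ℂ) • ⟨_, single_mem_Adm (conj a b σ) H⟩ := Subtype.ext (by
    change SkewMonoidAlgebra.single σ (z a b)⁻¹ - SkewMonoidAlgebra.single (conj a b σ) (z a b)⁻¹ =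
      SkewMonoidAlgebra.single σ (z a b)⁻¹ +
        (-1 : ℂ) • SkewMonoidAlgebra.single (conj a b σ) (z a b)⁻¹
    rw [neg_one_smul, sub_eq_add_neg])
  rw [D₂, e, map_add, map_smul, Ldist_single H, Ldist_single H, hz, dz_one, val_one]
  simp [sub_eq_add_neg]

section relations

variable (ho : IsOneSingular a b o)
include ho

theorem D₁_conj (σ : Γ n) : D₁ a b o (conj a b σ) = D₁ a b o σ := by
  rw [D₁_eq ho, D₁_eq ho, conj_conj ho.1, add_comm]

theorem D₂_conj (σ : Γ n) : D₂ a b o (conj a b σ) = -D₂ a b o σ := by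
  rw [D₂_eq ho, D₂_eq ho, conj_conj ho.1, neg_sub]

theorem relations_le_ker : relations a b ≤ LinearMap.ker (symbolMap a b o) := by
  refine Submodule.span_le.2 ?_
  rintro _ (⟨σ, rfl⟩ | ⟨σ, rfl⟩)
  · refine LinearMap.mem_ker.2 (Subtype.ext ?_)
    simp [symbolMap, v₁, D₁_conj ho]
  · refine LinearMap.mem_ker.2 (Subtype.ext ?_)
    simp [symbolMap, v₂, D₂_conj ho]

/-- All relations among the functionals follow from the symmetry and antisymmetry relations. -/
theorem ker_symbolMap : LinearMap.ker (symbolMap a b o) = relations a b := by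
  classical
  refine le_antisymm (fun l hl => ?_) (relations_le_ker ho)
  -- `T` is the involution of symbols that the relations identify with the identity. Its
  -- symmetrisation `m = l + T l` is congruent to `2 l` modulo the relations, so it suffices to show
  -- `m = 0`.
  let T : ((Γ n ⊕ Γ n) →₀ ℂ) →ₗ[ℂ] ((Γ n ⊕ Γ n) →₀ ℂ) := Finsupp.linearCombination ℂ
    (Sum.elim (fun σ => Finsupp.single (Sum.inl (conj a b σ)) 1)
      (fun σ => -Finsupp.single (Sum.inr (conj a b σ)) 1))
  have hT : ∀ l, T l - l ∈ relations a b := fun l => by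
    induction l using Finsupp.induction_linear with
    | zero => simp
    | add f g hf hg =>
      rw [map_add, add_sub_add_comm]; exact add_mem hf hg
    | single s c =>
      have e : (Finsupp.single s c : (Γ n ⊕ Γ n) →₀ ℂ) = c • Finsupp.single s 1 := by simp
      rw [e, map_smul, ← smul_sub]
      refine Submodule.smul_mem _ _ ?_
      rcases s with σ | σ
      · refine Submodule.subset_span (Or.inl ⟨σ, ?_⟩)
        simp [T]
      · rw [← Submodule.neg_mem_iff]
        refine Submodule.subset_span (Or.inr ⟨σ, ?_⟩)
        simp [T, add_comm]
  have hTl : ∀ l σ, (T l) (Sum.inl σ) = l (Sum.inl (conj a b σ)) ∧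
      (T l) (Sum.inr σ) = -l (Sum.inr (conj a b σ)) := fun l σ => by
    have hc : ∀ ρ, conj a b ρ = σ ↔ ρ = conj a b σ := fun ρ =>
      ⟨fun h => by rw [← h, conj_conj ho.1], fun h => by rw [h, conj_conj ho.1]⟩
    induction l using Finsupp.induction_linear with
    | zero => simp
    | add f g hf hg => simp [hf.1, hf.2, hg.1, hg.2, add_comm]
    | single s c =>
      rcases s with ρ | ρ <;> simp [T, Finsupp.single_apply, hc]
  set m := l + T l with hm
  have hm1 : ∀ σ, m (Sum.inl (conj a b σ)) = m (Sum.inl σ) := fun σ => by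
    simp [hm, (hTl _ _).1, conj_conj ho.1, add_comm]
  have hm2 : ∀ σ, m (Sum.inr (conj a b σ)) = -m (Sum.inr σ) := fun σ => by
    simp [hm, (hTl _ _).2, conj_conj ho.1]
  have hTker : T l ∈ LinearMap.ker (symbolMap a b o) := by
    have := add_mem (relations_le_ker ho (hT l)) hl
    simpa using this
  have hmker : m ∈ LinearMap.ker (symbolMap a b o) := add_mem hl hTker
  have hm0 : m = 0 := by
    set S : Finset (Γ n) := (m.support.preimage Sum.inl Sum.inl_injective.injOn) ∪
      (m.support.preimage Sum.inr Sum.inr_injective.injOn) with hS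
    have hSc : ∀ σ ∈ S, conj a b σ ∈ S := fun σ hσ => by
      simp only [hS, Finset.mem_union, Finset.mem_preimage, Finsupp.mem_support_iff, hm1, hm2,
        neg_ne_zero] at hσ ⊢
      exact hσ
    have hconj : ∀ f : Γ n → Module.Dual ℂ (Entire n),
        ∑ σ ∈ S, f (conj a b σ) = ∑ σ ∈ S, f σ := fun f =>
      Finset.sum_bij' (fun σ _ => conj a b σ) (fun σ _ => conj a b σ) hSc hSc
        (fun σ _ => conj_conj ho.1 σ) (fun σ _ => conj_conj ho.1 σ) (fun σ _ => rfl)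
    have e1 : ((symbolMap a b o m : spanD a b o) : Module.Dual ℂ (Entire n)) =
        ∑ σ ∈ S, (m (Sum.inl σ) • D₁ a b o σ + m (Sum.inr σ) • D₂ a b o σ) := by
      have hsub : m.support ⊆ S.disjSum S := fun s hs => by
        rcases s with σ | σ
        · rw [Finset.inl_mem_disjSum]
          exact Finset.mem_union_left _ (Finset.mem_preimage.2 hs)
        · rw [Finset.inr_mem_disjSum]
          exact Finset.mem_union_right _ (Finset.mem_preimage.2 hs)
      rw [symbolMap, Finsupp.linearCombination_apply,
        Finsupp.sum_of_support_subset m hsub _ (by simp), Finset.sum_disjSum,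
        ← Finset.sum_add_distrib, Submodule.coe_sum]
      rfl
    -- By the symmetry of `m`, the terms at `σ` and at its conjugate contribute equally, giving
    -- twice this sum.
    have e2 : ∑ σ ∈ S, (m (Sum.inl σ) • evAt o σ + m (Sum.inr σ) • dzAt a b o σ) = 0 := by
      rw [LinearMap.mem_ker.1 hmker] at e1
      simp only [D₁_eq ho, D₂_eq ho, smul_add, smul_sub] at e1
      rw [Finset.sum_add_distrib, Finset.sum_add_distrib, Finset.sum_sub_distrib] at e1
      have e3 : ∑ σ ∈ S, m (Sum.inl σ) • evAt o (conj a b σ) =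
          ∑ σ ∈ S, m (Sum.inl σ) • evAt o σ := by
        rw [← hconj]
        exact Finset.sum_congr rfl fun σ _ => by rw [hm1, conj_conj ho.1]
      have e4 : ∑ σ ∈ S, m (Sum.inr σ) • dzAt a b o (conj a b σ) =
          -∑ σ ∈ S, m (Sum.inr σ) • dzAt a b o σ := by
        rw [← hconj (fun σ => m (Sum.inr σ) • dzAt a b o σ), ← Finset.sum_neg_distrib]
        exact Finset.sum_congr rfl fun σ _ => by rw [hm2, neg_smul, neg_neg]
      rw [e3, e4, sub_neg_eq_add] at e1
      rw [Finset.sum_add_distrib]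
      have e5 : (2 : ℂ) • (∑ σ ∈ S, m (Sum.inl σ) • evAt o σ +
          ∑ σ ∈ S, m (Sum.inr σ) • dzAt a b o σ) = 0 := by
        rw [two_smul, add_add_add_comm]; exact e1.symm
      exact (smul_eq_zero.1 e5).resolve_left two_ne_zero
    have h0 : ∀ σ, m (Sum.inl σ) = 0 ∧ m (Sum.inr σ) = 0 := fun σ => by
      by_cases hσ : σ ∈ S
      · exact eq_zero_of_sum_eq_zero (c := fun σ => m (Sum.inl σ)) (d := fun σ => m (Sum.inr σ))
          ho.2.1 e2 hσ
      · simpa [hS, Finset.mem_union, Finset.mem_preimage, not_or] using hσ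
    ext (σ | σ)
    · exact (h0 σ).1
    · exact (h0 σ).2
  have e6 : (2 : ℂ) • l = m - (T l - l) := by rw [hm, two_smul]; abel
  have e7 : l = (1 / 2 : ℂ) • (m - (T l - l)) := by rw [← e6, smul_smul]; norm_num
  rw [e7, hm0, zero_sub]
  exact Submodule.smul_mem _ _ (neg_mem (hT l))

end relations

end distributions

/-! ### Expansions -/

section expansion

variable {n : ℕ} {a b : Idx n} {o : V n} (ho : IsOneSingular a b o)
include ho

/-- Since `τ(z₁) = -z₁`, this is `-τ(z₁ h)`: the value changes sign, whereas in `dz_mul_tau` the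
sign cancels against that of the reversed derivative. -/
theorem val_mul_tau {h : Mero n} (H : IsHol o (z a b * h)) :
    val o (z a b * tau a b h) = -val o (z a b * h) := by
  rw [show z a b * tau a b h = -tau a b (z a b * h) by rw [map_mul, tau_z]; ring,
    val_neg (H.tau ho.2.2.1), val_tau ho.2.2.1 H]

theorem dz_mul_tau {h : Mero n} (H : IsHol o (z a b * h)) :
    dz a b o (z a b * tau a b h) = dz a b o (z a b * h) := by
  rw [show z a b * tau a b h = -tau a b (z a b * h) by rw [map_mul, tau_z]; ring,
    dz_neg (H.tau ho.2.2.1), dz_tau ho.2.2.1 H, neg_neg]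

theorem tauR_mem_Adm {A : R n} (hA : A ∈ Adm a b o) : tauR ho.1 A ∈ Adm a b o := fun s => by
  rw [coeff_tauR, show z a b * tau a b (A.coeff (conj a b s)) =
    -tau a b (z a b * A.coeff (conj a b s)) by rw [map_mul, tau_z]; ring]
  exact ((hA _).tau ho.2.2.1).neg

theorem coe_expansion (f : Mero n) (A : R n) :
    (expansion a b o f A : Module.Dual ℂ (Entire n)) = ∑ s ∈ A.support,
      (val o (f * A.coeff s) • (dzAt a b o s - dzAt a b o (conj a b s)) +
        dz a b o (f * A.coeff s) • (evAt o s + evAt o (conj a b s))) := by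
  rw [expansion, Submodule.coe_sum]
  refine Finset.sum_congr rfl fun s _ => ?_
  rw [← D₁_eq ho, ← D₂_eq ho]
  rfl

/-- The term of `τ(A)` at the conjugate of `s` has the same derivative and the opposite value as
that of `A` at `s`. The pairs thus combine to exactly `D₁` and `D₂`. -/
theorem Ldist_add_tauR {A : R n} (hA : A ∈ Adm a b o) :
    Ldist a b o ⟨A + tauR ho.1 A, add_mem hA (tauR_mem_Adm ho hA)⟩ =
      expansion a b o (z a b) A := by
  have e : (⟨A + tauR ho.1 A, add_mem hA (tauR_mem_Adm ho hA)⟩ : Adm a b o) =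
    ⟨A, hA⟩ + ⟨_, tauR_mem_Adm ho hA⟩ := rfl
  have e2 : Ldist a b o ⟨_, tauR_mem_Adm ho hA⟩ = ∑ s ∈ A.support,
      (dz a b o (z a b * A.coeff s) • evAt o (conj a b s) -
        val o (z a b * A.coeff s) • dzAt a b o (conj a b s)) := by
    rw [Ldist_eq_sum]
    have hmem : ∀ s, conj a b s ∈ A.support ↔ s ∈ (tauR ho.1 A).support := fun s => by
      rw [SkewMonoidAlgebra.mem_support_iff, SkewMonoidAlgebra.mem_support_iff, coeff_tauR]
      exact (map_ne_zero_iff (tau a b) (tau a b).injective).symm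
    refine Finset.sum_bij' (fun s _ => conj a b s) (fun s _ => conj a b s)
      (fun s hs => (hmem s).2 hs) (fun s hs => (hmem _).1 (by rwa [conj_conj ho.1]))
      (fun s _ => conj_conj ho.1 s) (fun s _ => conj_conj ho.1 s) fun s _ => ?_
    rw [coeff_tauR, val_mul_tau ho (hA _), dz_mul_tau ho (hA _), conj_conj ho.1, neg_smul,
      sub_eq_add_neg]
  rw [e, map_add, e2, Ldist_eq_sum, coe_expansion ho, ← Finset.sum_add_distrib]
  refine Finset.sum_congr rfl fun s _ => ?_
  rw [smul_add, smul_sub]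
  abel

/-- The invariant operators whose coefficients have at most a simple pole at `o`. -/
noncomputable def invOps : Submodule ℂ (R n) where
  carrier := {A | tauR ho.1 A = A ∧ ∀ s, z a b * A.coeff s ∈ reg ho}
  zero_mem' := ⟨map_zero _, fun s => by simp⟩
  add_mem' {A B} hA hB := ⟨by rw [map_add, hA.1, hB.1], fun s => by
    rw [SkewMonoidAlgebra.coeff_add, Finsupp.add_apply, mul_add]
    exact add_mem (hA.2 s) (hB.2 s)⟩
  smul_mem' c A hA := ⟨by rw [map_smul, hA.1], fun s => by
    rw [SkewMonoidAlgebra.coeff_smul, Finsupp.smul_apply, mul_smul_comm]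
    exact Subalgebra.smul_mem _ (hA.2 s) c⟩

theorem invOps_le_Adm : invOps ho ≤ Adm a b o := fun _ hA s => (hA.2 s).1

/-- For invariant `A` the sum `A + τ(A)` is `2A`; hence the factor `1/2` of the explicit formula. -/
theorem Ldist_of_mem_invOps {A : R n} (hA : A ∈ invOps ho) :
    Ldist a b o ⟨A, invOps_le_Adm ho hA⟩ =
      (((1 / 2 : ℂ) • expansion a b o (z a b) A : spanD a b o) : Module.Dual ℂ (Entire n)) := by
  have hA' := invOps_le_Adm ho hA
  have h := Ldist_add_tauR ho hA'
  have e : (⟨A + tauR ho.1 A, add_mem hA' (tauR_mem_Adm ho hA')⟩ : Adm a b o) =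
      (2 : ℂ) • ⟨A, hA'⟩ := Subtype.ext (by
    change A + tauR ho.1 A = (2 : ℂ) • A
    rw [hA.1, two_smul])
  rw [e, map_smul] at h
  rw [Submodule.coe_smul, ← h, smul_smul]
  norm_num

theorem op₁_eq (σ : Γ n) : op₁ a b σ =
    SkewMonoidAlgebra.single σ 1 + tauR ho.1 (SkewMonoidAlgebra.single σ 1) := by
  rw [tauR_single, map_one]; rfl

theorem op₂_eq (σ : Γ n) : op₂ a b σ = SkewMonoidAlgebra.single σ (z a b)⁻¹ +
    tauR ho.1 (SkewMonoidAlgebra.single σ (z a b)⁻¹) := by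
  rw [tauR_single, map_inv₀, tau_z, inv_neg, SkewMonoidAlgebra.single_neg, ← sub_eq_add_neg]; rfl

theorem tauR_tauR (A : R n) : tauR ho.1 (tauR ho.1 A) = A :=
  SkewMonoidAlgebra.ext fun s => by rw [coeff_tauR, coeff_tauR, tau_tau, conj_conj ho.1]

theorem add_tauR_mem_invOps {A : R n} (hA : ∀ s, z a b * A.coeff s ∈ reg ho) :
    A + tauR ho.1 A ∈ invOps ho := by
  refine ⟨by rw [map_add, tauR_tauR ho, add_comm], fun s => ?_⟩
  rw [SkewMonoidAlgebra.coeff_add, Finsupp.add_apply, mul_add, coeff_tauR,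
    show z a b * tau a b (A.coeff (conj a b s)) =
    -tau a b (z a b * A.coeff (conj a b s)) by rw [map_mul, tau_z]; ring]
  exact add_mem (hA s) (neg_mem (tau_mem_reg ho (hA _)))

theorem z_mul_coeff_single_mem {σ : Γ n} {h : Mero n} (hh : z a b * h ∈ reg ho) (s : Γ n) :
    z a b * (SkewMonoidAlgebra.single σ h : R n).coeff s ∈ reg ho := by
  classical
  rw [SkewMonoidAlgebra.coeff_single_apply]
  split_ifs
  · exact hh
  · rw [mul_zero]; exact zero_mem _

theorem op₁_mem_invOps (σ : Γ n) : op₁ a b σ ∈ invOps ho := by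
  rw [op₁_eq ho]
  exact add_tauR_mem_invOps ho (z_mul_coeff_single_mem ho (by rw [mul_one]; exact z_mem_reg ho))

theorem op₂_mem_invOps (σ : Γ n) : op₂ a b σ ∈ invOps ho := by
  rw [op₂_eq ho]
  refine add_tauR_mem_invOps ho (z_mul_coeff_single_mem ho ?_)
  rw [mul_inv_cancel₀ (z_ne_zero ho.2.1)]
  exact one_mem _

/-- The map `A ↦ 𝓛 ∘ A` from the invariant operators to the span. -/
noncomputable def toSpan : invOps ho →ₗ[ℂ] spanD a b o :=
  ((Ldist a b o).comp (Submodule.inclusion (invOps_le_Adm ho))).codRestrict (spanD a b o)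
    fun A => by
      change Ldist a b o ⟨A.1, _⟩ ∈ _
      rw [Ldist_of_mem_invOps ho A.2]
      exact Subtype.coe_prop _

theorem coe_toSpan (A : invOps ho) :
    (toSpan ho A : Module.Dual ℂ (Entire n)) = Ldist a b o ⟨A.1, invOps_le_Adm ho A.2⟩ := rfl

theorem toSpan_eq (A : invOps ho) :
    toSpan ho A = (1 / 2 : ℂ) • expansion a b o (z a b) A.1 :=
  Subtype.ext (Ldist_of_mem_invOps ho A.2)

theorem toSpan_op₁ (σ : Γ n) : toSpan ho ⟨op₁ a b σ, op₁_mem_invOps ho σ⟩ = v₁ a b o σ := rfl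

theorem toSpan_op₂ (σ : Γ n) : toSpan ho ⟨op₂ a b σ, op₂_mem_invOps ho σ⟩ = v₂ a b o σ := rfl

theorem range_toSpan : LinearMap.range (toSpan ho) = ⊤ := by
  have h : spanD a b o ≤ (LinearMap.range (toSpan ho)).map (spanD a b o).subtype := by
    refine Submodule.span_le.2 ?_
    rintro _ (⟨σ, rfl⟩ | ⟨σ, rfl⟩)
    · exact ⟨v₁ a b o σ, ⟨_, toSpan_op₁ ho σ⟩, rfl⟩
    · exact ⟨v₂ a b o σ, ⟨_, toSpan_op₂ ho σ⟩, rfl⟩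
  refine eq_top_iff.2 fun m _ => ?_
  obtain ⟨m', hm', e⟩ := h m.2
  rwa [← (Subtype.ext e : m' = m)]

end expansion

/-! ### Right multiplication by the Gelfand–Tsetlin operators -/

/-- Functions holomorphic at `o` whose value and derivative vanish there. -/
def IsFlat {n : ℕ} (a b : Idx n) (o : V n) (h : Mero n) : Prop :=
  IsHol o h ∧ val o h = 0 ∧ dz a b o h = 0

section flat

variable {n : ℕ} {a b : Idx n} {o : V n}

theorem isFlat_zero : IsFlat a b o (0 : Mero n) := ⟨isHol_zero o, val_zero, dz_zero⟩

theorem IsFlat.add {h g : Mero n} (hh : IsFlat a b o h) (hg : IsFlat a b o g) :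
    IsFlat a b o (h + g) :=
  ⟨hh.1.add hg.1, by rw [val_add hh.1 hg.1, hh.2.1, hg.2.1, add_zero],
    by rw [dz_add a b hh.1 hg.1, hh.2.2, hg.2.2, add_zero]⟩

theorem IsFlat.mul {h g : Mero n} (hh : IsFlat a b o h) (hg : IsHol o g) :
    IsFlat a b o (h * g) :=
  ⟨hh.1.mul hg, by rw [val_mul hh.1 hg, hh.2.1, zero_mul],
    by rw [dz_mul hh.1 hg, hh.2.1, hh.2.2, zero_mul, zero_mul, add_zero]⟩

theorem IsFlat.smul {h : Mero n} (c : ℂ) (hh : IsFlat a b o h) : IsFlat a b o (c • h) :=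
  ⟨hh.1.smul c, by rw [val_smul c hh.1, hh.2.1, mul_zero],
    by rw [dz_smul a b c hh.1, hh.2.2, mul_zero]⟩

variable (ho : IsOneSingular a b o)
include ho

/-- Independence of values and derivatives turns the kernel into a condition on each coefficient
separately. -/
theorem toSpan_eq_zero_iff (A : invOps ho) :
    toSpan ho A = 0 ↔ ∀ s, IsFlat a b o (z a b * A.1.coeff s) := by
  have e : toSpan ho A = 0 ↔ (toSpan ho A : Module.Dual ℂ (Entire n)) = 0 :=
    ZeroMemClass.coe_eq_zero.symm
  rw [e, coe_toSpan, Ldist_eq_sum]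
  constructor
  · intro h s
    by_cases hs : s ∈ A.1.support
    · have := eq_zero_of_sum_eq_zero (c := fun s => dz a b o (z a b * A.1.coeff s))
        (d := fun s => val o (z a b * A.1.coeff s)) ho.2.1 h hs
      exact ⟨(A.2.2 s).1, this.2, this.1⟩
    · rw [SkewMonoidAlgebra.notMem_support_iff.1 hs, mul_zero]; exact isFlat_zero
  · intro h
    refine Finset.sum_eq_zero fun s _ => ?_
    rw [(h s).2.1, (h s).2.2, zero_smul, zero_smul, add_zero]

/-- Here `conj a b σ = σ`, so the coefficient `h` is `τ`-invariant and `z₁ h` is odd. The divided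
difference of `z₁ h` is then `2 h`, hence `h` has no pole. -/
theorem coeff_mem_reg {A : R n} (hA : A ∈ invOps ho) {σ : Γ n} (hσ : vec σ a = vec σ b) :
    A.coeff σ ∈ reg ho ∧ tau a b (A.coeff σ) = A.coeff σ := by
  have hτ : tau a b (A.coeff σ) = A.coeff σ := by
    conv_rhs => rw [← hA.1, coeff_tauR, (conj_eq_self_iff ho.1 σ).2 hσ]
  refine ⟨mem_reg_of_tau_eq ho ?_ hτ, hτ⟩
  have h := (hA.2 σ).2
  have e : (z a b)⁻¹ * (z a b * A.coeff σ - tau a b (z a b * A.coeff σ)) =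
      (2 : ℂ) • A.coeff σ := by
    rw [map_mul, hτ, tau_z, neg_mul, sub_neg_eq_add, ← mul_add,
      inv_mul_cancel_left₀ (z_ne_zero ho.2.1), two_smul]
  rw [e] at h
  simpa [smul_smul] using h.smul (1 / 2)

theorem inv_smul_z_mem_reg {σ : Γ n} (hσ : vec σ a ≠ vec σ b) : (σ • z a b)⁻¹ ∈ reg ho := by
  refine inv_mem_reg ho (z_mem_orbReg ho σ) ?_
  rw [val_smul_z ho, neg_ne_zero]
  exact_mod_cast sub_ne_zero.2 hσ

/-- The shift turns a pole along `z₁ = 0` into one along `σ(z₁) = 0`, a hyperplane that misses `o`.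
-/
theorem smul_mem_reg_of_ne {σ : Γ n} {h : Mero n} (hh : z a b * h ∈ orbReg ho)
    (hσ : vec σ a ≠ vec σ b) : σ • h ∈ reg ho := by
  have hz : σ • z a b ≠ 0 := fun e => z_ne_zero ho.2.1 ((smul_eq_zero_iff_eq σ).1 e)
  have e : σ • h = (σ • z a b)⁻¹ * σ • (z a b * h) := by
    rw [smul_mul', inv_mul_cancel_left₀ hz]
  rw [e]
  exact mul_mem (inv_smul_z_mem_reg ho hσ) (hh σ)

/-- In each product at most one factor has a pole at `o`: that of `B` if `σ` fixes `z₁`, and that of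
`A` otherwise. -/
theorem mul_mem_invOps {A B : R n} (hA : A ∈ invOps ho) (hB : B ∈ poleOps ho)
    (hτ : tauR ho.1 B = B) : A * B ∈ invOps ho := by
  refine ⟨by rw [map_mul, hA.1, hτ], fun s => ?_⟩
  rw [SkewMonoidAlgebra.coeff_mul_left, SkewMonoidAlgebra.sum_def', Finset.mul_sum]
  refine sum_mem fun σ _ => ?_
  by_cases hσ : vec σ a = vec σ b
  · have e : z a b * (A.coeff σ * σ • B.coeff (σ⁻¹ * s)) =
        A.coeff σ * σ • (z a b * B.coeff (σ⁻¹ * s)) := by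
      rw [smul_mul', smul_z_of_eq hσ]; ring
    rw [e]
    exact mul_mem (coeff_mem_reg ho hA hσ).1 (hB _ σ)
  · rw [← mul_assoc]
    exact mul_mem (hA.2 σ) (smul_mem_reg_of_ne ho (hB _) hσ)

theorem isFlat_mul {A B : R n} (hA : A ∈ invOps ho) (hB : B ∈ poleOps ho)
    (hflat : ∀ s, IsFlat a b o (z a b * A.coeff s)) (s : Γ n) :
    IsFlat a b o (z a b * (A * B).coeff s) := by
  rw [SkewMonoidAlgebra.coeff_mul_left, SkewMonoidAlgebra.sum_def', Finset.mul_sum]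
  refine Finset.sum_induction _ (IsFlat a b o) (fun _ _ => IsFlat.add) isFlat_zero fun σ _ => ?_
  by_cases hσ : vec σ a = vec σ b
  · have e : z a b * (A.coeff σ * σ • B.coeff (σ⁻¹ * s)) =
        A.coeff σ * σ • (z a b * B.coeff (σ⁻¹ * s)) := by
      rw [smul_mul', smul_z_of_eq hσ]; ring
    rw [e]
    obtain ⟨hreg, hτ⟩ := coeff_mem_reg ho hA hσ
    refine IsFlat.mul ⟨hreg.1, ?_, ?_⟩ (hB _ σ).1
    -- The coefficient itself is flat: its value is the derivative of `z₁` times it, and its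
    -- derivative vanishes because it is `τ`-invariant.
    · have h := (hflat σ).2.2
      rwa [dz_mul (isHol_z a b o) hreg.1, dz_z ho.2.1, val_z ho.2.2.1, one_mul, zero_mul,
        add_zero] at h
    · have h := dz_tau ho.2.2.1 hreg.1
      rw [hτ] at h
      exact self_eq_neg.1 h
  · rw [← mul_assoc]
    exact (hflat σ).mul (smul_mem_reg_of_ne ho (hB _) hσ).1

/-- Operators by which right multiplication preserves the invariant operators and the kernel of
the map to the span. -/
noncomputable def stableOps : Subalgebra ℂ (R n) where
  carrier := {B | (∀ A ∈ invOps ho, A * B ∈ invOps ho) ∧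
    ∀ A ∈ invOps ho, (∀ s, IsFlat a b o (z a b * A.coeff s)) →
      ∀ s, IsFlat a b o (z a b * (A * B).coeff s)}
  mul_mem' {B C} hB hC := by
    refine ⟨fun A hA => ?_, fun A hA h => ?_⟩
    · rw [← mul_assoc]; exact hC.1 _ (hB.1 A hA)
    · rw [← mul_assoc]; exact hC.2 _ (hB.1 A hA) (hB.2 A hA h)
  add_mem' {B C} hB hC := by
    refine ⟨fun A hA => ?_, fun A hA h s => ?_⟩
    · rw [mul_add]; exact add_mem (hB.1 A hA) (hC.1 A hA)
    · rw [mul_add, SkewMonoidAlgebra.coeff_add, Finsupp.add_apply, mul_add]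
      exact (hB.2 A hA h s).add (hC.2 A hA h s)
  algebraMap_mem' c := by
    refine ⟨fun A hA => ?_, fun A hA h s => ?_⟩
    · rw [← Algebra.commutes, ← Algebra.smul_def]; exact Submodule.smul_mem _ c hA
    · rw [← Algebra.commutes, ← Algebra.smul_def, SkewMonoidAlgebra.coeff_smul, Finsupp.smul_apply,
        mul_smul_comm]
      exact (h s).smul c

/-- `poleOps` is not closed under products, as poles along translates of `z₁ = 0` may appear. What
extends to the enveloping algebra is the stability under right multiplication. -/
theorem glOp_mem_stableOps (x : Gl n) : glOp x ∈ stableOps ho :=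
  ⟨fun _ hA => mul_mem_invOps ho hA (glOp_mem_poleOps ho x) (tauR_glOp ho.1 x),
    fun _ hA h => isFlat_mul ho hA (glOp_mem_poleOps ho x) h⟩

end flat

/-- A property of elements of the enveloping algebra that holds on `gl_n` and is stable under the
algebra operations holds everywhere. -/
theorem mem_of_ι_mem {n : ℕ} (S : Subalgebra ℂ (U n))
    (h : ∀ x : Gl n, UniversalEnvelopingAlgebra.ι ℂ x ∈ S) (u : U n) : u ∈ S := by
  let f : Gl n →ₗ⁅ℂ⁆ S :=
    { toFun := fun x => ⟨UniversalEnvelopingAlgebra.ι ℂ x, h x⟩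
      map_add' := fun x y => Subtype.ext (map_add _ x y)
      map_smul' := fun c x => Subtype.ext (map_smul _ c x)
      map_lie' := fun {x y} => Subtype.ext (LieHom.map_lie _ x y) }
  have e : S.val.comp (UniversalEnvelopingAlgebra.lift ℂ f) = AlgHom.id ℂ (U n) := by
    refine UniversalEnvelopingAlgebra.hom_ext ℂ (LieHom.ext fun x => ?_)
    change S.val (UniversalEnvelopingAlgebra.lift ℂ f (UniversalEnvelopingAlgebra.ι ℂ x)) = _
    rw [UniversalEnvelopingAlgebra.lift_ι_apply]
    rfl
  have := DFunLike.congr_fun e u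
  change (UniversalEnvelopingAlgebra.lift ℂ f u : U n) = u at this
  rw [← this]
  exact Subtype.coe_prop _

section action

variable {n : ℕ} {a b : Idx n} {o : V n} (ho : IsOneSingular a b o)
include ho

theorem gtOp_mem_stableOps (u : U n) : gtOp u ∈ stableOps ho := by
  refine mem_of_ι_mem
    { carrier := {u | gtOp u ∈ stableOps ho}
      mul_mem' := fun {u v} hu hv => by
        change gtOp (u * v) ∈ stableOps ho; rw [gtOp_mul]; exact mul_mem hv hu
      add_mem' := fun {u v} hu hv => by
        change gtOp (u + v) ∈ stableOps ho; rw [gtOp_add]; exact add_mem hu hv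
      algebraMap_mem' := fun c => by
        change gtOp (algebraMap ℂ (U n) c) ∈ stableOps ho
        rw [Algebra.algebraMap_eq_smul_one, gtOp_smul, gtOp_one]
        exact Subalgebra.smul_mem _ (one_mem _) c }
    (fun x => glOp_mem_stableOps ho x) u

/-- Right multiplication by the operator of `u` on the invariant operators. -/
noncomputable def mulRightOp (u : U n) : invOps ho →ₗ[ℂ] invOps ho where
  toFun A := ⟨A.1 * gtOp u, (gtOp_mem_stableOps ho u).1 A.1 A.2⟩
  map_add' A B := Subtype.ext (add_mul A.1 B.1 _)
  map_smul' c A := Subtype.ext (smul_mul_assoc c A.1 _)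

theorem coe_mulRightOp (u : U n) (A : invOps ho) : (mulRightOp ho u A : R n) = A.1 * gtOp u := rfl

/-- A linear section of the map to the span. -/
noncomputable def spanSection : spanD a b o →ₗ[ℂ] invOps ho :=
  ((toSpan ho).exists_rightInverse_of_surjective (range_toSpan ho)).choose

theorem toSpan_spanSection (m : spanD a b o) : toSpan ho (spanSection ho m) = m :=
  LinearMap.congr_fun
    ((toSpan ho).exists_rightInverse_of_surjective (range_toSpan ho)).choose_spec m

/-- This makes `D ↦ D ∘ Φ(u)` independent of the operator representing `D`, and the action
independent of the chosen section. -/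
theorem toSpan_mulRightOp_congr (u : U n) {A B : invOps ho} (h : toSpan ho A = toSpan ho B) :
    toSpan ho (mulRightOp ho u A) = toSpan ho (mulRightOp ho u B) := by
  rw [← sub_eq_zero, ← map_sub, toSpan_eq_zero_iff] at h
  rw [← sub_eq_zero, ← map_sub (toSpan ho), ← map_sub (mulRightOp ho u), toSpan_eq_zero_iff]
  exact (gtOp_mem_stableOps ho u).2 _ (A - B).2 h

theorem toSpan_mulRightOp_section (u : U n) (A : invOps ho) :
    toSpan ho (mulRightOp ho u (spanSection ho (toSpan ho A))) = toSpan ho (mulRightOp ho u A) :=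
  toSpan_mulRightOp_congr ho u (toSpan_spanSection ho _)

/-- The action of the enveloping algebra on the span, `D ↦ D ∘ Φ(u)`. -/
noncomputable def spanAction : U n →ₐ[ℂ] Module.End ℂ (spanD a b o) :=
  AlgHom.ofLinearMap
    { toFun := fun u => (toSpan ho).comp ((mulRightOp ho u).comp (spanSection ho))
      map_add' := fun u v => by
        ext1 m
        change toSpan ho (mulRightOp ho (u + v) _) = toSpan ho _ + toSpan ho _
        rw [← map_add]
        congr 1
        exact Subtype.ext (by
          rw [coe_mulRightOp, gtOp_add, mul_add]; rfl)
      map_smul' := fun c u => by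
        ext1 m
        change toSpan ho (mulRightOp ho (c • u) _) = c • toSpan ho _
        rw [← map_smul]
        congr 1
        exact Subtype.ext (by
          rw [coe_mulRightOp, gtOp_smul, mul_smul_comm]; rfl) }
    (by
      ext1 m
      change toSpan ho (mulRightOp ho 1 (spanSection ho m)) = m
      have e : mulRightOp ho 1 (spanSection ho m) = spanSection ho m :=
        Subtype.ext (by rw [coe_mulRightOp, gtOp_one, mul_one])
      rw [e, toSpan_spanSection])
    -- Right multiplication reverses products, and so does `gtOp`; together they give a left action.
    (fun u v => by
      ext1 m
      change toSpan ho (mulRightOp ho (u * v) (spanSection ho m)) =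
        toSpan ho (mulRightOp ho u (spanSection ho
          (toSpan ho (mulRightOp ho v (spanSection ho m)))))
      rw [toSpan_mulRightOp_section]
      congr 1
      exact Subtype.ext (by
        rw [coe_mulRightOp, coe_mulRightOp, coe_mulRightOp, gtOp_mul, mul_assoc]))

theorem spanAction_toSpan (u : U n) (A : invOps ho) :
    spanAction ho u (toSpan ho A) = toSpan ho (mulRightOp ho u A) :=
  toSpan_mulRightOp_section ho u A

/-- The action of `gl_n` on the span. -/
noncomputable def spanRep : Gl n →ₗ⁅ℂ⁆ Module.End ℂ (spanD a b o) :=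
  (UniversalEnvelopingAlgebra.lift ℂ).symm (spanAction ho)

theorem lift_spanRep : UniversalEnvelopingAlgebra.lift ℂ (spanRep ho) = spanAction ho :=
  (UniversalEnvelopingAlgebra.lift ℂ).apply_symm_apply _

theorem lift_spanRep_toSpan (u : U n) (A : R n) (hA : A ∈ invOps ho) :
    (∃ h : A * gtOp u ∈ Adm a b o,
      (UniversalEnvelopingAlgebra.lift ℂ (spanRep ho) u (toSpan ho ⟨A, hA⟩) :
        Module.Dual ℂ (Entire n)) = Ldist a b o ⟨_, h⟩) ∧
    UniversalEnvelopingAlgebra.lift ℂ (spanRep ho) u (toSpan ho ⟨A, hA⟩) =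
      (1 / 2 : ℂ) • expansion a b o (z a b) (A * gtOp u) := by
  rw [lift_spanRep, spanAction_toSpan]
  exact ⟨⟨invOps_le_Adm ho (mulRightOp ho u ⟨A, hA⟩).2, coe_toSpan ho _⟩, toSpan_eq ho _⟩

theorem spanRep_apply (x : Gl n) :
    spanRep ho x = spanAction ho (UniversalEnvelopingAlgebra.ι ℂ x) := rfl

/-- The action on `𝓛 ∘ (A + τ(A))`, in terms of the coefficients of `A ∘ Φ(x)` alone. -/
theorem spanRep_toSpan_add_tauR (x : Gl n) {A : R n} (hA : A + tauR ho.1 A ∈ invOps ho)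
    (hAx : A * glOp x ∈ Adm a b o) :
    spanRep ho x (toSpan ho ⟨_, hA⟩) = expansion a b o (z a b) (A * glOp x) := by
  rw [spanRep_apply, spanAction_toSpan]
  refine Subtype.ext ?_
  rw [← Ldist_add_tauR ho hAx, coe_toSpan]
  congr 1
  refine Subtype.ext ?_
  change (A + tauR ho.1 A) * glOp x = A * glOp x + tauR ho.1 (A * glOp x)
  rw [map_mul, tauR_glOp, add_mul]

/-- A single `σ` is not invariant, but its coefficient `1` has no pole, so at most the simple pole
of `glOp x` remains. -/
theorem single_mul_glOp_mem_Adm (x : Gl n) (σ : Γ n) :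
    SkewMonoidAlgebra.single σ 1 * glOp x ∈ Adm a b o := fun s => by
  rw [SkewMonoidAlgebra.coeff_single_mul, one_mul]
  by_cases hσ : vec σ a = vec σ b
  · have e : z a b * σ • (glOp x).coeff (σ⁻¹ * s) = σ • (z a b * (glOp x).coeff (σ⁻¹ * s)) := by
      rw [smul_mul', smul_z_of_eq hσ]
    rw [e]
    exact (glOp_mem_poleOps ho x _ σ).1
  · exact (isHol_z a b o).mul (smul_mem_reg_of_ne ho (glOp_mem_poleOps ho x _) hσ).1

theorem isHol_coeff_single_mul_glOp (x : Gl n) {σ : Γ n} (hσ : conj a b σ ≠ σ) (s : Γ n) :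
    IsHol o ((SkewMonoidAlgebra.single σ 1 * glOp x).coeff s) := by
  rw [SkewMonoidAlgebra.coeff_single_mul, one_mul]
  exact (smul_mem_reg_of_ne ho (glOp_mem_poleOps ho x _)
    (mt (conj_eq_self_iff ho.1 σ).2 hσ)).1

theorem spanRep_v₁ (x : Gl n) (σ : Γ n) : spanRep ho x (v₁ a b o σ) =
    expansion a b o (z a b) (SkewMonoidAlgebra.single σ 1 * glOp x) := by
  have h := op₁_mem_invOps ho σ
  rw [op₁_eq ho] at h
  rw [← spanRep_toSpan_add_tauR ho x h (single_mul_glOp_mem_Adm ho x σ)]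
  congr 1
  rw [← toSpan_op₁ ho]
  congr 1
  exact Subtype.ext (op₁_eq ho σ)

/-- With `A = z₁⁻¹ σ` the factor `z₁` in the expansion cancels `z₁⁻¹`. The remaining coefficients
are holomorphic at `o` because `σ` is not fixed by the involution. -/
theorem spanRep_v₂ (x : Gl n) {σ : Γ n} (hσ : conj a b σ ≠ σ) : spanRep ho x (v₂ a b o σ) =
    expansion a b o 1 (SkewMonoidAlgebra.single σ 1 * glOp x) := by
  have hz := z_ne_zero (n := n) ho.2.1
  have h := op₂_mem_invOps ho σ
  rw [op₂_eq ho] at h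
  set B := SkewMonoidAlgebra.single σ 1 * glOp x with hB
  set A := SkewMonoidAlgebra.single σ (z a b)⁻¹ * glOp x with hA
  have hc : ∀ s, z a b * A.coeff s = B.coeff s := fun s => by
    rw [hA, hB, SkewMonoidAlgebra.coeff_single_mul, SkewMonoidAlgebra.coeff_single_mul, one_mul,
      mul_inv_cancel_left₀ hz]
  have hAdm : A ∈ Adm a b o := fun s => by
    rw [hc]; exact isHol_coeff_single_mul_glOp ho x hσ s
  have e : expansion a b o (z a b) A = expansion a b o 1 B := by
    have hsupp : A.support = B.support := by
      ext s
      rw [SkewMonoidAlgebra.mem_support_iff, SkewMonoidAlgebra.mem_support_iff, ← hc,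
        mul_ne_zero_iff]
      exact (and_iff_right hz).symm
    rw [expansion, expansion, hsupp]
    exact Finset.sum_congr rfl fun s _ => by rw [hc, one_mul]
  rw [← e, ← spanRep_toSpan_add_tauR ho x h hAdm]
  congr 1
  rw [← toSpan_op₂ ho]
  congr 1
  exact Subtype.ext (op₂_eq ho σ)

end action

end GT

/-! ### The assembled theorem -/

theorem mainTheorem3 {n : ℕ} (a b : GT.Idx n) (o : GT.V n) (ho : GT.IsOneSingular a b o) :
    -- the span has exactly the relations `D¹_{τ(σ)} = D¹_σ`, `D²_{τ(σ)} = - D²_σ`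
    (∀ σ, GT.D₁ a b o (GT.conj a b σ) = GT.D₁ a b o σ) ∧
    (∀ σ, GT.D₂ a b o (GT.conj a b σ) = -GT.D₂ a b o σ) ∧
    LinearMap.ker (GT.symbolMap a b o) = GT.relations a b ∧
    -- the Gelfand–Tsetlin formulas define a homomorphism `Φ`
    ∃ Φ : GT.U n →ₐ[ℂ] (GT.R n)ᵐᵒᵖ, GT.IsGTHom Φ ∧ (∀ Ψ, GT.IsGTHom Ψ → Ψ = Φ) ∧
    -- the span is a `gl_n(ℂ)`-module
    ∃ ρ : GT.Gl n →ₗ⁅ℂ⁆ Module.End ℂ (GT.spanD a b o),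
      -- `u` acts by `D ↦ D ∘ Φ(u)`, explicitly by the expansion formula
      (∀ (u : GT.U n) (σ : GT.Γ n),
        (∃ h : GT.op₁ a b σ * (Φ u).unop ∈ GT.Adm a b o,
          (UniversalEnvelopingAlgebra.lift ℂ ρ u (GT.v₁ a b o σ) : Module.Dual ℂ (GT.Entire n)) =
            GT.Ldist a b o ⟨_, h⟩) ∧
        UniversalEnvelopingAlgebra.lift ℂ ρ u (GT.v₁ a b o σ) =
          (1 / 2 : ℂ) • GT.expansion a b o (GT.z a b) (GT.op₁ a b σ * (Φ u).unop) ∧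
        (∃ h : GT.op₂ a b σ * (Φ u).unop ∈ GT.Adm a b o,
          (UniversalEnvelopingAlgebra.lift ℂ ρ u (GT.v₂ a b o σ) : Module.Dual ℂ (GT.Entire n)) =
            GT.Ldist a b o ⟨_, h⟩) ∧
        UniversalEnvelopingAlgebra.lift ℂ ρ u (GT.v₂ a b o σ) =
          (1 / 2 : ℂ) • GT.expansion a b o (GT.z a b) (GT.op₂ a b σ * (Φ u).unop)) ∧
      -- with `T(σ⁻¹(o)) = D¹_σ` and `𝓓T(σ⁻¹(o)) = D²_σ` this is the action on the universal
      -- `1`-singular Gelfand–Tsetlin module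
      (∀ (x : GT.Gl n) (σ : GT.Γ n),
        (∀ s, GT.IsHol o (GT.z a b * (SkewMonoidAlgebra.single σ 1 *
          (Φ (UniversalEnvelopingAlgebra.ι ℂ x)).unop).coeff s)) ∧
        ρ x (GT.v₁ a b o σ) = GT.expansion a b o (GT.z a b)
          (SkewMonoidAlgebra.single σ 1 * (Φ (UniversalEnvelopingAlgebra.ι ℂ x)).unop) ∧
        (GT.conj a b σ ≠ σ →
          (∀ s, GT.IsHol o ((SkewMonoidAlgebra.single σ 1 *
            (Φ (UniversalEnvelopingAlgebra.ι ℂ x)).unop).coeff s)) ∧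
          ρ x (GT.v₂ a b o σ) = GT.expansion a b o 1
            (SkewMonoidAlgebra.single σ 1 * (Φ (UniversalEnvelopingAlgebra.ι ℂ x)).unop))) := by
  refine ⟨GT.D₁_conj ho, GT.D₂_conj ho, GT.ker_symbolMap ho, GT.gtHom n, GT.isGTHom_gtHom n,
    fun Ψ hΨ => (GT.isGTHom_gtHom n).eq hΨ, GT.spanRep ho, fun u σ => ?_, fun x σ => ?_⟩
  · have h₁ := GT.lift_spanRep_toSpan ho u _ (GT.op₁_mem_invOps ho σ)
    have h₂ := GT.lift_spanRep_toSpan ho u _ (GT.op₂_mem_invOps ho σ)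
    exact ⟨h₁.1, h₁.2, h₂.1, h₂.2⟩
  · exact ⟨GT.single_mul_glOp_mem_Adm ho x σ, GT.spanRep_v₁ ho x σ,
      fun hσ => ⟨GT.isHol_coeff_single_mul_glOp ho x hσ, GT.spanRep_v₂ ho x hσ⟩⟩
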